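/- **Setting.** Let $G=(\rho,V,E)$ be a rooted directed graph with root $\rho=0$, nodes $V=\{0,1,\dots,N\}$, and real edge weights $w_{ij}\ge 0$ with $w_{ij}=0$ if $(i,j)\notin E$. A *dependency tree* of $G$ is a set $t\subseteq E$ without directed cycles such that every node $j\neq\rho$ has exactly one incoming edge in $t$ and exactly one edge of $t$ leaves $\rho$. Let $\mathcal D$ be the set of dependency trees, $w(t)=\prod_{(i,j)\in t}w_{ij}$, $Z=\sum_{t\in\mathcal D}w(t)$, and for $D\subseteq\mathcal D$ let $$Z_D=\sum_{t\in\mathcal D\setminus D}w(t)=Z-\sum_{t\in D}w(t),\qquad p(t\mid D)=\frac{\mathbf 1[t\notin D]}{Z_D}\,w(t).$$ **The algorithm** $\mathrm{swor}(G,K)$. Build the $N\times N$ matrix $L'$ with $L'_{1j}=w_{\rho j}$ and, for $i\ge 2$, $L'_{ii}=\sum_{i'\neq\rho,i}w_{i'i}$ and $L'_{ij}=-w_{ij}$ for $j\ne i$. Compute $Z'=\det L'$ and $B'=(L')^{-\top}$ by Gauss–Jordan elimination. Put $D'=[\,]$, $Z'_D=Z'$. Repeat $K$ times: set $(L,B,Z,D,Z_D)\gets(L',B',Z',D',Z'_D)$;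 for $j=1,\dots,N$ do the following. 1. *Sample an edge.* With $D_{ij}=\{t\in D:(i,j)\in t\}$, compute $m_\rho=Z\,w_{\rho j}B_{1j}-\sum_{t\in D_{\rho j}}w(t)$, $m_j=0$, and $m_i=Z\,w_{ij}\bigl(\mathbf 1[j\ne1]B_{jj}-\mathbf 1[i\neq1]B_{ij}\bigr)-\sum_{t\in D_{ij}}w(t)$ for $i\ne\rho,j$. Draw $i$ with probabilities $\frac1{Z_D}m$ (abort if this is not a probability vector) and append the edge $e=(i,j)$ to the new tree. 2. *Condition on it.* Let $u=w_{\rho j}e_1-L_{[:,j]}$ if $i=\rho$, and $u=w_{ij}(\mathbf 1[j\ne1]e_j-\mathbf 1[i\neq1]e_i)-L_{[:,j]}$ otherwise, and let $s=1+u^\top B_{[:,j]}$. Set $L_{[:,j]}\gets L_{[:,j]}+u$, $Z\gets sZ$, $B\gets B-B_{[:,j]}(u^\top B)/s$, $D\gets D_{ij}$, $Z_D\gets Z-\sum_{t\in D}w(t)$. Then append the new tree $t$ to $D'$ and set $Z'_D\gets Z'_D-w(t)$. Finally return $D'$. The algorithm is one fixed program for a randomized real RAM with exact real arithmetic and unit-cost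 arithmetic, memory access and tests, on which drawing an index from an explicitly given probability vector costs a number of steps linear in the length of the vector. **Theorem.** 1. Let $K>0$ and suppose that $G$ has at least $K$ dependency trees of positive weight. Then, with probability one, $\mathrm{swor}(G,K)$ does not abort and returns a list $t_1,\dots,t_K$ of $K$ pairwise distinct dependency trees of $G$. Each tree is drawn with probability $p(t\mid D)$, where $D$ is the set of trees drawn before it: for all $k<K$, all lists $(s_1,\dots,s_k)$ and all $t\in\mathcal D$, $$\Pr[t_1=s_1,\dots,t_k=s_k,\ t_{k+1}=t]=\Pr[t_1=s_1,\dots,t_k=s_k]\cdot p(t\mid\{s_1,\dots,s_k\}).$$ 2. There is an absolute constant $C$ such that, for all $N,K\ge 1$, every graph $G$ with $N$ non-root nodes, and every outcome of the random draws, $\mathrm{swor}(G,K)$ makes at most $C\,(KN^3+K^2N)$ steps. -/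

import Mathlib

/-! ## Rooted weighted graphs and dependency trees

The nodes are `0, …, N`, the root is `0`. -/

abbrev EdgeSet (N : ℕ) := Finset (Fin (N + 1) × Fin (N + 1))

/-- A rooted directed graph with non-negative edge weights; `(i, j)` is the edge from `i` to `j`. -/
structure RootedGraph (N : ℕ) where
  edges : EdgeSet N
  weight : Fin (N + 1) → Fin (N + 1) → ℝ
  weight_nonneg : ∀ i j, 0 ≤ weight i j
  weight_eq_zero : ∀ i j, (i, j) ∉ edges → weight i j = 0

namespace RootedGraph

variable {N : ℕ}

/-- Every non-root node has exactly one incoming edge, and there is no directed cycle. -/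
def IsSpanningTree (G : RootedGraph N) (t : EdgeSet N) : Prop :=
  t ⊆ G.edges ∧ (∀ j : Fin (N + 1), j ≠ 0 → ∃! i, (i, j) ∈ t) ∧
    ∀ v, ¬ Relation.TransGen (fun a b => (a, b) ∈ t) v v

/-- A spanning tree in which exactly one edge leaves the root. -/
def IsDependencyTree (G : RootedGraph N) (t : EdgeSet N) : Prop :=
  G.IsSpanningTree t ∧ ∃! j, ((0 : Fin (N + 1)), j) ∈ t

open Classical in
/-- The finite set of all dependency trees of `G`. -/
noncomputable def depTrees (G : RootedGraph N) : Finset (EdgeSet N) :=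
  Finset.univ.filter G.IsDependencyTree

/-- The weight of a tree: the product of its edge weights. -/
noncomputable def treeWeight (G : RootedGraph N) (t : EdgeSet N) : ℝ :=
  ∏ e ∈ t, G.weight e.1 e.2

/-- `Z_D`, the total weight of the dependency trees outside `D`. -/
noncomputable def partitionOutside (G : RootedGraph N) (D : Finset (EdgeSet N)) : ℝ :=
  ∑ t ∈ G.depTrees \ D, G.treeWeight t

/-- `p(t ∣ D) = 1[t ∉ D] · w(t) / Z_D`. -/
noncomputable def condProb (G : RootedGraph N) (D : Finset (EdgeSet N)) (t : EdgeSet N) : ℝ :=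
  (if t ∉ D then 1 else 0) / G.partitionOutside D * G.treeWeight t

end RootedGraph

/-! ## A unit-cost randomized real RAM

Programs are built from assignments, conditionals, counted loops and draws from an explicitly given
finite probability vector. The memory holds natural-number and real registers and two-index arrays
of naturals and of reals. Every node of an evaluated expression (constant, register, array access,
arithmetic operation, test) costs one step, every executed statement and every loop iteration costs
one more, and a draw from a vector costs in addition one step per entry of the vector. -/

namespace RealRAM

/-- Natural-number registers. -/
inductive NVar
  | nN | nK | vk | vj | ve | vr | vc | vq | vs | vt | vd | vd2 | vpiv
  deriving DecidableEq

/-- Real registers. -/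
inductive RVar
  | xZ | xZD | xZ0 | xZD0 | xp | xf | xtmp
  deriving DecidableEq

/-- Arrays of natural numbers. -/
inductive NArr
  | aT | aD
  deriving DecidableEq

/-- Arrays of real numbers. -/
inductive RArr
  | aW | aL | aB | aL0 | aB0 | aA | aR | aS | aM | aU | aV | aC | aWt
  deriving DecidableEq

structure Store where
  nvar : NVar → ℕ
  rvar : RVar → ℝ
  narr : NArr → ℕ → ℕ → ℕ
  rarr : RArr → ℕ → ℕ → ℝ

inductive NExp
  | lit (n : ℕ)
  | var (x : NVar)
  | get (a : NArr) (i j : NExp)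
  | succ (e : NExp)

/-- `indEq a b` is `1` if `a = b` and `0` otherwise; `indNe a b` is `1` if `a ≠ b`, else `0`. -/
inductive RExp
  | lit (n : ℕ)
  | var (x : RVar)
  | get (a : RArr) (i j : NExp)
  | indEq (a b : NExp)
  | indNe (a b : NExp)
  | neg (a : RExp)
  | add (a b : RExp)
  | sub (a b : RExp)
  | mul (a b : RExp)
  | div (a b : RExp)

inductive BExp
  | eqN (a b : NExp)
  | isZero (a : RExp)

/-- `loop x lo hi body` runs `body` with `x = lo, lo + 1, …, hi`; the bounds are evaluated once.
`draw x a n` draws an index `x` from `{0, …, n}` with probabilities `a[0, 0], …, a[0, n]`. -/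
inductive Stmt
  | skip
  | setN (x : NVar) (e : NExp)
  | setR (x : RVar) (e : RExp)
  | putN (a : NArr) (i j e : NExp)
  | putR (a : RArr) (i j : NExp) (e : RExp)
  | seq (s₁ s₂ : Stmt)
  | ite (b : BExp) (s₁ s₂ : Stmt)
  | loop (x : NVar) (lo hi : NExp) (body : Stmt)
  | draw (x : NVar) (a : RArr) (n : NExp)

def NExp.eval (σ : Store) : NExp → ℕ
  | .lit n => n
  | .var x => σ.nvar x
  | .get a i j => σ.narr a (i.eval σ) (j.eval σ)
  | .succ e => e.eval σ + 1

def NExp.cost : NExp → ℕ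
  | .lit _ => 1
  | .var _ => 1
  | .get _ i j => i.cost + j.cost + 1
  | .succ e => e.cost + 1

noncomputable def RExp.eval (σ : Store) : RExp → ℝ
  | .lit n => n
  | .var x => σ.rvar x
  | .get a i j => σ.rarr a (i.eval σ) (j.eval σ)
  | .indEq a b => if a.eval σ = b.eval σ then 1 else 0
  | .indNe a b => if a.eval σ ≠ b.eval σ then 1 else 0
  | .neg a => - a.eval σ
  | .add a b => a.eval σ + b.eval σ
  | .sub a b => a.eval σ - b.eval σ
  | .mul a b => a.eval σ * b.eval σ
  | .div a b => a.eval σ / b.eval σ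

def RExp.cost : RExp → ℕ
  | .lit _ => 1
  | .var _ => 1
  | .get _ i j => i.cost + j.cost + 1
  | .indEq a b => a.cost + b.cost + 1
  | .indNe a b => a.cost + b.cost + 1
  | .neg a => a.cost + 1
  | .add a b => a.cost + b.cost + 1
  | .sub a b => a.cost + b.cost + 1
  | .mul a b => a.cost + b.cost + 1
  | .div a b => a.cost + b.cost + 1

def BExp.holds (σ : Store) : BExp → Prop
  | .eqN a b => a.eval σ = b.eval σ
  | .isZero a => a.eval σ = 0

def BExp.cost : BExp → ℕ
  | .eqN a b => a.cost + b.cost + 1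
  | .isZero a => a.cost + 1

/-- The law of a run: the final memory (`none` if the run was aborted) and the number of steps. -/
abbrev RunLaw := PMF (Option Store × ℕ)

/-- A deterministic step of the given cost. -/
noncomputable def done (σ : Store) (c : ℕ) : RunLaw := PMF.pure (some σ, c)

noncomputable def charge (c : ℕ) (p : RunLaw) : RunLaw := p.map fun r => (r.1, c + r.2)

/-- Sequential composition: costs add up, and an aborted run stays aborted. -/
noncomputable def andThen (p : RunLaw) (f : Store → RunLaw) : RunLaw :=
  p.bind fun r => match r.1 with
    | none => PMF.pure (none, r.2)
    | some σ => charge r.2 (f σ)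

/-- Run `f x` for the entries `x` of a list, in order, with one extra step per iteration. -/
noncomputable def iter (f : ℕ → Store → RunLaw) : List ℕ → Store → RunLaw
  | [], σ => done σ 0
  | x :: xs, σ => andThen (charge 1 (f x σ)) (iter f xs)

/-- `p 0, …, p n` is a probability vector. -/
def IsProbVector (n : ℕ) (p : ℕ → ℝ) : Prop :=
  (∀ i ∈ Finset.range (n + 1), 0 ≤ p i) ∧ ∑ i ∈ Finset.range (n + 1), p i = 1

/-- The law on `{0, …, n}` with probabilities `p 0, …, p n`. -/
noncomputable def indexLaw (n : ℕ) (p : ℕ → ℝ) (h : IsProbVector n p) : PMF ℕ :=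
  PMF.ofFinset (fun i => if i ∈ Finset.range (n + 1) then ENNReal.ofReal (p i) else 0)
    (Finset.range (n + 1))
    (by
      rw [Finset.sum_congr rfl fun i hi => if_pos hi, ← ENNReal.ofReal_sum_of_nonneg h.1, h.2,
        ENNReal.ofReal_one])
    (fun _ hi => if_neg hi)

open Classical in
/-- The meaning of a statement. A draw from numbers that do not form a probability vector aborts
the run. -/
noncomputable def Stmt.run : Stmt → Store → RunLaw
  | .skip, σ => done σ 1
  | .setN x e, σ => done { σ with nvar := Function.update σ.nvar x (e.eval σ) } (e.cost + 1)
  | .setR x e, σ => done { σ with rvar := Function.update σ.rvar x (e.eval σ) } (e.cost + 1)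
  | .putN a i j e, σ =>
      done { σ with narr := Function.update σ.narr a (Function.update (σ.narr a) (i.eval σ)
        (Function.update (σ.narr a (i.eval σ)) (j.eval σ) (e.eval σ))) }
        (i.cost + j.cost + e.cost + 1)
  | .putR a i j e, σ =>
      done { σ with rarr := Function.update σ.rarr a (Function.update (σ.rarr a) (i.eval σ)
        (Function.update (σ.rarr a (i.eval σ)) (j.eval σ) (e.eval σ))) }
        (i.cost + j.cost + e.cost + 1)
  | .seq s₁ s₂, σ => andThen (s₁.run σ) s₂.run
  | .ite b s₁ s₂, σ => charge (b.cost + 1) (if b.holds σ then s₁.run σ else s₂.run σ)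
  | .loop x lo hi body, σ =>
      charge (lo.cost + hi.cost + 1)
        (iter (fun v τ => body.run { τ with nvar := Function.update τ.nvar x v })
          (List.range' (lo.eval σ) (hi.eval σ + 1 - lo.eval σ)) σ)
  | .draw x a n, σ =>
      if h : IsProbVector (n.eval σ) (σ.rarr a 0) then
        (indexLaw (n.eval σ) (σ.rarr a 0) h).map fun v =>
          (some { σ with nvar := Function.update σ.nvar x v }, n.cost + (n.eval σ + 1) + 1)
      else PMF.pure (none, n.cost + (n.eval σ + 1) + 1)

end RealRAM

/-! ## The program `swor`

Registers and arrays: `nN`, `nK` are the numbers of non-root nodes and of samples and `aW` the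
weights (the input); `aL0`, `aB0`, `xZ0`, `xZD0` are the Laplacian, its inverse transpose, its
determinant and `Z_D` for the input graph; `aL`, `aB`, `xZ`, `xZD` are the same for the graph
conditioned on the edges drawn so far. Row `k` of `aT` is the `k`-th tree (`aT[k, j]` is the tail of
its edge into `j`) and `aWt[0, k]` its weight. The earlier trees that contain all edges drawn so far
are numbers `aD[0, 1], …, aD[0, vd]`. Matrices have rows and columns `1, …, N`; vectors live in
row `0` of an array. -/

namespace RealRAM

section Programs

open NVar RVar NArr RArr Stmt BExp

local infixr:40 " ;; " => Stmt.seq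
local infixl:65 " +ᵣ " => RExp.add
local infixl:65 " -ᵣ " => RExp.sub
local infixl:70 " *ᵣ " => RExp.mul
local infixl:70 " /ᵣ " => RExp.div

instance : Coe NVar NExp := ⟨NExp.var⟩
instance : Coe RVar RExp := ⟨RExp.var⟩

/-- The constants `0` and `1` as index expressions. -/
abbrev n0 : NExp := .lit 0
abbrev n1 : NExp := .lit 1

/-- The Laplacian of the input graph: `L[i, j] = -w(i, j)` for `i ≠ j` and
`L[j, j] = ∑ w(i, j)` over `i ≠ 0, j`, and then the first row is replaced by `w(0, j)`. -/
def laplacian : Stmt :=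
  loop vj n1 nN (
    putR aL0 vj vj (.lit 0) ;;
    loop vr n1 nN (
      ite (eqN vr vj) skip (
        putR aL0 vr vj (.neg (.get aW vr vj)) ;;
        putR aL0 vj vj (.get aL0 vj vj +ᵣ .get aW vr vj))) ;;
    putR aL0 n1 vj (.get aW n0 vj))

/-- One elimination step: exchange rows `c` and `piv` of `A` and `R`, divide row `c` by the pivot,
and clear the rest of column `c` of `A`. -/
def eliminate : Stmt :=
  ite (eqN vpiv vc) skip (
    setR xZ0 (.neg xZ0) ;;
    loop vq n1 nN (
      setR xtmp (.get aA vc vq) ;;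
      putR aA vc vq (.get aA vpiv vq) ;;
      putR aA vpiv vq xtmp ;;
      setR xtmp (.get aR vc vq) ;;
      putR aR vc vq (.get aR vpiv vq) ;;
      putR aR vpiv vq xtmp)) ;;
  setR xp (.get aA vc vc) ;;
  setR xZ0 (xZ0 *ᵣ xp) ;;
  loop vq n1 nN (
    putR aA vc vq (.get aA vc vq /ᵣ xp) ;;
    putR aR vc vq (.get aR vc vq /ᵣ xp)) ;;
  loop vr n1 nN (
    ite (eqN vr vc) skip (
      setR xf (.get aA vr vc) ;;
      loop vq n1 nN (
        putR aA vr vq (.get aA vr vq -ᵣ xf *ᵣ .get aA vc vq) ;;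
        putR aR vr vq (.get aR vr vq -ᵣ xf *ᵣ .get aR vc vq))))

/-- Gauss-Jordan elimination on `[L0 | I]`: `Z0 = det L0`, and `B0` is the inverse transpose of
`L0` if `Z0 ≠ 0`. -/
def detAndInverse : Stmt :=
  loop vr n1 nN (loop vq n1 nN (
    putR aA vr vq (.get aL0 vr vq) ;;
    putR aR vr vq (.indEq vr vq))) ;;
  setR xZ0 (.lit 1) ;;
  loop vc n1 nN (
    setN vpiv n0 ;;
    loop vr vc nN (
      ite (eqN vpiv n0)
        (ite (isZero (.get aA vr vc)) skip (setN vpiv vr))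
        skip) ;;
    ite (eqN vpiv n0) (setR xZ0 (.lit 0)) eliminate) ;;
  loop vr n1 nN (loop vq n1 nN (putR aB0 vr vq (.get aR vq vr)))

/-- Draw the tail `ve` of the edge into `vj`. Here `S[i]` is the total weight of the trees of the
current `D` that contain the edge `(i, j)`. -/
def sampleEdge : Stmt :=
  loop vr n0 nN (putR aS n0 vr (.lit 0)) ;;
  loop vs n1 vd (
    setN vt (.get aD n0 vs) ;;
    putR aS n0 (.get aT vt vj) (.get aS n0 (.get aT vt vj) +ᵣ .get aWt n0 vt)) ;;
  putR aM n0 n0 (xZ *ᵣ (.get aW n0 vj *ᵣ .get aB n1 vj) -ᵣ .get aS n0 n0) ;;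
  loop vr n1 nN (
    ite (eqN vr vj)
      (putR aM n0 vr (.lit 0))
      (putR aM n0 vr
        (xZ *ᵣ (.get aW vr vj *ᵣ
            (.indNe vj n1 *ᵣ .get aB vj vj -ᵣ .indNe vr n1 *ᵣ .get aB vr vj))
          -ᵣ .get aS n0 vr))) ;;
  loop vr n0 nN (putR aM n0 vr (.get aM n0 vr /ᵣ xZD)) ;;
  draw ve aM nN

/-- Condition `L`, `Z`, `B`, `D` and `Z_D` on the edge `(ve, vj)`. The new column `j` of `L` is
`L[:, j] + u`; with `p = 1 + ∑ r, u[r] * B[r, j]`, `Z` is multiplied by `p`, and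
`B[:, j] (uᵀ B) / p` is subtracted from `B`. -/
def condition : Stmt :=
  ite (eqN ve n0)
    (loop vr n1 nN (
      putR aU n0 vr (.get aW n0 vj *ᵣ .indEq vr n1 -ᵣ .get aL vr vj)))
    (loop vr n1 nN (
      putR aU n0 vr
        (.get aW ve vj *ᵣ
            (.indNe vj n1 *ᵣ .indEq vr vj -ᵣ .indNe ve n1 *ᵣ .indEq vr ve)
          -ᵣ .get aL vr vj))) ;;
  loop vr n1 nN (putR aL vr vj (.get aL vr vj +ᵣ .get aU n0 vr)) ;;
  setR xp (.lit 1) ;;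
  loop vr n1 nN (setR xp (xp +ᵣ .get aU n0 vr *ᵣ .get aB vr vj)) ;;
  setR xZ (xZ *ᵣ xp) ;;
  loop vq n1 nN (
    putR aV n0 vq (.lit 0) ;;
    loop vr n1 nN (putR aV n0 vq (.get aV n0 vq +ᵣ .get aU n0 vr *ᵣ .get aB vr vq))) ;;
  loop vr n1 nN (putR aC n0 vr (.get aB vr vj)) ;;
  loop vr n1 nN (loop vq n1 nN (
    putR aB vr vq (.get aB vr vq -ᵣ .get aC n0 vr *ᵣ .get aV n0 vq /ᵣ xp))) ;;
  setN vd2 n0 ;;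
  setR xZD xZ ;;
  loop vs n1 vd (
    setN vt (.get aD n0 vs) ;;
    ite (eqN (.get aT vt vj) ve)
      (setN vd2 (.succ vd2) ;;
        putN aD n0 vd2 vt ;;
        setR xZD (xZD -ᵣ .get aWt n0 vt))
      skip) ;;
  setN vd vd2

/-- Draw the tree number `vk`, given that trees `1, …, vd` with `vd = vk - 1` have been drawn
before. -/
def drawTree : Stmt :=
  loop vs n1 vd (putN aD n0 vs vs) ;;
  setR xZ xZ0 ;;
  setR xZD xZD0 ;;
  loop vr n1 nN (loop vq n1 nN (
    putR aL vr vq (.get aL0 vr vq) ;;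
    putR aB vr vq (.get aB0 vr vq))) ;;
  loop vj n1 nN (
    sampleEdge ;;
    putN aT vk vj ve ;;
    condition) ;;
  putR aWt n0 vk (.lit 1) ;;
  loop vj n1 nN (
    putR aWt n0 vk (.get aWt n0 vk *ᵣ .get aW (.get aT vk vj) vj)) ;;
  setR xZD0 (xZD0 -ᵣ .get aWt n0 vk) ;;
  setN vd vk

/-- The sampler without replacement, one fixed program for all graphs and all sample sizes. -/
def swor : Stmt :=
  laplacian ;;
  detAndInverse ;;
  setR xZD0 xZ0 ;;
  setN vd n0 ;;
  loop vk n1 nK drawTree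

end Programs

variable {N : ℕ}

/-- The initial memory: `N`, `K` and the weights of `G`; everything else is `0`. -/
def input (G : RootedGraph N) (K : ℕ) : Store where
  nvar x := if x = .nN then N else if x = .nK then K else 0
  rvar _ := 0
  narr _ _ _ := 0
  rarr a i j :=
    if a = .aW then
      if h : i < N + 1 ∧ j < N + 1 then G.weight ⟨i, h.1⟩ ⟨j, h.2⟩ else 0
    else 0

/-- The `k`-th tree held in the memory: its edges are `(aT[k, j], j)` for `j = 1, …, N`. -/
def readTree (N : ℕ) (σ : Store) (k : ℕ) : EdgeSet N :=
  Finset.univ.filter fun e => e.2 ≠ 0 ∧ σ.narr .aT k e.2 = (e.1 : ℕ)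

/-- The output, in the order in which the trees were drawn. -/
def readTrees (N K : ℕ) (σ : Store) : List (EdgeSet N) :=
  (List.range' 1 K).map (readTree N σ)

/-- The joint law of the output of `swor(G, K)` (`none`: aborted) and of the running time. -/
noncomputable def sworRun (G : RootedGraph N) (K : ℕ) : PMF (Option (List (EdgeSet N)) × ℕ) :=
  (swor.run (input G K)).map fun r => (r.1.map (readTrees N K), r.2)

/-- The probability that the first trees drawn by `swor(G, K)` are those of the list `D`. -/
noncomputable def prefixProb (G : RootedGraph N) (K : ℕ) (D : List (EdgeSet N)) : ENNReal :=
  (sworRun G K).toOuterMeasure {r | ∃ ts, r.1 = some ts ∧ D <+: ts}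

end RealRAM

/-! A set with one edge into each non-root node is a parent function. Column `j` of the modified
Laplacian is the sum, over the edges into `j`, of the weight times a fixed vector, so multilinearity
expands the determinant into a sum over parent functions of their weight times the determinant of a
matrix of edge vectors (`det_lap`). That determinant is `1` for a dependency tree and `0` otherwise
(`det_edgeMatrix`): along a cycle the columns telescope to zero, two root edges give equal columns,
and a tree with one root edge factors into a star and a unitriangular matrix. Hence `det L' = Z`.

Fixing the parent of `j` changes column `j` only. By Cramer's rule the partition function of the
conditioned graph is `Z` times a linear form in column `j` of `B` (`det_updateCol_eq`), which is the
first term of `m`; `B` follows by the Sherman-Morrison formula (`inverse_updateCol`). Subtracting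
the earlier trees that contain all chosen edges leaves `restWeight`, the mass of the unseen trees
that extend the current prefix. So `m / Z_D` is a ratio of consecutive masses. The masses of the
one-step extensions of a prefix add up to the mass of the prefix (`sum_restFuns_succ`), hence `m /
Z_D` is a probability vector, and along a tree the ratios telescope to `w(t) / Z_D`
(`ev_drawColumns`). Edges of mass zero are never drawn, so the mass stays positive and no division
by zero occurs.

On the program side, expectations `ev` of functions of the final memory are computed: draw-free code
acts through `exec`, loops through invariants (`Holds`, `Drawing`, `Drawn`), and the whole run
realises the ideal process `expectDraws` (`ev_swor`). Indicator functions then give both the almost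
sure statement and the prefix probabilities, which obey the chain rule `nextProb_append`.

The time bound is mostly a recursion on the program text (`within_bound`). Separate arguments are
needed for the number of listed trees, which conditioning never increases, and for the loops over
columns and trees: a column costs `O(N² + K)`, a tree `O(N³ + NK)`, the elimination `O(N³)`. -/

open scoped ENNReal

/-! ### Combinatorics: the matrix-tree theorem and the ideal sampling process -/

namespace Arborescence

open Finset

variable {N : ℕ}

/-! ## Parent functions

A set of edges with exactly one edge into each non-root node is given by a function
`f : Fin N → Fin (N + 1)`: `f c` is the parent of the node `c.succ`. -/

/-- A rank that drops from each node to its non-root parent serves as the definition because it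
supplies the ordering in which the matrices below are triangular. -/
def Acyclic (f : Fin N → Fin (N + 1)) : Prop :=
  ∃ d : Fin N → ℕ, ∀ c k, f c = k.succ → d k < d c

/-- `f` describes a tree with exactly one edge from the root. -/
def IsDep (f : Fin N → Fin (N + 1)) : Prop :=
  Acyclic f ∧ ∃! c, f c = 0

/-- The parent, as a non-root node; the node itself if the parent is the root. -/
def up (f : Fin N → Fin (N + 1)) (c : Fin N) : Fin N :=
  if h : f c = 0 then c else (f c).pred h

theorem succ_up {f : Fin N → Fin (N + 1)} {c : Fin N} (h : f c ≠ 0) : (up f c).succ = f c := by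
  simp [up, h]

theorem up_eq {f : Fin N → Fin (N + 1)} {c k : Fin N} (h : f c = k.succ) : up f c = k := by
  have h0 : f c ≠ 0 := by rw [h]; exact Fin.succ_ne_zero k
  exact Fin.succ_injective _ ((succ_up h0).trans h)

/-- A parent function with a cycle has a periodic orbit that avoids the root. -/
theorem exists_cycle_of_not_acyclic {f : Fin N → Fin (N + 1)} (hf : ¬ Acyclic f) :
    ∃ c p, 0 < p ∧ (up f)^[p] c = c ∧ ∀ n, f ((up f)^[n] c) ≠ 0 := by
  classical
  -- If every orbit met the root, the number of steps needed to get there would be a rank.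
  have h0 : ∃ c, ∀ n, f ((up f)^[n] c) ≠ 0 := by
    by_contra! hcon
    refine hf ⟨fun c => Nat.find (hcon c), fun c k hck => ?_⟩
    have hc := Nat.find_spec (hcon c)
    have hpos : Nat.find (hcon c) ≠ 0 := by
      intro h
      rw [h, Function.iterate_zero, id, hck] at hc
      exact Fin.succ_ne_zero k hc
    obtain ⟨m, hm⟩ := Nat.exists_eq_succ_of_ne_zero hpos
    rw [hm, Function.iterate_succ_apply, up_eq hck] at hc
    show Nat.find (hcon k) < Nat.find (hcon c)
    rw [hm]
    exact Nat.lt_succ_of_le (Nat.find_min' _ hc)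
  obtain ⟨c, hc⟩ := h0
  -- Pigeonhole: the orbit lives in a finite set, so two iterates coincide.
  obtain ⟨a, b, hab, h⟩ := Finite.exists_ne_map_eq_of_infinite fun n : ℕ => (up f)^[n] c
  wlog hlt : a < b generalizing a b
  · exact this b a hab.symm h.symm (by omega)
  refine ⟨(up f)^[a] c, b - a, by omega, ?_, fun n => ?_⟩
  · rw [← Function.iterate_add_apply, Nat.sub_add_cancel hlt.le]
    exact h.symm
  · rw [← Function.iterate_add_apply]
    exact hc _

/-! ## The determinant -/

/-- A matrix that is triangular with respect to a rank function. -/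
theorem det_of_rank_lt {ι : Type*} [Fintype ι] [DecidableEq ι] (A : Matrix ι ι ℝ) (d : ι → ℕ)
    (h : ∀ k j, A k j ≠ 0 → k = j ∨ d k < d j) : A.det = ∏ j, A j j := by
  rw [Matrix.det_apply, Finset.sum_eq_single 1]
  · simp
  · intro σ _ hσ
    by_contra hne
    have hprod : ∏ i, A (σ i) i ≠ 0 := fun h0 => hne (by rw [h0, smul_zero])
    have hall : ∀ i, σ i = i ∨ d (σ i) < d i := fun i =>
      h _ _ (Finset.prod_ne_zero_iff.1 hprod i (mem_univ _))
    obtain ⟨i, hi⟩ : ∃ i, σ i ≠ i := by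
      by_contra! hcon
      exact hσ (Equiv.ext hcon)
    -- A permutation preserves the sum of the ranks, whereas a nonzero term other than the identity
    -- would make it strictly smaller.
    have hlt : ∑ i, d (σ i) < ∑ i, d i := by
      refine Finset.sum_lt_sum (fun j _ => ?_) ⟨i, mem_univ _, (hall i).resolve_left hi⟩
      rcases hall j with hj | hj
      · rw [hj]
      · exact hj.le
    exact absurd (Equiv.sum_comp σ d) hlt.ne
  · simp

/-- The first row of the Laplacian is reserved for the root weights. A root edge therefore
contributes only to that row, and the remaining edges contribute to all rows but that one. -/
def rootVec (r : Fin N) : ℝ := if (r : ℕ) = 0 then 1 else 0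

/-- The unit vector of a node, `0` for the first one. -/
def nodeVec (k r : Fin N) : ℝ := if r = k ∧ (k : ℕ) ≠ 0 then 1 else 0

/-- The column of the edge `(i, c.succ)` in the Laplacian. -/
def edgeVec (i : Fin (N + 1)) (c : Fin N) : Fin N → ℝ :=
  Fin.cases rootVec (fun k => nodeVec c - nodeVec k) i

@[simp] theorem edgeVec_zero (c : Fin N) : edgeVec 0 c = rootVec := rfl

@[simp] theorem edgeVec_succ (k c : Fin N) : edgeVec k.succ c = nodeVec c - nodeVec k := rfl

/-- These are the matrices that arise when the determinant of the Laplacian is expanded by columns.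
-/
def edgeMatrix (f : Fin N → Fin (N + 1)) : Matrix (Fin N) (Fin N) ℝ := fun r c => edgeVec (f c) c r

/-- The column of `c` is `nodeVec c - nodeVec (up f c)` as long as the orbit avoids the root. Summed
over a full period the columns telescope to zero, so the sum of the unit vectors along the orbit
lies in the kernel. -/
theorem det_edgeMatrix_of_not_acyclic {f : Fin N → Fin (N + 1)} (hf : ¬ Acyclic f) :
    (edgeMatrix f).det = 0 := by
  obtain ⟨c, p, hp, hpc, hn⟩ := exists_cycle_of_not_acyclic hf
  refine Matrix.exists_mulVec_eq_zero_iff.1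
    ⟨∑ t ∈ range p, Pi.single ((up f)^[t] c) 1, ?_, ?_⟩
  · intro h0
    -- The kernel vector is nonzero: its entries are sums of non-negative terms, and the term `t =
    -- 0` contributes `1` at `c`.
    have h1 := congrFun h0 c
    rw [Finset.sum_apply, Pi.zero_apply, Finset.sum_eq_zero_iff_of_nonneg] at h1
    · have := h1 0 (mem_range.2 hp)
      simp at this
    · intro t _
      rw [Pi.single_apply]
      split_ifs <;> norm_num
  · have hcol : ∀ t, (edgeMatrix f).mulVec (Pi.single ((up f)^[t] c) 1) =
        nodeVec ((up f)^[t] c) - nodeVec ((up f)^[t + 1] c) := by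
      intro t
      rw [Matrix.mulVec_single_one]
      ext r
      show edgeVec (f ((up f)^[t] c)) ((up f)^[t] c) r = _
      rw [← succ_up (hn t), edgeVec_succ, Function.iterate_succ_apply']
    rw [Matrix.mulVec_sum]
    simp only [hcol]
    rw [Finset.sum_range_sub', hpc]
    simp

/-- The matrix of a path-compressed tree with root child `r`. -/
def starMatrix (r : Fin N) : Matrix (Fin N) (Fin N) ℝ := fun k j =>
  if j = r then rootVec k else nodeVec j k - nodeVec r k

/-- If `r` is the first node, `nodeVec r = 0` and the matrix is the identity. Otherwise column `r`
is the first unit vector and the column of the first node is minus the unit vector of `r`.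
Exchanging the two leaves a matrix that is triangular up to the order of the nodes, with a single
`-1` on the diagonal, and the exchange contributes the other sign. -/
theorem det_starMatrix (r : Fin N) : (starMatrix r).det = 1 := by
  have hN : 0 < N := r.pos
  let z : Fin N := ⟨0, hN⟩
  by_cases hr : (r : ℕ) = 0
  · have : starMatrix r = 1 := by
      ext k j
      simp only [starMatrix, rootVec, nodeVec, Matrix.one_apply, Fin.ext_iff]
      by_cases hj : (j : ℕ) = r <;> by_cases hk : (k : ℕ) = j <;> simp_all
    rw [this, Matrix.det_one]
  · have hzr : z ≠ r := fun h => hr (by rw [← h])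
    have hz : ∀ k : Fin N, (k : ℕ) = 0 ↔ k = z := fun k => by simp [Fin.ext_iff, z]
    have h1 := Matrix.det_permute' (Equiv.swap z r) (starMatrix r)
    rw [Equiv.Perm.sign_swap hzr] at h1
    have h2 : ((starMatrix r).submatrix id (Equiv.swap z r)).det = -1 := by
      have hval : ∀ k j, (starMatrix r).submatrix id (Equiv.swap z r) k j =
          if j = z then (if k = z then 1 else 0) else if j = r then (if k = r then -1 else 0)
          else (if k = j then 1 else 0) - (if k = r then 1 else 0) := by
        intro k j
        simp only [Matrix.submatrix_apply, id, starMatrix, rootVec, nodeVec, hz]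
        by_cases hj : j = z
        · subst hj; simp
        · by_cases hj' : j = r
          · subst hj'
            simp only [Equiv.swap_apply_right, if_neg hj, if_neg hzr]
            have hz0 : (z : ℕ) = 0 := rfl
            by_cases hk : k = j <;> simp [hk, hj, hr, hz0]
          · rw [Equiv.swap_apply_of_ne_of_ne hj hj']
            have hj0 : (j : ℕ) ≠ 0 := fun h => hj ((hz j).1 h)
            simp [hj, hj', hj0, hr]
      rw [det_of_rank_lt _ (fun k => if k = r then 0 else 1)]
      · rw [Finset.prod_eq_single r]
        · rw [hval]; simp [Ne.symm hzr]
        · intro j _ hj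
          rw [hval]
          by_cases hjz : j = z <;> simp [hjz, hj]
        · simp
      · intro k j hkj
        rw [hval] at hkj
        by_cases hk : k = j
        · exact Or.inl hk
        · right
          by_cases hkr : k = r
          · subst hkr; simp [Ne.symm hk]
          · exfalso
            apply hkj
            by_cases hjz : j = z
            · subst hjz; simp [hk]
            · by_cases hjr : j = r <;> simp_all
    rw [h2] at h1
    simp at h1
    linarith

/-- Path compression: with `r` the root child, `S` subtracts from each column that of its parent
unless the parent is `r` or the root. In the product with the star matrix the two copies of `nodeVec
r` cancel, which restores the edge vectors. `S` is unitriangular for the rank. -/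
theorem det_edgeMatrix_of_isDep {f : Fin N → Fin (N + 1)} (hf : IsDep f) :
    (edgeMatrix f).det = 1 := by
  obtain ⟨⟨d, hd⟩, r, hr, huniq⟩ := hf
  let S : Matrix (Fin N) (Fin N) ℝ := fun k j =>
    (if k = j then 1 else 0) - if f j = k.succ ∧ k ≠ r then 1 else 0
  have hself : ∀ j, f j ≠ j.succ := fun j h => lt_irrefl _ (hd j j h)
  have hS : S.det = 1 := by
    rw [det_of_rank_lt S d]
    · refine Finset.prod_eq_one fun j _ => ?_
      simp [S, hself j]
    · intro k j hkj
      by_cases h : k = j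
      · exact Or.inl h
      · right
        by_contra hlt
        apply hkj
        have : f j ≠ k.succ := fun h' => hlt (hd _ _ h')
        simp [S, h, this]
  have hmul : edgeMatrix f = starMatrix r * S := by
    ext i j
    rw [Matrix.mul_apply]
    show edgeVec (f j) j i = ∑ k, starMatrix r i k *
      ((if k = j then 1 else 0) - if f j = k.succ ∧ k ≠ r then 1 else 0)
    simp only [mul_sub, Finset.sum_sub_distrib, mul_ite, mul_one, mul_zero]
    rw [Finset.sum_ite_eq' univ j, if_pos (mem_univ _)]
    by_cases hj : f j = 0
    · have hjr : j = r := huniq j hj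
      subst hjr
      have : ∀ k : Fin N, ¬ (f j = k.succ ∧ k ≠ j) := fun k h => by
        rw [hj] at h
        exact Fin.succ_ne_zero k h.1.symm
      simp only [if_neg (this _)]
      simp [hj, starMatrix]
    · have hjr : j ≠ r := fun h => hj (h ▸ hr)
      obtain ⟨k, hk⟩ := Fin.exists_succ_eq.2 hj
      have hiff : ∀ x : Fin N, (f j = x.succ ∧ x ≠ r) ↔ (x = k ∧ k ≠ r) := fun x => by
        rw [← hk, Fin.succ_inj]
        constructor
        · rintro ⟨rfl, h⟩; exact ⟨rfl, h⟩
        · rintro ⟨rfl, h⟩; exact ⟨rfl, h⟩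
      simp only [hiff]
      by_cases hkr : k = r
      · simp [← hk, starMatrix, hjr, hkr]
      · simp [← hk, starMatrix, hjr, hkr]
  rw [hmul, Matrix.det_mul, hS, det_starMatrix, one_mul]

open Classical in
-- An acyclic `f` sends a node of minimal rank to the root, so if it is not a dependency tree there
-- is a second such node, and both columns equal `rootVec`. For `N = 0` the empty determinant is `1`
-- although there is no root edge, whence `hN`.
theorem det_edgeMatrix (hN : 0 < N) (f : Fin N → Fin (N + 1)) :
    (edgeMatrix f).det = if IsDep f then 1 else 0 := by
  split_ifs with h
  · exact det_edgeMatrix_of_isDep h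
  · by_cases ha : Acyclic f
    · obtain ⟨d, hd⟩ := id ha
      obtain ⟨c, -, hc⟩ := Finset.exists_min_image univ d ⟨⟨0, hN⟩, mem_univ _⟩
      have hc0 : f c = 0 := by
        by_contra h0
        obtain ⟨k, hk⟩ := Fin.exists_succ_eq.2 h0
        exact absurd (hd c k hk.symm) (not_lt.2 (hc k (mem_univ _)))
      obtain ⟨c', hc', hne⟩ : ∃ c', f c' = 0 ∧ c' ≠ c := by
        by_contra! hcon
        exact h ⟨ha, c, hc0, hcon⟩
      refine Matrix.det_zero_of_column_eq hne fun i => ?_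
      simp [edgeMatrix, hc0, hc']
    · exact det_edgeMatrix_of_not_acyclic ha

/-- The Laplacian of the weights `W c i` of the edges `(i, c.succ)`. -/
noncomputable def lap (W : Fin N → Fin (N + 1) → ℝ) : Matrix (Fin N) (Fin N) ℝ :=
  fun r c => ∑ i, W c i * edgeVec i c r

open Classical in
/-- The matrix-tree theorem for trees with one edge from the root. -/
theorem det_lap (hN : 0 < N) (W : Fin N → Fin (N + 1) → ℝ) :
    (lap W).det = ∑ f with IsDep f, ∏ c, W c (f c) := by
  have h1 : (lap W).det =
      (Matrix.detRowAlternating (n := Fin N) (R := ℝ)).toMultilinearMap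
        (fun c => ∑ i, W c i • edgeVec i c) := by
    rw [← Matrix.det_transpose]
    show Matrix.det _ = Matrix.det _
    congr 1
    ext c r
    simp [lap, Matrix.transpose_apply, Finset.sum_apply]
  -- Choosing one summand in every column is the same as choosing a parent for every node.
  rw [h1, MultilinearMap.map_sum, Finset.sum_filter]
  refine Finset.sum_congr rfl fun f _ => ?_
  rw [MultilinearMap.map_smul_univ]
  have h2 : (Matrix.detRowAlternating (n := Fin N) (R := ℝ)).toMultilinearMap
      (fun c => edgeVec (f c) c) = (edgeMatrix f).det := by
    rw [← Matrix.det_transpose]; rfl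
  rw [h2, det_edgeMatrix hN]
  simp

/-! ## Dependency trees as parent functions -/

/-- The edge set of a parent function. -/
def edgeSet (f : Fin N → Fin (N + 1)) : EdgeSet N := univ.image fun c => (f c, c.succ)

theorem mem_edgeSet {f : Fin N → Fin (N + 1)} {i j : Fin (N + 1)} :
    (i, j) ∈ edgeSet f ↔ ∃ c, f c = i ∧ c.succ = j := by
  simp [edgeSet]

theorem mem_edgeSet_succ {f : Fin N → Fin (N + 1)} {i : Fin (N + 1)} {c : Fin N} :
    (i, c.succ) ∈ edgeSet f ↔ f c = i := by
  simp [mem_edgeSet]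

theorem edgeSet_injective : Function.Injective (edgeSet (N := N)) := by
  intro f g h
  ext1 c
  rw [← mem_edgeSet_succ (f := f), h, mem_edgeSet_succ]

/-- Edges point from parent to child. The rank, shifted by one so that the root can take the value
`0`, increases along them; conversely a periodic orbit of `up`, read backwards, is a directed cycle.
-/
theorem acyclic_iff (f : Fin N → Fin (N + 1)) :
    Acyclic f ↔ ∀ v, ¬ Relation.TransGen (fun a b => (a, b) ∈ edgeSet f) v v := by
  constructor
  · rintro ⟨d, hd⟩ v hv
    let D : Fin (N + 1) → ℕ := Fin.cases 0 fun k => d k + 1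
    have key : ∀ a b, Relation.TransGen (fun a b => (a, b) ∈ edgeSet f) a b → D a < D b := by
      intro a b h
      have step : ∀ a b, (a, b) ∈ edgeSet f → D a < D b := by
        intro a b hab
        obtain ⟨c, rfl, rfl⟩ := mem_edgeSet.1 hab
        by_cases h0 : f c = 0
        · rw [h0]; simp [D]
        · obtain ⟨k, hk⟩ := Fin.exists_succ_eq.2 h0
          have := hd c k hk.symm
          rw [← hk]
          simpa [D] using this
      induction h with
      | single h => exact step _ _ h
      | tail _ h ih => exact ih.trans (step _ _ h)
    exact lt_irrefl _ (key v v hv)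
  · intro h
    by_contra hf
    obtain ⟨c, p, hp, hpc, hn⟩ := exists_cycle_of_not_acyclic hf
    have key : ∀ n, Relation.TransGen (fun a b => (a, b) ∈ edgeSet f)
        ((up f)^[n + 1] c).succ c.succ := by
      intro n
      induction n with
      | zero => exact .single (mem_edgeSet_succ.2 (succ_up (hn 0)).symm)
      | succ n ih =>
        refine .head (mem_edgeSet_succ.2 ?_) ih
        rw [Function.iterate_succ_apply' _ (n + 1)]
        exact (succ_up (hn _)).symm
    have := key (p - 1)
    rw [Nat.sub_add_cancel hp, hpc] at this
    exact h _ this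

theorem existsUnique_root_iff (f : Fin N → Fin (N + 1)) :
    (∃! j, ((0 : Fin (N + 1)), j) ∈ edgeSet f) ↔ ∃! c, f c = 0 := by
  constructor
  · rintro ⟨j, hj, hu⟩
    obtain ⟨c, hc, rfl⟩ := mem_edgeSet.1 hj
    exact ⟨c, hc, fun c' hc' => Fin.succ_injective _ (hu _ (mem_edgeSet_succ.2 hc'))⟩
  · rintro ⟨c, hc, hu⟩
    refine ⟨c.succ, mem_edgeSet_succ.2 hc, fun j hj => ?_⟩
    obtain ⟨c', hc', rfl⟩ := mem_edgeSet.1 hj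
    rw [hu c' hc']

/-- The uniqueness of incoming edges says nothing about edges into the root. These are excluded by
acyclicity, since every node is reachable from the root and such an edge would close a cycle. -/
theorem isDependencyTree_iff (G : RootedGraph N) (t : EdgeSet N) :
    G.IsDependencyTree t ↔
      ∃ f, IsDep f ∧ (∀ c, (f c, c.succ) ∈ G.edges) ∧ edgeSet f = t := by
  constructor
  · rintro ⟨⟨hE, hpar, hcyc⟩, hroot⟩
    choose f hf hu using fun c : Fin N => hpar c.succ (Fin.succ_ne_zero c)
    have hsub : edgeSet f ⊆ t := by
      rintro ⟨i, j⟩ hij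
      obtain ⟨c, rfl, rfl⟩ := mem_edgeSet.1 hij
      exact hf c
    have hac : Acyclic f := (acyclic_iff f).2 fun v hv =>
      hcyc v (Relation.TransGen.mono (fun a b h => hsub h) v v hv)
    have hreach : ∀ v, Relation.ReflTransGen (fun a b => (a, b) ∈ t) 0 v := by
      obtain ⟨d, hd⟩ := id hac
      have : ∀ n, ∀ c, d c < n → Relation.ReflTransGen (fun a b => (a, b) ∈ t) 0 c.succ := by
        intro n
        induction n with
        | zero => intro c hc; omega
        | succ n ih =>
          intro c hc
          by_cases h0 : f c = 0
          · exact .single (h0 ▸ hf c)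
          · obtain ⟨k, hk⟩ := Fin.exists_succ_eq.2 h0
            have := hd c k hk.symm
            exact (ih k (by omega)).tail (hk ▸ hf c)
      intro v
      refine Fin.cases .refl (fun c => ?_) v
      exact this _ c (Nat.lt_succ_self _)
    have heq : edgeSet f = t := by
      refine Finset.Subset.antisymm hsub ?_
      rintro ⟨i, j⟩ hij
      refine Fin.cases (fun h => ?_) (fun c h => ?_) j hij
      · exact absurd (Relation.TransGen.tail' (hreach i) h) (hcyc 0)
      · exact mem_edgeSet_succ.2 (hu c i h).symm
    refine ⟨f, ⟨hac, (existsUnique_root_iff f).1 (heq ▸ hroot)⟩, fun c => hE (hf c), heq⟩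
  · rintro ⟨f, ⟨hac, hroot⟩, hE, rfl⟩
    refine ⟨⟨?_, ?_, (acyclic_iff f).1 hac⟩, (existsUnique_root_iff f).2 hroot⟩
    · rintro ⟨i, j⟩ hij
      obtain ⟨c, rfl, rfl⟩ := mem_edgeSet.1 hij
      exact hE c
    · intro j hj
      obtain ⟨c, rfl⟩ := Fin.exists_succ_eq.2 hj
      exact ⟨f c, mem_edgeSet_succ.2 rfl, fun i hi => (mem_edgeSet_succ.1 hi).symm⟩

/-- The weight of a parent function. -/
noncomputable def funWeight (G : RootedGraph N) (f : Fin N → Fin (N + 1)) : ℝ :=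
  ∏ c, G.weight (f c) c.succ

theorem funWeight_nonneg (G : RootedGraph N) (f : Fin N → Fin (N + 1)) : 0 ≤ funWeight G f :=
  Finset.prod_nonneg fun _ _ => G.weight_nonneg _ _

theorem treeWeight_edgeSet (G : RootedGraph N) (f : Fin N → Fin (N + 1)) :
    G.treeWeight (edgeSet f) = funWeight G f := by
  rw [RootedGraph.treeWeight, edgeSet, Finset.prod_image]
  · rfl
  · intro a _ b _ h
    exact Fin.succ_injective _ (Prod.ext_iff.1 h).2

open Classical in
/-- The parent functions of the dependency trees of positive weight. -/
noncomputable def posFuns (G : RootedGraph N) : Finset (Fin N → Fin (N + 1)) :=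
  univ.filter fun f => IsDep f ∧ 0 < funWeight G f

theorem mem_posFuns {G : RootedGraph N} {f : Fin N → Fin (N + 1)} :
    f ∈ posFuns G ↔ IsDep f ∧ 0 < funWeight G f := by
  simp [posFuns]

open Classical in
-- Containment in `G.edges` need not be required on the right: a missing edge has weight zero and
-- would annihilate the product.
theorem filter_pos_depTrees (G : RootedGraph N) :
    (G.depTrees.filter fun t => 0 < G.treeWeight t) = (posFuns G).image edgeSet := by
  ext t
  simp only [RootedGraph.depTrees, Finset.mem_filter, mem_univ, true_and, mem_image, mem_posFuns,
    isDependencyTree_iff]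
  constructor
  · rintro ⟨⟨f, hf, -, rfl⟩, h⟩
    exact ⟨f, ⟨hf, by rwa [treeWeight_edgeSet] at h⟩, rfl⟩
  · rintro ⟨f, ⟨hf, hpos⟩, rfl⟩
    refine ⟨⟨f, hf, fun c => ?_, rfl⟩, by rwa [treeWeight_edgeSet]⟩
    by_contra hE
    exact hpos.ne' (Finset.prod_eq_zero (mem_univ c) (G.weight_eq_zero _ _ hE))

theorem treeWeight_nonneg (G : RootedGraph N) (t : EdgeSet N) : 0 ≤ G.treeWeight t :=
  Finset.prod_nonneg fun _ _ => G.weight_nonneg _ _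

/-- A sum over the dependency trees of terms that vanish with the weight. -/
theorem sum_depTrees {M : Type*} [AddCommMonoid M] (G : RootedGraph N) (h : EdgeSet N → M)
    (h0 : ∀ t, G.treeWeight t = 0 → h t = 0) :
    ∑ t ∈ G.depTrees, h t = ∑ f ∈ posFuns G, h (edgeSet f) := by
  classical
  rw [← Finset.sum_image (f := h) (g := edgeSet) (fun a _ b _ hab => edgeSet_injective hab),
    ← filter_pos_depTrees, Finset.sum_filter_of_ne]
  intro t _ hne
  exact lt_of_le_of_ne (treeWeight_nonneg G t) fun h => hne (h0 t h.symm)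

open Classical in
theorem partitionOutside_eq (G : RootedGraph N) (D : Finset (Fin N → Fin (N + 1))) :
    G.partitionOutside (D.image edgeSet) = ∑ f ∈ posFuns G with f ∉ D, funWeight G f := by
  have h1 : G.partitionOutside (D.image edgeSet) =
      ∑ t ∈ G.depTrees, if t ∉ D.image edgeSet then G.treeWeight t else 0 := by
    rw [← Finset.sum_filter, RootedGraph.partitionOutside]
    refine Finset.sum_congr ?_ fun _ _ => rfl
    ext t
    simp
  rw [h1, sum_depTrees, Finset.sum_filter]
  · refine Finset.sum_congr rfl fun f _ => ?_
    simp [treeWeight_edgeSet, edgeSet_injective.eq_iff]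
  · intro t ht
    simp [ht]

/-- The weights conditioned on the first `n` values of `p`. -/
noncomputable def condWeights (G : RootedGraph N) (p : Fin N → Fin (N + 1)) (n : ℕ) (c : Fin N)
    (i : Fin (N + 1)) : ℝ :=
  if (c : ℕ) < n ∧ i ≠ p c then 0 else G.weight i c.succ

/-- The nodes are treated in increasing order, so this interpolates between no constraint (`n = 0`)
and equality (`n = N`). -/
def AgreeUpTo (n : ℕ) (p f : Fin N → Fin (N + 1)) : Prop := ∀ c : Fin N, (c : ℕ) < n → f c = p c

open Classical in
-- Zeroing the weights of the edges that contradict the prefix kills exactly the terms of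
-- incompatible parent functions in `det_lap`, and terms of weight zero may be dropped.
theorem det_lap_condWeights (hN : 0 < N) (G : RootedGraph N) (p : Fin N → Fin (N + 1)) (n : ℕ) :
    (lap (condWeights G p n)).det = ∑ f ∈ posFuns G with AgreeUpTo n p f, funWeight G f := by
  rw [det_lap hN, posFuns, Finset.filter_filter]
  symm
  refine Finset.sum_subset_zero_on_sdiff ?_ ?_ ?_
  · intro f
    simp only [Finset.mem_filter, mem_univ, true_and]
    exact fun h => h.1.1
  · intro f hf
    simp only [Finset.mem_sdiff, Finset.mem_filter, mem_univ, true_and, not_and] at hf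
    by_cases hag : AgreeUpTo n p f
    · have hw : ¬ 0 < funWeight G f := fun h => hf.2 ⟨hf.1, h⟩ hag
      have hw0 : funWeight G f = 0 := le_antisymm (not_lt.1 hw) (funWeight_nonneg G f)
      obtain ⟨c, -, hc⟩ := Finset.prod_eq_zero_iff.1 hw0
      refine Finset.prod_eq_zero (mem_univ c) ?_
      simp [condWeights, hc]
    · simp only [AgreeUpTo, not_forall] at hag
      obtain ⟨c, hc, hne⟩ := hag
      exact Finset.prod_eq_zero (mem_univ c) (if_pos ⟨hc, hne⟩)
  · intro f hf
    simp only [Finset.mem_filter] at hf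
    refine Finset.prod_congr rfl fun c _ => ?_
    rw [condWeights, if_neg]
    exact fun h => h.2 (hf.2.2 c h.1)

/-! ## Weights of the trees that remain -/

open Classical in
/-- The trees of positive weight outside `fs` that agree with `p` on the first `n` nodes. -/
noncomputable def restFuns (G : RootedGraph N) (fs : List (Fin N → Fin (N + 1))) (n : ℕ)
    (p : Fin N → Fin (N + 1)) : Finset (Fin N → Fin (N + 1)) :=
  (posFuns G).filter fun f => AgreeUpTo n p f ∧ f ∉ fs

theorem mem_restFuns {G : RootedGraph N} {fs n} {p f : Fin N → Fin (N + 1)} :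
    f ∈ restFuns G fs n p ↔ f ∈ posFuns G ∧ AgreeUpTo n p f ∧ f ∉ fs := by
  simp [restFuns]

/-- This is the quantity that `Z_D` tracks; ratios of consecutive values are the probabilities of
the edges. -/
noncomputable def restWeight (G : RootedGraph N) (fs : List (Fin N → Fin (N + 1))) (n : ℕ)
    (p : Fin N → Fin (N + 1)) : ℝ := ∑ f ∈ restFuns G fs n p, funWeight G f

theorem restWeight_nonneg (G : RootedGraph N) (fs n) (p : Fin N → Fin (N + 1)) :
    0 ≤ restWeight G fs n p := Finset.sum_nonneg fun _ _ => funWeight_nonneg G _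

theorem le_restWeight {G : RootedGraph N} {fs n} {p f : Fin N → Fin (N + 1)}
    (h : f ∈ restFuns G fs n p) : funWeight G f ≤ restWeight G fs n p :=
  Finset.single_le_sum (f := funWeight G) (fun _ _ => funWeight_nonneg G _) h

theorem restWeight_pos {G : RootedGraph N} {fs n} {p f : Fin N → Fin (N + 1)}
    (h : f ∈ restFuns G fs n p) : 0 < restWeight G fs n p :=
  (mem_posFuns.1 (mem_restFuns.1 h).1).2.trans_le (le_restWeight h)

theorem agreeUpTo_succ {c : Fin N} {p f : Fin N → Fin (N + 1)} {i : Fin (N + 1)} :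
    AgreeUpTo (c + 1) (Function.update p c i) f ↔ AgreeUpTo c p f ∧ f c = i := by
  constructor
  · intro h
    refine ⟨fun x hx => ?_, ?_⟩
    · rw [h x (by omega), Function.update_of_ne (fun hxc => by rw [hxc] at hx; omega)]
    · rw [h c (by omega), Function.update_self]
  · rintro ⟨h, hc⟩ x hx
    by_cases hxc : x = c
    · subst hxc
      rw [Function.update_self, hc]
    · rw [Function.update_of_ne hxc]
      refine h x ?_
      rw [Fin.ext_iff] at hxc
      omega

/-- The remaining functions are split by their value at `c`. With `h` the weight this says that the
edge probabilities sum to one; for general `h` it drives the induction over the columns. -/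
theorem sum_restFuns_succ {M : Type*} [AddCommMonoid M] (G : RootedGraph N) (fs)
    (p : Fin N → Fin (N + 1)) (c : Fin N) (h : (Fin N → Fin (N + 1)) → M) :
    ∑ i, ∑ f ∈ restFuns G fs (c + 1) (Function.update p c i), h f =
      ∑ f ∈ restFuns G fs c p, h f := by
  classical
  rw [← Finset.sum_fiberwise (restFuns G fs c p) (fun f => f c) h]
  refine Finset.sum_congr rfl fun i _ => Finset.sum_congr ?_ fun _ _ => rfl
  ext f
  simp only [mem_restFuns, Finset.mem_filter, agreeUpTo_succ]
  tauto

theorem agreeUpTo_all {p f : Fin N → Fin (N + 1)} : AgreeUpTo N p f ↔ f = p :=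
  ⟨fun h => funext fun c => h c c.is_lt, fun h c _ => by rw [h]⟩

/-- Once all parents are fixed, positive mass leaves no room: the only candidate is `p`, hence `p`
is itself a new tree of positive weight. -/
theorem restFuns_all {G : RootedGraph N} {fs} {p : Fin N → Fin (N + 1)}
    (h : 0 < restWeight G fs N p) :
    restFuns G fs N p = {p} ∧ p ∈ posFuns G ∧ p ∉ fs ∧ restWeight G fs N p = funWeight G p := by
  have hne : (restFuns G fs N p).Nonempty := by
    by_contra h0
    rw [Finset.not_nonempty_iff_eq_empty] at h0
    simp [restWeight, h0] at h
  obtain ⟨f, hf⟩ := hne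
  have hfp : f = p := agreeUpTo_all.1 (mem_restFuns.1 hf).2.1
  subst hfp
  have heq : restFuns G fs N f = {f} := by
    ext g
    rw [Finset.mem_singleton]
    refine ⟨fun hg => agreeUpTo_all.1 (mem_restFuns.1 hg).2.1, ?_⟩
    rintro rfl
    exact hf
  refine ⟨heq, (mem_restFuns.1 hf).1, (mem_restFuns.1 hf).2.2, ?_⟩
  rw [restWeight, heq, Finset.sum_singleton]

open Classical in
-- The form in which the program computes the mass: all compatible trees minus the earlier
-- compatible ones. The list must be duplicate-free and consist of trees of positive weight, so that
-- nothing is subtracted twice or without having been counted.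
theorem list_sum_filter_eq (G : RootedGraph N) {fs : List (Fin N → Fin (N + 1))} (hnd : fs.Nodup)
    (hpos : ∀ f ∈ fs, f ∈ posFuns G) (n : ℕ) (p : Fin N → Fin (N + 1)) :
    (∑ f ∈ posFuns G with AgreeUpTo n p f, funWeight G f) -
      ((fs.filter fun f => AgreeUpTo n p f).map (funWeight G)).sum = restWeight G fs n p := by
  rw [← List.sum_toFinset _ (hnd.filter _), sub_eq_iff_eq_add, restWeight, ← Finset.sum_union]
  · refine Finset.sum_congr ?_ fun _ _ => rfl
    ext f
    simp only [Finset.mem_filter, mem_union, mem_restFuns, List.mem_toFinset, List.mem_filter,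
      decide_eq_true_eq]
    have := hpos f
    tauto
  · rw [Finset.disjoint_left]
    intro f hf hf'
    simp only [List.mem_toFinset, List.mem_filter] at hf'
    exact (mem_restFuns.1 hf).2.2 hf'.1

/-- Conditioning on an edge into `c` alters one column only, which is why a rank-one update
suffices. -/
theorem lap_condWeights_succ (G : RootedGraph N) (p : Fin N → Fin (N + 1)) (c : Fin N)
    (i : Fin (N + 1)) :
    lap (condWeights G (Function.update p c i) (c + 1)) =
      (lap (condWeights G p c)).updateCol c fun r => G.weight i c.succ * edgeVec i c r := by
  ext r x
  by_cases hx : x = c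
  · subst hx
    rw [Matrix.updateCol_self, lap, Finset.sum_eq_single i]
    · simp [condWeights]
    · intro k _ hk
      simp [condWeights, hk]
    · simp
  · rw [Matrix.updateCol_ne hx, lap, lap]
    refine Finset.sum_congr rfl fun k _ => ?_
    congr 1
    have : (x : ℕ) < c + 1 ↔ (x : ℕ) < c := by
      rw [Fin.ext_iff] at hx
      omega
    simp only [condWeights, Function.update_of_ne hx, this]

theorem lap_condWeights_zero (G : RootedGraph N) (p : Fin N → Fin (N + 1)) :
    lap (condWeights G p 0) = lap fun c i => G.weight i c.succ := by
  congr 1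

theorem restFuns_append_singleton {G : RootedGraph N} {fs : List (Fin N → Fin (N + 1))} {n}
    {p f : Fin N → Fin (N + 1)} (hf : f ∈ restFuns G fs n p) :
    restWeight G (fs ++ [f]) n p = restWeight G fs n p - funWeight G f := by
  classical
  have : restFuns G (fs ++ [f]) n p = (restFuns G fs n p).erase f := by
    ext g
    simp only [mem_restFuns, List.mem_append, List.mem_singleton, Finset.mem_erase]
    tauto
  rw [restWeight, this, restWeight, ← Finset.add_sum_erase _ _ hf]
  ring

/-- The parent of every node is the root; a placeholder where no edge is fixed yet. -/
abbrev noFun : Fin N → Fin (N + 1) := fun _ => 0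

theorem mem_restFuns_zero {G : RootedGraph N} {fs : List (Fin N → Fin (N + 1))}
    {p f : Fin N → Fin (N + 1)} : f ∈ restFuns G fs 0 p ↔ f ∈ posFuns G ∧ f ∉ fs := by
  rw [mem_restFuns]
  have : AgreeUpTo 0 p f := fun c hc => absurd hc (Nat.not_lt_zero _)
  tauto

theorem restWeight_zero_pos {G : RootedGraph N} {fs : List (Fin N → Fin (N + 1))}
    (h : fs.length < (posFuns G).card) (p) : 0 < restWeight G fs 0 p := by
  classical
  obtain ⟨f, hf, hfs⟩ : ∃ f ∈ posFuns G, f ∉ fs.toFinset := by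
    by_contra! hcon
    exact absurd (Finset.card_le_card hcon) (not_le.2 ((List.toFinset_card_le fs).trans_lt h))
  exact restWeight_pos (f := f) (mem_restFuns_zero.2 ⟨hf, by simpa using hfs⟩)

/-- The expectation of `h` over the list obtained from `fs` by `k` draws without replacement. -/
noncomputable def expectDraws (G : RootedGraph N) (h : List (Fin N → Fin (N + 1)) → ℝ≥0∞) :
    ℕ → List (Fin N → Fin (N + 1)) → ℝ≥0∞
  | 0, fs => h fs
  | k + 1, fs => ∑ f ∈ restFuns G fs 0 noFun,
      ENNReal.ofReal (funWeight G f / restWeight G fs 0 noFun) * expectDraws G h k (fs ++ [f])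

/-! ## Draws without replacement -/

/-- Only lists that the process can reach matter. Their good properties are passed as an implication
from those of `fs`, which makes the base case trivial and lets the induction propagate them from
draw to draw. -/
theorem expectDraws_congr {G : RootedGraph N} {h h' : List (Fin N → Fin (N + 1)) → ℝ≥0∞} (k : ℕ)
    (fs : List (Fin N → Fin (N + 1)))
    (H : ∀ gs, fs <+: gs → gs.length = fs.length + k →
      (fs.Nodup ∧ (∀ f ∈ fs, f ∈ posFuns G) → gs.Nodup ∧ ∀ f ∈ gs, f ∈ posFuns G) →
      h gs = h' gs) : expectDraws G h k fs = expectDraws G h' k fs := by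
  induction k generalizing fs with
  | zero => exact H fs (List.prefix_refl fs) rfl id
  | succ k ih =>
    rw [expectDraws, expectDraws]
    refine Finset.sum_congr rfl fun f hf => ?_
    obtain ⟨hf1, hf2⟩ := mem_restFuns_zero.1 hf
    congr 1
    refine ih (fs ++ [f]) fun gs h1 h2 h3 => H gs ((List.prefix_append fs [f]).trans h1) ?_ ?_
    · rw [h2, List.length_append, List.length_singleton]
      omega
    · rintro ⟨hnd, hpos⟩
      refine h3 ⟨?_, ?_⟩
      · rw [List.nodup_append]
        refine ⟨hnd, List.nodup_singleton f, fun a ha b hb hab => ?_⟩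
        rw [List.mem_singleton] at hb
        exact hf2 (hb ▸ hab ▸ ha)
      · intro g hg
        rcases List.mem_append.1 hg with hg | hg
        · exact hpos g hg
        · rw [List.mem_singleton.1 hg]
          exact hf1

/-- As long as trees of positive weight remain, the mass is positive and the draw probabilities add
up to one. -/
theorem expectDraws_one {G : RootedGraph N} (k : ℕ) (fs : List (Fin N → Fin (N + 1)))
    (hk : fs.length + k ≤ (posFuns G).card) : expectDraws G (fun _ => 1) k fs = 1 := by
  induction k generalizing fs with
  | zero => rfl
  | succ k ih =>
    have hpos := restWeight_zero_pos (G := G) (fs := fs) (by omega) noFun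
    rw [expectDraws, Finset.sum_congr rfl fun f _ => by
      rw [ih (fs ++ [f]) (by rw [List.length_append, List.length_singleton]; omega), mul_one],
      ← ENNReal.ofReal_sum_of_nonneg fun f _ => div_nonneg (funWeight_nonneg G f) hpos.le,
      ← Finset.sum_div]
    show ENNReal.ofReal (restWeight G fs 0 noFun / _) = 1
    rw [div_self hpos.ne', ENNReal.ofReal_one]

theorem expectDraws_zero {G : RootedGraph N} (k : ℕ) (fs : List (Fin N → Fin (N + 1))) :
    expectDraws G (fun _ => 0) k fs = 0 := by
  induction k generalizing fs with
  | zero => rfl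
  | succ k ih => simp [expectDraws, ih]

open Classical in
/-- The probability that the next trees after `fs` are those of a list. -/
noncomputable def nextProb (G : RootedGraph N) : List (Fin N → Fin (N + 1)) → List (EdgeSet N) → ℝ≥0∞
  | _, [] => 1
  | fs, d :: D => ∑ f ∈ restFuns G fs 0 noFun, if edgeSet f = d then
      ENNReal.ofReal (funWeight G f / restWeight G fs 0 noFun) * nextProb G (fs ++ [f]) D else 0

open Classical in
-- The indicator is resolved one draw at a time. A draw different from `d` fixes a wrong entry at
-- that position and the indicator vanishes for good; once `D` is used up, the remaining draws have
-- total mass one.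
theorem expectDraws_prefix {G : RootedGraph N} (D : List (EdgeSet N)) (k : ℕ)
    (fs : List (Fin N → Fin (N + 1))) (hD : D.length ≤ k)
    (hk : fs.length + k ≤ (posFuns G).card) :
    expectDraws G (fun gs => if fs.map edgeSet ++ D <+: gs.map edgeSet then 1 else 0) k fs =
      nextProb G fs D := by
  induction D generalizing k fs with
  | nil =>
    rw [nextProb]
    refine Eq.trans ?_ (expectDraws_one k fs hk)
    refine expectDraws_congr k fs fun gs hgs _ _ => ?_
    rw [List.append_nil, if_pos (hgs.map edgeSet)]
  | cons d D ih =>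
    obtain ⟨k, rfl⟩ : ∃ k', k = k' + 1 := ⟨k - 1, by simp at hD; omega⟩
    rw [expectDraws, nextProb]
    refine Finset.sum_congr rfl fun f hf => ?_
    split_ifs with hfd
    · congr 1
      rw [← ih k (fs ++ [f]) (by simpa using hD) (by simp; omega)]
      simp [hfd]
    · rw [expectDraws_congr (h' := fun _ => 0) k (fs ++ [f]), expectDraws_zero, mul_zero]
      intro gs hgs _ _
      rw [if_neg]
      intro hpre
      apply hfd
      have h1 := hgs.map edgeSet
      rw [List.map_append, List.map_singleton] at h1
      have h2 : fs.map edgeSet ++ [d] <+: gs.map edgeSet :=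
        List.IsPrefix.trans ⟨D, by simp⟩ hpre
      have h3 := List.prefix_of_prefix_length_le h1 h2 (by simp)
      have h4 := h3.eq_of_length (by simp)
      simpa using h4

theorem restWeight_eq_partitionOutside (G : RootedGraph N) (fs : List (Fin N → Fin (N + 1))) (p) :
    restWeight G fs 0 p = G.partitionOutside (fs.map edgeSet).toFinset := by
  classical
  have h1 : (fs.map edgeSet).toFinset = fs.toFinset.image edgeSet := by
    ext t
    simp
  rw [h1, partitionOutside_eq, restWeight]
  refine Finset.sum_congr ?_ fun _ _ => rfl
  ext f
  rw [mem_restFuns_zero]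
  simp

/-- At most one parent function has edge set `t`. If none remains, `t` either was drawn before or
has weight zero, and in both cases `condProb` vanishes as well. -/
theorem nextProb_singleton (G : RootedGraph N) (fs : List (Fin N → Fin (N + 1))) {t : EdgeSet N}
    (ht : t ∈ G.depTrees) :
    nextProb G fs [t] = ENNReal.ofReal (G.condProb (fs.map edgeSet).toFinset t) := by
  classical
  simp only [nextProb, mul_one]
  by_cases h : ∃ f ∈ restFuns G fs 0 noFun, edgeSet f = t
  · obtain ⟨f, hf, rfl⟩ := h
    rw [Finset.sum_eq_single f]
    · rw [if_pos rfl, RootedGraph.condProb, if_pos, ← restWeight_eq_partitionOutside G fs noFun,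
        treeWeight_edgeSet, one_div_mul_eq_div]
      simp only [List.mem_toFinset, List.mem_map, not_exists, not_and]
      rintro g hg hgf
      exact (mem_restFuns_zero.1 hf).2 (edgeSet_injective hgf ▸ hg)
    · intro g _ hg
      rw [if_neg fun h => hg (edgeSet_injective h)]
    · exact fun h => absurd hf h
  · rw [Finset.sum_eq_zero]
    · symm
      rw [ENNReal.ofReal_eq_zero, RootedGraph.condProb]
      by_cases htD : t ∈ (fs.map edgeSet).toFinset
      · simp [htD]
      · have hw : ¬ 0 < G.treeWeight t := by
          intro hpos
          have hmem : t ∈ (G.depTrees.filter fun t => 0 < G.treeWeight t) :=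
            Finset.mem_filter.2 ⟨ht, hpos⟩
          rw [filter_pos_depTrees] at hmem
          obtain ⟨f, hf, rfl⟩ := Finset.mem_image.1 hmem
          refine h ⟨f, mem_restFuns_zero.2 ⟨hf, fun hfs => htD ?_⟩, rfl⟩
          rw [List.mem_toFinset]
          exact List.mem_map_of_mem hfs
        rw [le_antisymm (not_lt.1 hw) (treeWeight_nonneg G t), mul_zero]
    · intro f hf
      rw [if_neg fun hft => h ⟨f, hf, hft⟩]

/-- The chain rule. A term survives only if its first draw is `d`, and then the history `fs ++ [f]`
followed by `D` has the same trees as `fs` followed by `d :: D`, so the last factor is common to all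
terms. -/
theorem nextProb_append (G : RootedGraph N) (D : List (EdgeSet N)) {t : EdgeSet N}
    (ht : t ∈ G.depTrees) (fs : List (Fin N → Fin (N + 1))) :
    nextProb G fs (D ++ [t]) =
      nextProb G fs D * ENNReal.ofReal (G.condProb (fs.map edgeSet ++ D).toFinset t) := by
  classical
  induction D generalizing fs with
  | nil =>
    rw [List.nil_append, List.append_nil, nextProb_singleton G fs ht, nextProb, one_mul]
  | cons d D ih =>
    rw [List.cons_append, nextProb, nextProb, Finset.sum_mul]
    refine Finset.sum_congr rfl fun f _ => ?_
    split_ifs with hfd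
    · rw [ih (fs ++ [f]), mul_assoc]
      simp [hfd]
    · rw [zero_mul]

end Arborescence

/-! ### Program analysis: meaning, law and cost of `swor` -/

namespace RealRAM

/-! ## Deterministic execution -/

open Classical in
/-- The memory after a run without draws. -/
noncomputable def Stmt.exec : Stmt → Store → Store
  | .skip, σ => σ
  | .setN x e, σ => { σ with nvar := Function.update σ.nvar x (e.eval σ) }
  | .setR x e, σ => { σ with rvar := Function.update σ.rvar x (e.eval σ) }
  | .putN a i j e, σ =>
      { σ with narr := Function.update σ.narr a (Function.update (σ.narr a) (i.eval σ)
        (Function.update (σ.narr a (i.eval σ)) (j.eval σ) (e.eval σ))) }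
  | .putR a i j e, σ =>
      { σ with rarr := Function.update σ.rarr a (Function.update (σ.rarr a) (i.eval σ)
        (Function.update (σ.rarr a (i.eval σ)) (j.eval σ) (e.eval σ))) }
  | .seq s₁ s₂, σ => s₂.exec (s₁.exec σ)
  | .ite b s₁ s₂, σ => if b.holds σ then s₁.exec σ else s₂.exec σ
  | .loop x lo hi body, σ =>
      (List.range' (lo.eval σ) (hi.eval σ + 1 - lo.eval σ)).foldl
        (fun τ v => body.exec { τ with nvar := Function.update τ.nvar x v }) σ
  | .draw _ _ _, σ => σ

def Stmt.drawFree : Stmt → Bool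
  | .seq s₁ s₂ => s₁.drawFree && s₂.drawFree
  | .ite _ s₁ s₂ => s₁.drawFree && s₂.drawFree
  | .loop _ _ _ s => s.drawFree
  | .draw _ _ _ => false
  | _ => true

def Stmt.writesN (x : NVar) : Stmt → Bool
  | .setN y _ => decide (y = x)
  | .seq s₁ s₂ => s₁.writesN x || s₂.writesN x
  | .ite _ s₁ s₂ => s₁.writesN x || s₂.writesN x
  | .loop y _ _ s => decide (y = x) || s.writesN x
  | .draw y _ _ => decide (y = x)
  | _ => false

def Stmt.writesR (x : RVar) : Stmt → Bool
  | .setR y _ => decide (y = x)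
  | .seq s₁ s₂ => s₁.writesR x || s₂.writesR x
  | .ite _ s₁ s₂ => s₁.writesR x || s₂.writesR x
  | .loop _ _ _ s => s.writesR x
  | _ => false

def Stmt.writesNArr (x : NArr) : Stmt → Bool
  | .putN y _ _ _ => decide (y = x)
  | .seq s₁ s₂ => s₁.writesNArr x || s₂.writesNArr x
  | .ite _ s₁ s₂ => s₁.writesNArr x || s₂.writesNArr x
  | .loop _ _ _ s => s.writesNArr x
  | _ => false

def Stmt.writesRArr (x : RArr) : Stmt → Bool
  | .putR y _ _ _ => decide (y = x)
  | .seq s₁ s₂ => s₁.writesRArr x || s₂.writesRArr x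
  | .ite _ s₁ s₂ => s₁.writesRArr x || s₂.writesRArr x
  | .loop _ _ _ s => s.writesRArr x
  | _ => false

/-- `τ` and `σ` agree on all that `s` does not write. -/
structure Agree (s : Stmt) (σ τ : Store) : Prop where
  nvar : ∀ x, s.writesN x = false → τ.nvar x = σ.nvar x
  rvar : ∀ x, s.writesR x = false → τ.rvar x = σ.rvar x
  narr : ∀ x, s.writesNArr x = false → τ.narr x = σ.narr x
  rarr : ∀ x, s.writesRArr x = false → τ.rarr x = σ.rarr x

theorem Agree.refl (s : Stmt) (σ : Store) : Agree s σ σ :=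
  ⟨fun _ _ => rfl, fun _ _ => rfl, fun _ _ => rfl, fun _ _ => rfl⟩

theorem Agree.trans {s : Stmt} {σ τ υ : Store} (h : Agree s σ τ) (h' : Agree s τ υ) :
    Agree s σ υ :=
  ⟨fun x hx => (h'.nvar x hx).trans (h.nvar x hx), fun x hx => (h'.rvar x hx).trans (h.rvar x hx),
    fun x hx => (h'.narr x hx).trans (h.narr x hx), fun x hx => (h'.rarr x hx).trans (h.rarr x hx)⟩

theorem Agree.mono {s s' : Stmt} {σ τ : Store} (h : Agree s σ τ)
    (hN : ∀ x, s'.writesN x = false → s.writesN x = false)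
    (hR : ∀ x, s'.writesR x = false → s.writesR x = false)
    (hNA : ∀ x, s'.writesNArr x = false → s.writesNArr x = false)
    (hRA : ∀ x, s'.writesRArr x = false → s.writesRArr x = false) : Agree s' σ τ :=
  ⟨fun x hx => h.nvar x (hN x hx), fun x hx => h.rvar x (hR x hx),
    fun x hx => h.narr x (hNA x hx), fun x hx => h.rarr x (hRA x hx)⟩

theorem agree_loop_step {x : NVar} {lo hi : NExp} {body : Stmt} {τ υ : Store} {v : ℕ}
    (h : Agree body { τ with nvar := Function.update τ.nvar x v } υ) :
    Agree (.loop x lo hi body) τ υ := by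
  refine Agree.trans (τ := { τ with nvar := Function.update τ.nvar x v }) ?_
    (h.mono ?_ ?_ ?_ ?_)
  · refine ⟨fun y hy => ?_, fun _ _ => rfl, fun _ _ => rfl, fun _ _ => rfl⟩
    have : y ≠ x := by
      rintro rfl
      simp [Stmt.writesN] at hy
    simp [this]
  all_goals intro y hy; simp_all [Stmt.writesN, Stmt.writesR, Stmt.writesNArr, Stmt.writesRArr]

theorem agree_foldl {x : NVar} {lo hi : NExp} {body : Stmt}
    (hb : ∀ σ, Agree body σ (body.exec σ)) (l : List ℕ) (σ : Store) :
    Agree (.loop x lo hi body) σ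
      (l.foldl (fun τ v => body.exec { τ with nvar := Function.update τ.nvar x v }) σ) := by
  induction l generalizing σ with
  | nil => exact Agree.refl _ _
  | cons v l ih =>
    rw [List.foldl_cons]
    exact Agree.trans (agree_loop_step (hb _)) (ih _)

/-- The frame rule. What a statement writes is computed from its text, so each use on a concrete
statement reduces to `rfl`. -/
theorem exec_agree (s : Stmt) (σ : Store) : Agree s σ (s.exec σ) := by
  induction s generalizing σ with
  | skip => exact Agree.refl _ _
  | setN y e =>
    refine ⟨fun x hx => ?_, fun _ _ => rfl, fun _ _ => rfl, fun _ _ => rfl⟩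
    simp [Stmt.writesN] at hx
    simp [Stmt.exec, Ne.symm hx]
  | setR y e =>
    refine ⟨fun _ _ => rfl, fun x hx => ?_, fun _ _ => rfl, fun _ _ => rfl⟩
    simp [Stmt.writesR] at hx
    simp [Stmt.exec, Ne.symm hx]
  | putN y i j e =>
    refine ⟨fun _ _ => rfl, fun _ _ => rfl, fun x hx => ?_, fun _ _ => rfl⟩
    simp [Stmt.writesNArr] at hx
    simp [Stmt.exec, Ne.symm hx]
  | putR y i j e =>
    refine ⟨fun _ _ => rfl, fun _ _ => rfl, fun _ _ => rfl, fun x hx => ?_⟩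
    simp [Stmt.writesRArr] at hx
    simp [Stmt.exec, Ne.symm hx]
  | seq a b iha ihb =>
    refine Agree.trans (τ := a.exec σ) ((iha σ).mono ?_ ?_ ?_ ?_) ((ihb _).mono ?_ ?_ ?_ ?_)
    all_goals
      intro y hy
      simp_all [Stmt.writesN, Stmt.writesR, Stmt.writesNArr, Stmt.writesRArr]
  | ite b s₁ s₂ h₁ h₂ =>
    simp only [Stmt.exec]
    split_ifs
    · refine (h₁ σ).mono ?_ ?_ ?_ ?_ <;>
      · intro y hy
        simp_all [Stmt.writesN, Stmt.writesR, Stmt.writesNArr, Stmt.writesRArr]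
    · refine (h₂ σ).mono ?_ ?_ ?_ ?_ <;>
      · intro y hy
        simp_all [Stmt.writesN, Stmt.writesR, Stmt.writesNArr, Stmt.writesRArr]
  | loop x lo hi body ih => exact agree_foldl ih _ _
  | draw => exact Agree.refl _ _

/-- The invariant rule: `P v` holds before the pass with counter `v`. The hypothesis `a ≤ b + 1`
admits the empty loop, and the frame fact is handed to each pass so that invariants need not mention
unchanged memory. -/
theorem exec_loop_induct {x : NVar} {lo hi : NExp} {body : Stmt} {σ : Store}
    (P : ℕ → Store → Prop) {a b : ℕ} (ha : lo.eval σ = a) (hb : hi.eval σ = b) (hab : a ≤ b + 1)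
    (h0 : P a σ)
    (hs : ∀ v τ, a ≤ v → v ≤ b → Agree (.loop x lo hi body) σ τ → P v τ →
      P (v + 1) (body.exec { τ with nvar := Function.update τ.nvar x v })) :
    P (b + 1) ((Stmt.loop x lo hi body).exec σ) := by
  simp only [Stmt.exec, ha, hb]
  have key : ∀ m c τ, c + m = b + 1 → a ≤ c → Agree (.loop x lo hi body) σ τ → P c τ →
      P (b + 1) ((List.range' c m).foldl
        (fun τ v => body.exec { τ with nvar := Function.update τ.nvar x v }) τ) := by
    intro m
    induction m with
    | zero =>
      intro c τ hc _ _ hP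
      simpa [← hc] using hP
    | succ m ih =>
      intro c τ hc hac hτ hP
      rw [List.range'_succ, List.foldl_cons]
      exact ih (c + 1) _ (by omega) (by omega)
        (hτ.trans (agree_loop_step (exec_agree _ _))) (hs c τ hac (by omega) hτ hP)
  exact key _ a σ (by omega) le_rfl (Agree.refl _ _) h0

/-! ## Expectations over a run -/

/-- The expectation of `φ` over the final memory; aborted runs count as `0`. -/
noncomputable def ev (p : RunLaw) (φ : Store → ℝ≥0∞) : ℝ≥0∞ := ∑' r, p r * r.1.elim 0 φ

theorem tsum_bind_mul {α β : Type*} (p : PMF α) (f : α → PMF β) (h : β → ℝ≥0∞) :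
    ∑' b, (p.bind f) b * h b = ∑' a, p a * ∑' b, f a b * h b := by
  simp only [PMF.bind_apply, ← ENNReal.tsum_mul_right, ← ENNReal.tsum_mul_left]
  rw [ENNReal.tsum_comm]
  simp only [mul_assoc]

theorem tsum_pure_mul {α : Type*} (a : α) (h : α → ℝ≥0∞) :
    ∑' b, (PMF.pure a) b * h b = h a := by
  rw [tsum_eq_single a]
  · simp
  · intro b hb
    simp [PMF.pure_apply, hb]

theorem tsum_map_mul {α β : Type*} (p : PMF α) (f : α → β) (h : β → ℝ≥0∞) :
    ∑' b, (p.map f) b * h b = ∑' a, p a * h (f a) := by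
  rw [← PMF.bind_pure_comp, tsum_bind_mul]
  simp only [Function.comp_apply, tsum_pure_mul]

@[simp] theorem ev_done (σ : Store) (c : ℕ) (φ) : ev (done σ c) φ = φ σ := by
  exact tsum_pure_mul _ _

@[simp] theorem ev_charge (c : ℕ) (p : RunLaw) (φ) : ev (charge c p) φ = ev p φ := by
  exact tsum_map_mul _ _ _

@[simp] theorem ev_andThen (p : RunLaw) (f : Store → RunLaw) (φ) :
    ev (andThen p f) φ = ev p fun σ => ev (f σ) φ := by
  unfold ev andThen
  rw [tsum_bind_mul]
  refine tsum_congr fun r => ?_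
  congr 1
  obtain ⟨_ | σ, c⟩ := r
  · exact tsum_pure_mul _ _
  · exact ev_charge c (f σ) φ

theorem ev_iter_cons (f : ℕ → Store → RunLaw) (x : ℕ) (l : List ℕ) (σ : Store) (φ) :
    ev (iter f (x :: l) σ) φ = ev (f x σ) fun τ => ev (iter f l τ) φ := by
  simp [iter]

theorem ev_iter_nil (f : ℕ → Store → RunLaw) (σ : Store) (φ) :
    ev (iter f [] σ) φ = φ σ := by
  simp [iter]

theorem ev_seq (s₁ s₂ : Stmt) (σ : Store) (φ) :
    ev ((Stmt.seq s₁ s₂).run σ) φ = ev (s₁.run σ) fun τ => ev (s₂.run τ) φ := by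
  simp [Stmt.run]

/-- Deterministic code has a one-point law on memories, so all probability is confined to the draws.
-/
theorem ev_run_of_drawFree (s : Stmt) (hs : s.drawFree = true) (σ : Store) (φ) :
    ev (s.run σ) φ = φ (s.exec σ) := by
  induction s generalizing σ φ with
  | seq a b iha ihb =>
    simp only [Stmt.drawFree, Bool.and_eq_true] at hs
    simp [ev_seq, iha hs.1, ihb hs.2, Stmt.exec]
  | ite b s₁ s₂ h₁ h₂ =>
    simp only [Stmt.drawFree, Bool.and_eq_true] at hs
    simp only [Stmt.run, ev_charge, Stmt.exec]
    split_ifs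
    · exact h₁ hs.1 _ _
    · exact h₂ hs.2 _ _
  | loop x lo hi body ih =>
    simp only [Stmt.drawFree] at hs
    simp only [Stmt.run, ev_charge, Stmt.exec]
    generalize List.range' (lo.eval σ) (hi.eval σ + 1 - lo.eval σ) = l
    induction l generalizing σ with
    | nil => simp [ev_iter_nil]
    | cons v l ihl => rw [ev_iter_cons, ih hs, List.foldl_cons, ihl]
  | draw => simp [Stmt.drawFree] at hs
  | _ => simp [Stmt.run, Stmt.exec]

theorem ev_draw (x : NVar) (a : RArr) (n : NExp) (σ : Store)
    (h : IsProbVector (n.eval σ) (σ.rarr a 0)) (φ) :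
    ev ((Stmt.draw x a n).run σ) φ = ∑ i ∈ Finset.range (n.eval σ + 1),
      ENNReal.ofReal (σ.rarr a 0 i) * φ { σ with nvar := Function.update σ.nvar x i } := by
  simp only [Stmt.run, dif_pos h]
  unfold ev
  rw [tsum_map_mul, tsum_eq_sum (s := Finset.range (n.eval σ + 1))]
  · refine Finset.sum_congr rfl fun i hi => ?_
    simp only [indexLaw, PMF.ofFinset_apply, if_pos hi, Option.elim]
  · intro i hi
    simp only [indexLaw, PMF.ofFinset_apply, if_neg hi, zero_mul]

/-- Turns an expectation equal to one into an almost sure statement: a deficit at one outcome of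
positive probability would push the mean strictly below one. -/
theorem eq_one_of_tsum_mul_eq_one {α : Type*} (p : PMF α) (h : α → ℝ≥0∞) (h1 : ∀ a, h a ≤ 1)
    (hp : ∑' a, p a * h a = 1) (a : α) (ha : a ∈ p.support) : h a = 1 := by
  by_contra hne
  have hlt : h a < 1 := lt_of_le_of_ne (h1 a) hne
  have : ∑' a, p a * h a < ∑' a, p a := by
    refine ENNReal.tsum_lt_tsum (i := a) (by rw [hp]; simp) (fun b => ?_) ?_
    · exact mul_le_of_le_one_right' (h1 b)
    · have h0 : p a ≠ 0 := (PMF.mem_support_iff _ _).1 ha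
      conv_rhs => rw [← mul_one (p a)]
      exact (ENNReal.mul_lt_mul_iff_right h0 (PMF.apply_ne_top _ _)).2 hlt
  rw [hp, p.tsum_coe] at this
  exact lt_irrefl _ this

attribute [local simp] NExp.eval RExp.eval BExp.holds

/-! ## Execution of single statements -/

section ExecLemmas

variable (σ : Store)

@[simp] theorem exec_skip : Stmt.skip.exec σ = σ := rfl

@[simp] theorem exec_seq (s₁ s₂ : Stmt) : (Stmt.seq s₁ s₂).exec σ = s₂.exec (s₁.exec σ) := rfl

theorem exec_ite_pos {b : BExp} {s₁ s₂ : Stmt} (h : b.holds σ) :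
    (Stmt.ite b s₁ s₂).exec σ = s₁.exec σ := if_pos h

theorem exec_ite_neg {b : BExp} {s₁ s₂ : Stmt} (h : ¬ b.holds σ) :
    (Stmt.ite b s₁ s₂).exec σ = s₂.exec σ := if_neg h

@[simp] theorem exec_setN_nvar (x e y) :
    ((Stmt.setN x e).exec σ).nvar y = if y = x then e.eval σ else σ.nvar y := by
  simp [Stmt.exec, Function.update_apply]
@[simp] theorem exec_setN_rvar (x e) : ((Stmt.setN x e).exec σ).rvar = σ.rvar := rfl
@[simp] theorem exec_setN_narr (x e) : ((Stmt.setN x e).exec σ).narr = σ.narr := rfl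
@[simp] theorem exec_setN_rarr (x e) : ((Stmt.setN x e).exec σ).rarr = σ.rarr := rfl

@[simp] theorem exec_setR_nvar (x e) : ((Stmt.setR x e).exec σ).nvar = σ.nvar := rfl
@[simp] theorem exec_setR_rvar (x e y) :
    ((Stmt.setR x e).exec σ).rvar y = if y = x then e.eval σ else σ.rvar y := by
  simp [Stmt.exec, Function.update_apply]
@[simp] theorem exec_setR_narr (x e) : ((Stmt.setR x e).exec σ).narr = σ.narr := rfl
@[simp] theorem exec_setR_rarr (x e) : ((Stmt.setR x e).exec σ).rarr = σ.rarr := rfl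

@[simp] theorem exec_putN_nvar (a i j e) : ((Stmt.putN a i j e).exec σ).nvar = σ.nvar := rfl
@[simp] theorem exec_putN_rvar (a i j e) : ((Stmt.putN a i j e).exec σ).rvar = σ.rvar := rfl
@[simp] theorem exec_putN_narr (a i j e b k l) :
    ((Stmt.putN a i j e).exec σ).narr b k l =
      if b = a ∧ k = i.eval σ ∧ l = j.eval σ then e.eval σ else σ.narr b k l := by
  simp only [Stmt.exec, Function.update_apply]
  by_cases hb : b = a
  · subst hb
    by_cases hk : k = i.eval σ
    · subst hk
      simp [Function.update_apply]
    · simp [hk]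
  · simp [hb]
@[simp] theorem exec_putN_rarr (a i j e) : ((Stmt.putN a i j e).exec σ).rarr = σ.rarr := rfl

@[simp] theorem exec_putR_nvar (a i j e) : ((Stmt.putR a i j e).exec σ).nvar = σ.nvar := rfl
@[simp] theorem exec_putR_rvar (a i j e) : ((Stmt.putR a i j e).exec σ).rvar = σ.rvar := rfl
@[simp] theorem exec_putR_narr (a i j e) : ((Stmt.putR a i j e).exec σ).narr = σ.narr := rfl
@[simp] theorem exec_putR_rarr (a i j e b k l) :
    ((Stmt.putR a i j e).exec σ).rarr b k l =
      if b = a ∧ k = i.eval σ ∧ l = j.eval σ then e.eval σ else σ.rarr b k l := by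
  simp only [Stmt.exec, Function.update_apply]
  by_cases hb : b = a
  · subst hb
    by_cases hk : k = i.eval σ
    · subst hk
      simp [Function.update_apply]
    · simp [hk]
  · simp [hb]

end ExecLemmas

/-- The shift by one makes `P u` speak of `u` completed passes, so that pass `u` treats the index
`u` of `Fin N`, stored at position `u + 1`. -/
theorem exec_loop_one {x : NVar} {hi : NExp} {body : Stmt} {σ : Store}
    (P : ℕ → Store → Prop) {n : ℕ} (hn : hi.eval σ = n) (h0 : P 0 σ)
    (hs : ∀ u τ, u < n → Agree (.loop x n1 hi body) σ τ → P u τ →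
      P (u + 1) (body.exec { τ with nvar := Function.update τ.nvar x (u + 1) })) :
    P n ((Stmt.loop x n1 hi body).exec σ) := by
  refine exec_loop_induct (fun v τ => P (v - 1) τ) (a := 1) rfl hn (by omega) h0 ?_
  intro v τ h1 h2 hτ hP
  obtain ⟨u, rfl⟩ : ∃ u, v = u + 1 := ⟨v - 1, by omega⟩
  exact hs u τ (by omega) hτ hP

theorem exec_loop_zero {x : NVar} {hi : NExp} {body : Stmt} {σ : Store}
    (P : ℕ → Store → Prop) {n : ℕ} (hn : hi.eval σ = n) (h0 : P 0 σ)
    (hs : ∀ u τ, u < n + 1 → Agree (.loop x n0 hi body) σ τ → P u τ →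
      P (u + 1) (body.exec { τ with nvar := Function.update τ.nvar x u })) :
    P (n + 1) ((Stmt.loop x n0 hi body).exec σ) :=
  exec_loop_induct P (a := 0) rfl hn (by omega) h0
    fun v τ _ h2 hτ hP => hs v τ (by omega) hτ hP

/-- The matrix held in an array. -/
def mat (N : ℕ) (a : ℕ → ℕ → ℝ) : Matrix (Fin N) (Fin N) ℝ := fun i j => a (i + 1) (j + 1)

open NVar RVar NArr RArr Stmt BExp Arborescence

local infixr:40 " ;; " => Stmt.seq
local infixl:65 " +ᵣ " => RExp.add
local infixl:65 " -ᵣ " => RExp.sub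
local infixl:70 " *ᵣ " => RExp.mul
local infixl:70 " /ᵣ " => RExp.div

/-! ## The Laplacian -/

/-- Pieces of the program receive names so that each loop can have its own specification; they
unfold definitionally to the code of `swor`. -/
def laplacianColumn : Stmt :=
  loop vr n1 nN (
      ite (eqN vr vj) skip (
        putR aL0 vr vj (.neg (.get aW vr vj)) ;;
        putR aL0 vj vj (.get aL0 vj vj +ᵣ .get aW vr vj)))

theorem laplacianColumn_spec {N : ℕ} {σ : Store} {j : Fin N} (hN : σ.nvar nN = N)
    (hj : σ.nvar vj = j + 1) (h0 : σ.rarr aL0 (j + 1) (j + 1) = 0) :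
    mat N ((laplacianColumn.exec σ).rarr aL0) = fun r c =>
      if c = j then
        if r = j then ∑ k : Fin N, if k = j then 0 else mat N (σ.rarr aW) k j
        else - mat N (σ.rarr aW) r j
      else mat N (σ.rarr aL0) r c := by
  have key := exec_loop_one (x := vr) (hi := nN) (σ := σ) (n := N) (body :=
      ite (eqN vr vj) skip (
        putR aL0 vr vj (.neg (.get aW vr vj)) ;;
        putR aL0 vj vj (.get aL0 vj vj +ᵣ .get aW vr vj)))
    (fun u τ => ∀ r c : Fin N, τ.rarr aL0 (r + 1) (c + 1) =
      if c = j then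
        if r = j then ∑ k : Fin N, if k = j ∨ u ≤ k then 0 else σ.rarr aW (k + 1) (j + 1)
        else if (r : ℕ) < u then - σ.rarr aW (r + 1) (j + 1) else σ.rarr aL0 (r + 1) (j + 1)
      else σ.rarr aL0 (r + 1) (c + 1)) hN ?_ ?_
  · ext r c
    have := key r c
    rw [mat]
    refine this.trans ?_
    simp [mat, not_le.2 (Fin.is_lt _)]
  · intro r c
    by_cases hc : c = j
    · subst hc
      by_cases hr : r = c
      · subst hr; simp [h0]
      · simp [hr]
    · simp [hc]
  · intro u τ hu hτ hP r c
    have hW : τ.rarr aW = σ.rarr aW := hτ.rarr _ rfl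
    have hvj : τ.nvar vj = j + 1 := (hτ.nvar _ rfl).trans hj
    by_cases huj : u = j
    · rw [exec_ite_pos]
      · rw [exec_skip]
        refine (hP r c).trans ?_
        subst huj
        have : ∀ k : Fin N, (k = j ∨ (j : ℕ) ≤ k) ↔ (k = j ∨ (j : ℕ) + 1 ≤ k) := fun k => by
          rw [Fin.ext_iff]; omega
        simp only [this]
        by_cases hr : r = j
        · simp [hr]
        · have : (r : ℕ) < j ↔ (r : ℕ) < j + 1 := by rw [Fin.ext_iff] at hr; omega
          simp only [this]
      · simp [hvj, huj]
    · rw [exec_ite_neg]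
      · have hjj := hP j j
        simp only [if_true] at hjj
        simp [hvj, hW, hjj, hP r c, Fin.val_inj]
        by_cases hc : c = j
        · subst hc
          by_cases hr : r = c
          · subst hr
            simp [Ne.symm huj]
            have hsplit : ∀ k : Fin N,
                (if k = r ∨ u < k then 0 else σ.rarr aW (k + 1) (r + 1)) =
                (if k = r ∨ u ≤ k then 0 else σ.rarr aW (k + 1) (r + 1)) +
                  if k = ⟨u, hu⟩ then σ.rarr aW (u + 1) (r + 1) else 0 := by
              intro k
              by_cases hk : k = ⟨u, hu⟩
              · subst hk
                have : (⟨u, hu⟩ : Fin N) ≠ r := fun h => huj (by rw [← h])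
                simp [this]
              · have : (u ≤ k ↔ u < k) := by rw [Fin.ext_iff] at hk; simp at hk; omega
                simp [hk, this]
            rw [Finset.sum_congr rfl fun k _ => hsplit k, Finset.sum_add_distrib]
            simp
          · by_cases hru : (r : ℕ) = u
            · simp [hr, hru]
            · have : ((r : ℕ) < u ↔ (r : ℕ) < u + 1) := by omega
              simp [hr, hru, this]
        · simp [hc]
      · simp [hvj, huj]

theorem laplacian_spec {N : ℕ} (G : RootedGraph N) {σ : Store} (hN : σ.nvar nN = N)
    (hW : ∀ i j : Fin (N + 1), σ.rarr aW i j = G.weight i j) :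
    mat N ((laplacian.exec σ).rarr aL0) = lap fun c i => G.weight i c.succ := by
  have key := exec_loop_one (x := vj) (hi := nN) (σ := σ) (n := N) (body :=
    putR aL0 vj vj (.lit 0) ;; laplacianColumn ;; putR aL0 n1 vj (.get aW n0 vj))
    (fun u τ => ∀ r c : Fin N, (c : ℕ) < u → τ.rarr aL0 (r + 1) (c + 1) =
      lap (fun c i => G.weight i c.succ) r c) hN ?_ ?_
  · ext r c
    exact key r c c.is_lt
  · intro r c hc
    omega
  · intro u τ hu hτ hP r c hc
    have hWτ : τ.rarr aW = σ.rarr aW := hτ.rarr _ rfl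
    simp only [exec_seq]
    set τ' := (putR aL0 vj vj (.lit 0)).exec { τ with nvar := Function.update τ.nvar vj (u + 1) }
      with hτ'
    have hN' : τ'.nvar nN = N := by
      rw [hτ']; simp
      exact (hτ.nvar _ rfl).trans hN
    have hj' : τ'.nvar vj = (⟨u, hu⟩ : Fin N) + 1 := by rw [hτ']; simp
    have hspec := laplacianColumn_spec hN' hj' (by rw [hτ']; simp)
    have hagree := exec_agree laplacianColumn τ'
    set υ := laplacianColumn.exec τ' with hυ
    have hW' : υ.rarr aW = σ.rarr aW := by
      rw [hagree.rarr aW rfl, hτ', ← hWτ]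
      ext i j
      simp
    have hvj : υ.nvar vj = u + 1 := (hagree.nvar vj rfl).trans hj'
    have hent : υ.rarr aL0 (r + 1) (c + 1) = _ := congrFun (congrFun hspec r) c
    simp only [exec_putR_rarr, NExp.eval, RExp.eval, hvj, hW', hent]
    have hτW : τ'.rarr aW = σ.rarr aW := by
      rw [← hagree.rarr aW rfl]; exact hW'
    -- Entrywise form of the Laplacian. Since `nodeVec` vanishes in the first row, only the root
    -- weight survives there, in accordance with the final overwrite by the program.
    have hlap : lap (fun c i => G.weight i c.succ) r c =
        if (r : ℕ) = 0 then G.weight 0 c.succ else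
          if r = c then ∑ k : Fin N, if k = c then 0 else G.weight k.succ c.succ
          else - G.weight r.succ c.succ := by
      rw [lap, Fin.sum_univ_succ]
      by_cases hr : (r : ℕ) = 0
      · have : ∀ k : Fin N, nodeVec k r = 0 := fun k => by
          rw [nodeVec, if_neg]
          rintro ⟨rfl, h⟩
          exact h hr
        simp [hr, rootVec, this]
      · have hnode : ∀ k : Fin N, nodeVec k r = if k = r then 1 else 0 := fun k => by
          by_cases hk : k = r
          · subst hk; simp [nodeVec, hr]
          · simp [nodeVec, hk, Ne.symm hk]
        by_cases hrc : r = c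
        · subst hrc
          simp only [edgeVec_zero, rootVec, hr, edgeVec_succ, Pi.sub_apply, hnode, if_true,
            if_false, mul_zero, zero_add]
          refine Finset.sum_congr rfl fun k _ => ?_
          by_cases hk : k = r <;> simp [hk]
        · simp [hr, rootVec, hnode, hrc, Ne.symm hrc]
    rw [hlap]
    have hWF : ∀ i : Fin N, ∀ j : Fin N,
        mat N (σ.rarr aW) i j = G.weight i.succ j.succ := fun i j => by
      have := hW i.succ j.succ
      simpa [mat] using this
    have hW0 : ∀ j : Fin N, σ.rarr aW 0 (j + 1) = G.weight 0 j.succ := fun j => by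
      have := hW 0 j.succ
      simpa using this
    by_cases hcu : c = ⟨u, hu⟩
    · subst hcu
      have := hW0 ⟨u, hu⟩
      simp only at this
      by_cases hr : (r : ℕ) = 0
      · simp [hr, this]
      · simp [hr, hτW, hWF]
    · have hcu' : (c : ℕ) ≠ u := fun h => hcu (Fin.ext h)
      have h1 : mat N (τ'.rarr aL0) r c = τ.rarr aL0 (r + 1) (c + 1) := by
        rw [mat, hτ']
        simp [hcu']
      simp only [add_left_inj, hcu', and_false, if_false, hcu]
      rw [h1, hP r c (by omega), hlap]

/-! ## Gauss-Jordan elimination -/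

/-- Column `c` is then a combination of the unit columns before it. Consequently a nonsingular
matrix always offers a pivot at or below the diagonal. -/
theorem det_eq_zero_of_unit_columns {N : ℕ} (M : Matrix (Fin N) (Fin N) ℝ) (c : Fin N)
    (h1 : ∀ i j, j < c → M i j = if i = j then 1 else 0) (h2 : ∀ i, c ≤ i → M i c = 0) :
    M.det = 0 := by
  refine Matrix.exists_mulVec_eq_zero_iff.1
    ⟨fun j => (if j = c then 1 else 0) - if j < c then M j c else 0, ?_, ?_⟩
  · intro h
    have := congrFun h c
    simp at this
  · ext i
    simp only [Matrix.mulVec, dotProduct, mul_sub, Finset.sum_sub_distrib, mul_ite, mul_one,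
      mul_zero, Finset.sum_ite_eq', Finset.mem_univ, if_true, Pi.zero_apply]
    have : ∀ j, (if j < c then M i j * M j c else 0) =
        if i = j then (if i < c then M i c else 0) else 0 := by
      intro j
      by_cases hj : j < c
      · rw [if_pos hj, h1 i j hj]
        by_cases hij : i = j
        · subst hij; simp [hj]
        · simp [hij]
      · by_cases hij : i = j
        · subst hij; simp [hj]
        · simp [hj, hij]
    rw [Finset.sum_congr rfl fun j _ => this j, Finset.sum_ite_eq, if_pos (Finset.mem_univ _)]
    by_cases hi : i < c
    · simp [hi]
    · simp [hi, h2 i (not_lt.1 hi)]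

def swapBody : Stmt :=
  setR xtmp (.get aA vc vq) ;;
  putR aA vc vq (.get aA vpiv vq) ;;
  putR aA vpiv vq xtmp ;;
  setR xtmp (.get aR vc vq) ;;
  putR aR vc vq (.get aR vpiv vq) ;;
  putR aR vpiv vq xtmp

def swapRows : Stmt :=
  ite (eqN vpiv vc) skip (setR xZ0 (.neg xZ0) ;; loop vq n1 nN swapBody)

theorem swapLoop_spec {N : ℕ} {σ : Store} {c p : Fin N} (hN : σ.nvar nN = N)
    (hc : σ.nvar vc = c + 1) (hp : σ.nvar vpiv = p + 1) {a : RArr} (ha : a = aA ∨ a = aR) :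
    mat N (((loop vq n1 nN swapBody).exec σ).rarr a) =
      (mat N (σ.rarr a)).submatrix (Equiv.swap c p) id := by
  have key := exec_loop_one (x := vq) (hi := nN) (σ := σ) (n := N) (body := swapBody)
    (fun u τ => ∀ i j : Fin N, τ.rarr a (i + 1) (j + 1) =
      if (j : ℕ) < u then σ.rarr a (Equiv.swap c p i + 1) (j + 1)
      else σ.rarr a (i + 1) (j + 1)) hN ?_ ?_
  · ext i j
    exact (key i j).trans (by simp [mat])
  · intro i j
    simp
  · intro u τ hu hτ hP i j
    have hc' : τ.nvar vc = c + 1 := (hτ.nvar _ rfl).trans hc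
    have hp' : τ.nvar vpiv = p + 1 := (hτ.nvar _ rfl).trans hp
    have hgen : (swapBody.exec { τ with nvar := Function.update τ.nvar vq (u + 1) }).rarr a
        (i + 1) (j + 1) = if (j : ℕ) = u then
          (if i = p then τ.rarr a (c + 1) (j + 1) else if i = c then τ.rarr a (p + 1) (j + 1)
            else τ.rarr a (i + 1) (j + 1)) else τ.rarr a (i + 1) (j + 1) := by
      rcases ha with rfl | rfl
      all_goals
        simp [swapBody, hc', hp', Fin.val_inj]
        by_cases hj : (j : ℕ) = u
        · simp only [hj, and_true, if_true]
        · simp [hj]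
    rw [hgen, hP i j, hP c j, hP p j]
    by_cases hj : (j : ℕ) = u
    · simp only [hj, if_true, lt_irrefl, if_false, Nat.lt_succ_self]
      by_cases hip : i = p
      · subst hip; simp
      · by_cases hic : i = c
        · subst hic; simp [hip]
        · simp [hip, hic, Equiv.swap_apply_of_ne_of_ne hic hip]
    · have : (j : ℕ) < u ↔ (j : ℕ) < u + 1 := by omega
      simp only [hj, if_false, this]

/-- The sign of the exchange is absorbed by `xZ0`, so that the product with the determinant is
invariant. -/
theorem swapRows_spec {N : ℕ} {σ : Store} {c p : Fin N} (hN : σ.nvar nN = N)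
    (hc : σ.nvar vc = c + 1) (hp : σ.nvar vpiv = p + 1) :
    mat N ((swapRows.exec σ).rarr aA) = (mat N (σ.rarr aA)).submatrix (Equiv.swap c p) id ∧
    mat N ((swapRows.exec σ).rarr aR) = (mat N (σ.rarr aR)).submatrix (Equiv.swap c p) id ∧
    (swapRows.exec σ).rvar xZ0 * (mat N ((swapRows.exec σ).rarr aA)).det =
      σ.rvar xZ0 * (mat N (σ.rarr aA)).det := by
  by_cases hcp : p = c
  · subst hcp
    rw [swapRows, exec_ite_pos _ (by simp [hc, hp])]
    simp
  · rw [swapRows, exec_ite_neg _ (by simp [hc, hp, Fin.val_inj, hcp]), exec_seq]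
    have hA := swapLoop_spec (σ := (setR xZ0 (RExp.neg xZ0)).exec σ) hN hc hp (Or.inl rfl)
    have hR := swapLoop_spec (σ := (setR xZ0 (RExp.neg xZ0)).exec σ) hN hc hp (Or.inr rfl)
    have hZ := (exec_agree (loop vq n1 nN swapBody) ((setR xZ0 (RExp.neg xZ0)).exec σ)).rvar xZ0 rfl
    refine ⟨hA, hR, ?_⟩
    rw [hA, hZ, Matrix.det_permute, Equiv.Perm.sign_swap (Ne.symm hcp)]
    simp

def scaleBody : Stmt :=
  putR aA vc vq (.get aA vc vq /ᵣ xp) ;;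
  putR aR vc vq (.get aR vc vq /ᵣ xp)

theorem scaleLoop_spec {N : ℕ} {σ : Store} {c : Fin N} (hN : σ.nvar nN = N)
    (hc : σ.nvar vc = c + 1) {a : RArr} (ha : a = aA ∨ a = aR) :
    mat N (((loop vq n1 nN scaleBody).exec σ).rarr a) =
      (mat N (σ.rarr a)).updateRow c ((σ.rvar xp)⁻¹ • mat N (σ.rarr a) c) := by
  have key := exec_loop_one (x := vq) (hi := nN) (σ := σ) (n := N) (body := scaleBody)
    (fun u τ => ∀ i j : Fin N, τ.rarr a (i + 1) (j + 1) =
      if i = c ∧ (j : ℕ) < u then σ.rarr a (i + 1) (j + 1) / σ.rvar xp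
      else σ.rarr a (i + 1) (j + 1)) hN ?_ ?_
  · ext i j
    refine (key i j).trans ?_
    by_cases hi : i = c
    · subst hi
      simp [mat, div_eq_inv_mul]
    · simp [mat, hi]
  · intro i j
    simp
  · intro u τ hu hτ hP i j
    have hc' : τ.nvar vc = c + 1 := (hτ.nvar _ rfl).trans hc
    have hp' : τ.rvar xp = σ.rvar xp := hτ.rvar _ rfl
    have hgen : (scaleBody.exec { τ with nvar := Function.update τ.nvar vq (u + 1) }).rarr a
        (i + 1) (j + 1) = if i = c ∧ (j : ℕ) = u then τ.rarr a (i + 1) (j + 1) / σ.rvar xp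
          else τ.rarr a (i + 1) (j + 1) := by
      rcases ha with rfl | rfl
      all_goals
        simp [scaleBody, hc', hp', Fin.val_inj]
        split_ifs with h
        · rw [h.1, h.2]
        · rfl
    rw [hgen, hP i j]
    by_cases hi : i = c
    · by_cases hj : (j : ℕ) = u
      · simp [hi, hj]
      · have : (j : ℕ) < u ↔ (j : ℕ) < u + 1 := by omega
        simp [hi, hj, this]
    · simp [hi]

def clearBody : Stmt :=
  putR aA vr vq (.get aA vr vq -ᵣ xf *ᵣ .get aA vc vq) ;;
  putR aR vr vq (.get aR vr vq -ᵣ xf *ᵣ .get aR vc vq)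

/-- The multiplier sits in `xf` because the entry it comes from is overwritten during the loop, and
`r ≠ c` keeps the pivot row intact. -/
theorem clearRow_spec {N : ℕ} {σ : Store} {c r : Fin N} (hN : σ.nvar nN = N)
    (hc : σ.nvar vc = c + 1) (hr : σ.nvar vr = r + 1) (hrc : r ≠ c) {a : RArr}
    (ha : a = aA ∨ a = aR) :
    mat N (((loop vq n1 nN clearBody).exec σ).rarr a) = fun i j =>
      if i = r then mat N (σ.rarr a) i j - σ.rvar xf * mat N (σ.rarr a) c j
      else mat N (σ.rarr a) i j := by
  have key := exec_loop_one (x := vq) (hi := nN) (σ := σ) (n := N) (body := clearBody)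
    (fun u τ => ∀ i j : Fin N, τ.rarr a (i + 1) (j + 1) =
      if i = r ∧ (j : ℕ) < u then
        σ.rarr a (i + 1) (j + 1) - σ.rvar xf * σ.rarr a (c + 1) (j + 1)
      else σ.rarr a (i + 1) (j + 1)) hN ?_ ?_
  · ext i j
    exact (key i j).trans (by simp [mat])
  · intro i j
    simp
  · intro u τ hu hτ hP i j
    have hc' : τ.nvar vc = c + 1 := (hτ.nvar _ rfl).trans hc
    have hr' : τ.nvar vr = r + 1 := (hτ.nvar _ rfl).trans hr
    have hf' : τ.rvar xf = σ.rvar xf := hτ.rvar _ rfl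
    have hgen : (clearBody.exec { τ with nvar := Function.update τ.nvar vq (u + 1) }).rarr a
        (i + 1) (j + 1) = if i = r ∧ (j : ℕ) = u then
          τ.rarr a (i + 1) (j + 1) - σ.rvar xf * τ.rarr a (c + 1) (j + 1)
          else τ.rarr a (i + 1) (j + 1) := by
      rcases ha with rfl | rfl
      all_goals
        simp [clearBody, hc', hr', hf', Fin.val_inj]
        split_ifs with h
        · rw [h.1, h.2]
        · rfl
    rw [hgen, hP i j, hP c j]
    by_cases hi : i = r
    · by_cases hj : (j : ℕ) = u
      · simp [hi, hj, Ne.symm hrc]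
      · have : (j : ℕ) < u ↔ (j : ℕ) < u + 1 := by omega
        simp [hi, hj, this]
    · simp [hi]

def clearColumn : Stmt :=
  loop vr n1 nN (
    ite (eqN vr vc) skip (setR xf (.get aA vr vc) ;; loop vq n1 nN clearBody))

/-- Row `i` is touched only in its own pass and row `c` never, so all multipliers are entries of the
original column. Adding multiples of one fixed row is the shape for which the determinant is known
to be unchanged. -/
theorem clearColumn_spec {N : ℕ} {σ : Store} {c : Fin N} (hN : σ.nvar nN = N)
    (hc : σ.nvar vc = c + 1) {a : RArr} (ha : a = aA ∨ a = aR) :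
    mat N ((clearColumn.exec σ).rarr a) = fun i j =>
      mat N (σ.rarr a) i j + (if i = c then 0 else - mat N (σ.rarr aA) i c) *
        mat N (σ.rarr a) c j := by
  have key := exec_loop_one (x := vr) (hi := nN) (σ := σ) (n := N)
    (body := ite (eqN vr vc) skip (setR xf (.get aA vr vc) ;; loop vq n1 nN clearBody))
    (fun u τ => ∀ a, a = aA ∨ a = aR → ∀ i j : Fin N, mat N (τ.rarr a) i j =
      if i ≠ c ∧ (i : ℕ) < u then
        mat N (σ.rarr a) i j - mat N (σ.rarr aA) i c * mat N (σ.rarr a) c j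
      else mat N (σ.rarr a) i j) hN ?_ ?_
  · ext i j
    refine (key a ha i j).trans ?_
    by_cases hi : i = c
    · simp [hi]
    · simp [hi]
      ring
  · intro a _ i j
    simp
  · intro u τ hu hτ hP a ha i j
    have hc' : τ.nvar vc = c + 1 := (hτ.nvar _ rfl).trans hc
    by_cases huc : u = c
    · rw [exec_ite_pos _ (by simp [hc', huc]), exec_skip]
      refine (hP a ha i j).trans ?_
      have : (i ≠ c ∧ (i : ℕ) < u) ↔ (i ≠ c ∧ (i : ℕ) < u + 1) := by
        rw [ne_eq, Fin.ext_iff]; omega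
      simp only [this]
    · rw [exec_ite_neg _ (by simp [hc', huc]), exec_seq]
      set υ := (setR xf (RExp.get aA vr vc)).exec
        { τ with nvar := Function.update τ.nvar vr (u + 1) } with hυ
      have hυc : υ.nvar vc = c + 1 := by rw [hυ]; simp [hc']
      have hrc : (⟨u, hu⟩ : Fin N) ≠ c := fun h => huc (by rw [← h])
      rw [clearRow_spec (σ := υ) (r := ⟨u, hu⟩) (by rw [hυ]; simp; exact (hτ.nvar _ rfl).trans hN)
        hυc (by rw [hυ]; simp) hrc ha]
      have hf : υ.rvar xf = mat N (τ.rarr aA) ⟨u, hu⟩ c := by rw [hυ]; simp [hc', mat]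
      have hυa : υ.rarr = τ.rarr := rfl
      simp only [hf, hυa]
      rw [hP a ha i j, hP a ha c j, hP aA (Or.inl rfl) ⟨u, hu⟩ c]
      by_cases hi : i = ⟨u, hu⟩
      · subst hi
        simp [hrc]
      · have : (i : ℕ) < u ↔ (i : ℕ) < u + 1 := by rw [Fin.ext_iff] at hi; simp at hi; omega
        simp [hi, this]

theorem eliminate_eq : eliminate = (swapRows ;; setR xp (.get aA vc vc) ;; setR xZ0 (xZ0 *ᵣ xp) ;;
    loop vq n1 nN scaleBody ;; clearColumn) := rfl

/-- The state of the elimination of `[Λ | 1]` when `u` columns are done. -/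
structure Reduced {N : ℕ} (Λ : Matrix (Fin N) (Fin N) ℝ) (u : ℕ) (τ : Store) : Prop where
  mul : mat N (τ.rarr aR) * Λ = mat N (τ.rarr aA)
  det : τ.rvar xZ0 * (mat N (τ.rarr aA)).det = Λ.det
  unit : ∀ i j : Fin N, (j : ℕ) < u → mat N (τ.rarr aA) i j = if i = j then 1 else 0

/-- The same row operations act on `A` and `R`, which preserves `R * Λ = A`. Division by the pivot
divides the determinant of `A` by it, and `xZ0` is multiplied by it in turn. -/
theorem eliminate_spec {N : ℕ} {Λ : Matrix (Fin N) (Fin N) ℝ} {σ : Store} {c p : Fin N}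
    (hN : σ.nvar nN = N) (hc : σ.nvar vc = c + 1) (hp : σ.nvar vpiv = p + 1) (hcp : c ≤ p)
    (h0 : mat N (σ.rarr aA) p c ≠ 0) (h : Reduced Λ c σ) : Reduced Λ (c + 1) (eliminate.exec σ) := by
  rw [eliminate_eq]
  simp only [exec_seq]
  obtain ⟨hA1, hR1, hZ1⟩ := swapRows_spec hN hc hp
  have ag1 := exec_agree swapRows σ
  set σ1 := swapRows.exec σ
  set σ2 := (setR xZ0 (xZ0 *ᵣ xp)).exec ((setR xp (.get aA vc vc)).exec σ1) with hσ2
  have hN2 : σ2.nvar nN = N := (ag1.nvar nN rfl).trans hN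
  have hc2 : σ2.nvar vc = c + 1 := (ag1.nvar vc rfl).trans hc
  have hc1 : σ1.nvar vc = c + 1 := hc2
  have hxp : σ2.rvar xp = mat N (σ1.rarr aA) c c := by rw [hσ2]; simp [hc1, mat]
  have hxZ : σ2.rvar xZ0 = σ1.rvar xZ0 * mat N (σ1.rarr aA) c c := by rw [hσ2]; simp [hc1, mat]
  have hpiv : mat N (σ1.rarr aA) c c ≠ 0 := by rw [hA1]; simpa using h0
  have hA2 := scaleLoop_spec (σ := σ2) hN2 hc2 (Or.inl rfl)
  have hR2 := scaleLoop_spec (σ := σ2) hN2 hc2 (Or.inr rfl)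
  have ag3 := exec_agree (loop vq n1 nN scaleBody) σ2
  set σ3 := (loop vq n1 nN scaleBody).exec σ2
  have hN3 : σ3.nvar nN = N := (ag3.nvar nN rfl).trans hN2
  have hc3 : σ3.nvar vc = c + 1 := (ag3.nvar vc rfl).trans hc2
  have hA4 := clearColumn_spec (σ := σ3) hN3 hc3 (Or.inl rfl)
  have hR4 := clearColumn_spec (σ := σ3) hN3 hc3 (Or.inr rfl)
  have hZ4 : (clearColumn.exec σ3).rvar xZ0 = σ1.rvar xZ0 * mat N (σ1.rarr aA) c c :=
    ((exec_agree clearColumn σ3).rvar xZ0 rfl).trans ((ag3.rvar xZ0 rfl).trans hxZ)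
  have hσ2a : σ2.rarr = σ1.rarr := rfl
  rw [hσ2a, hxp] at hA2 hR2
  have hmul1 : mat N (σ1.rarr aR) * Λ = mat N (σ1.rarr aA) := by
    rw [hA1, hR1, ← h.mul]
    rfl
  have hmul3 : mat N (σ3.rarr aR) * Λ = mat N (σ3.rarr aA) := by
    rw [hA2, hR2, ← hmul1]
    ext i j
    by_cases hi : i = c
    · subst hi
      simp [Matrix.mul_apply, Finset.mul_sum, mul_assoc]
    · simp [Matrix.mul_apply, hi]
  have hdet3 : (mat N (σ3.rarr aA)).det = (mat N (σ1.rarr aA) c c)⁻¹ * (mat N (σ1.rarr aA)).det := by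
    rw [hA2, Matrix.det_updateRow_smul, Matrix.updateRow_eq_self]
  -- The exchange involves only rows from `c` on, where the finished columns are zero.
  have hunit1 : ∀ i j : Fin N, j < c → mat N (σ1.rarr aA) i j = if i = j then 1 else 0 := by
    intro i j hj
    rw [hA1, Matrix.submatrix_apply, id, h.unit _ _ hj]
    have : Equiv.swap c p i = j ↔ i = j := by
      rw [Equiv.swap_apply_eq_iff, Equiv.swap_apply_of_ne_of_ne hj.ne (hj.trans_le hcp).ne]
    simp only [this]
  have hunit3 : ∀ i j : Fin N, j < c → mat N (σ3.rarr aA) i j = if i = j then 1 else 0 := by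
    intro i j hj
    rw [hA2]
    by_cases hi : i = c
    · subst hi
      simp [hunit1 i j hj, hj.ne']
    · simp [hi, hunit1 i j hj]
  have hcc3 : mat N (σ3.rarr aA) c c = 1 := by
    rw [hA2]
    simp [hpiv]
  refine ⟨?_, ?_, ?_⟩
  · rw [hA4, hR4, ← hmul3]
    ext i j
    refine (Matrix.mul_apply (M := fun i j => mat N (σ3.rarr aR) i j + _ * _)).trans ?_
    generalize (if i = c then (0 : ℝ) else _) = y
    simp only [Matrix.mul_apply, add_mul, Finset.sum_add_distrib, Finset.mul_sum, mul_assoc]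
  · rw [hZ4]
    have : (mat N ((clearColumn.exec σ3).rarr aA)).det = (mat N (σ3.rarr aA)).det := by
      refine Matrix.det_eq_of_forall_row_eq_smul_add_const
        (fun i => if i = c then 0 else - mat N (σ3.rarr aA) i c) c (by simp) ?_
      intro i j
      rw [hA4]
    rw [this, hdet3, ← h.det, ← hZ1]
    field_simp
  · intro i j hj
    rw [hA4]
    simp only
    by_cases hjc : j = c
    · subst hjc
      rw [hcc3]
      by_cases hi : i = j
      · subst hi; simp [hcc3]
      · simp [hi]
    · have hlt : j < c := by
        rw [Fin.ext_iff] at hjc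
        rw [Fin.lt_def]
        omega
      rw [hunit3 i j hlt, hunit3 c j hlt, if_neg hlt.ne' ]
      simp

def findPivot : Stmt :=
  loop vr vc nN (
      ite (eqN vpiv n0)
        (ite (isZero (.get aA vr vc)) skip (setN vpiv vr))
        skip)

/-- Rows are numbered from `1`, so `0` can stand for "no pivot found yet". -/
theorem findPivot_spec {N : ℕ} {σ : Store} {c : Fin N} (hN : σ.nvar nN = N)
    (hc : σ.nvar vc = c + 1) (hpiv : σ.nvar vpiv = 0)
    (hex : ∃ i, c ≤ i ∧ mat N (σ.rarr aA) i c ≠ 0) :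
    ∃ p : Fin N, c ≤ p ∧ (findPivot.exec σ).nvar vpiv = p + 1 ∧ mat N (σ.rarr aA) p c ≠ 0 := by
  have key := exec_loop_induct (x := vr) (lo := vc) (hi := nN) (σ := σ) (a := c + 1) (b := N)
    (body := ite (eqN vpiv n0) (ite (isZero (.get aA vr vc)) skip (setN vpiv vr)) skip)
    (fun v τ => (τ.nvar vpiv = 0 ∧ ∀ i : Fin N, c ≤ i → (i : ℕ) + 1 < v →
        mat N (σ.rarr aA) i c = 0) ∨
      ∃ p : Fin N, c ≤ p ∧ τ.nvar vpiv = p + 1 ∧ mat N (σ.rarr aA) p c ≠ 0) hc hN (by omega) ?_ ?_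
  · rcases key with ⟨-, h⟩ | h
    · obtain ⟨i, hi, hne⟩ := hex
      exact absurd (h i hi (by omega)) hne
    · exact h
  · refine Or.inl ⟨hpiv, fun i hi hlt => ?_⟩
    rw [Fin.le_def] at hi
    omega
  · intro v τ hv1 hv2 hτ hP
    have hc' : τ.nvar vc = c + 1 := (hτ.nvar _ rfl).trans hc
    have hA : τ.rarr aA = σ.rarr aA := hτ.rarr _ rfl
    obtain ⟨w, rfl⟩ : ∃ w, v = w + 1 := ⟨v - 1, by omega⟩
    have hw : w < N := by omega
    rcases hP with ⟨h0, hz⟩ | ⟨p, hp1, hp2, hp3⟩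
    · rw [exec_ite_pos _ (by simp [h0])]
      by_cases hA0 : mat N (σ.rarr aA) ⟨w, hw⟩ c = 0
      · rw [exec_ite_pos _ (by simpa [hc', hA, mat] using hA0), exec_skip]
        refine Or.inl ⟨by simp [h0], fun i hi hlt => ?_⟩
        by_cases hiw : (i : ℕ) = w
        · have : i = ⟨w, hw⟩ := Fin.ext hiw
          rw [this, hA0]
        · exact hz i hi (by omega)
      · rw [exec_ite_neg _ (by simpa [hc', hA, mat] using hA0)]
        refine Or.inr ⟨⟨w, hw⟩, ?_, by simp, hA0⟩
        rw [Fin.le_def]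
        simp only
        omega
    · rw [exec_ite_neg _ (by simp [hp2]), exec_skip]
      exact Or.inr ⟨p, hp1, by simp [hp2], hp3⟩

def initElimination : Stmt :=
  loop vr n1 nN (loop vq n1 nN (
    putR aA vr vq (.get aL0 vr vq) ;;
    putR aR vr vq (.indEq vr vq)))

theorem initElimination_spec {N : ℕ} {σ : Store} (hN : σ.nvar nN = N) :
    mat N ((initElimination.exec σ).rarr aA) = mat N (σ.rarr aL0) ∧
    mat N ((initElimination.exec σ).rarr aR) = 1 := by
  have key := exec_loop_one (x := vr) (hi := nN) (σ := σ) (n := N)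
    (body := loop vq n1 nN (
      putR aA vr vq (.get aL0 vr vq) ;; putR aR vr vq (.indEq vr vq)))
    (fun u τ => ∀ i j : Fin N, (i : ℕ) < u → mat N (τ.rarr aA) i j = mat N (σ.rarr aL0) i j ∧
      mat N (τ.rarr aR) i j = if i = j then 1 else 0) hN ?_ ?_
  · refine ⟨?_, ?_⟩
    · ext i j
      exact (key i j i.is_lt).1
    · ext i j
      exact (key i j i.is_lt).2
  · intro i j h
    omega
  · intro u τ hu hτ hP
    have hL0 : τ.rarr aL0 = σ.rarr aL0 := hτ.rarr _ rfl
    have key := exec_loop_one (x := vq) (hi := nN) (n := N)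
      (σ := { τ with nvar := Function.update τ.nvar vr (u + 1) })
      (body := putR aA vr vq (.get aL0 vr vq) ;; putR aR vr vq (.indEq vr vq))
      (fun w υ => ∀ i j : Fin N, (i : ℕ) < u ∨ (i : ℕ) = u ∧ (j : ℕ) < w →
        mat N (υ.rarr aA) i j = mat N (σ.rarr aL0) i j ∧
        mat N (υ.rarr aR) i j = if i = j then 1 else 0) ?_ ?_ ?_
    · intro i j hi
      exact key i j (by omega)
    · simp
      exact (hτ.nvar _ rfl).trans hN
    · intro i j hi
      exact hP i j (by omega)
    · intro w υ hw hυ hQ i j hij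
      have hr : υ.nvar vr = u + 1 := (hυ.nvar vr rfl).trans (by simp)
      have hL : υ.rarr aL0 = σ.rarr aL0 := (hυ.rarr _ rfl).trans hL0
      by_cases h : (i : ℕ) = u ∧ (j : ℕ) = w
      · simp [mat, hr, hL, h.1, h.2, Fin.ext_iff]
      · have := hQ i j (by omega)
        simp only [mat] at this ⊢
        simp [hr, h, this]

def elimLoop : Stmt :=
  loop vc n1 nN (
    setN vpiv n0 ;; findPivot ;; ite (eqN vpiv n0) (setR xZ0 (.lit 0)) eliminate)

/-- The invariant keeps `xZ0 * det A` equal to `det Λ ≠ 0`, so `A` remains nonsingular and every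
column finds its pivot. -/
theorem elimLoop_spec {N : ℕ} {Λ : Matrix (Fin N) (Fin N) ℝ} {σ : Store}
    (hN : σ.nvar nN = N) (hΛ : Λ.det ≠ 0) (h : Reduced Λ 0 σ) : Reduced Λ N (elimLoop.exec σ) := by
  refine exec_loop_one (Reduced Λ) hN h ?_
  intro u τ hu hτ hP
  simp only [exec_seq]
  set τ1 := (setN vpiv n0).exec { τ with nvar := Function.update τ.nvar vc (u + 1) } with hτ1
  let c : Fin N := ⟨u, hu⟩
  have hN1 : τ1.nvar nN = N := by
    rw [hτ1]; simp
    exact (hτ.nvar _ rfl).trans hN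
  have hc1 : τ1.nvar vc = c + 1 := by rw [hτ1]; simp [c]
  have hτ1a : τ1.rarr = τ.rarr := rfl
  have hτ1r : τ1.rvar = τ.rvar := rfl
  have hdet : (mat N (τ1.rarr aA)).det ≠ 0 := by
    intro h0
    apply hΛ
    rw [← hP.det, ← hτ1a, h0, mul_zero]
  obtain ⟨p, hcp, hp, hne⟩ := findPivot_spec (σ := τ1) hN1 hc1 (by rw [hτ1]; simp) (by
    by_contra! hcon
    exact hdet (det_eq_zero_of_unit_columns _ c (fun i j hj => hP.unit i j hj) hcon))
  have ag := exec_agree findPivot τ1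
  rw [exec_ite_neg _ (by simp [hp])]
  refine eliminate_spec (c := c) ((ag.nvar _ rfl).trans hN1) ((ag.nvar _ rfl).trans hc1) hp hcp
    ?_ ?_
  · rwa [ag.rarr aA rfl]
  · refine ⟨?_, ?_, ?_⟩
    · rw [ag.rarr aA rfl, ag.rarr aR rfl]
      exact hP.mul
    · rw [ag.rarr aA rfl, ag.rvar xZ0 rfl]
      exact hP.det
    · rw [ag.rarr aA rfl]
      exact hP.unit

def transposeInverse : Stmt :=
  loop vr n1 nN (loop vq n1 nN (putR aB0 vr vq (.get aR vq vr)))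

theorem transposeInverse_spec {N : ℕ} {σ : Store} (hN : σ.nvar nN = N) :
    mat N ((transposeInverse.exec σ).rarr aB0) = (mat N (σ.rarr aR)).transpose := by
  have key := exec_loop_one (x := vr) (hi := nN) (σ := σ) (n := N)
    (body := loop vq n1 nN (putR aB0 vr vq (.get aR vq vr)))
    (fun u τ => ∀ i j : Fin N, (i : ℕ) < u →
      mat N (τ.rarr aB0) i j = mat N (σ.rarr aR) j i) hN ?_ ?_
  · ext i j
    exact key i j i.is_lt
  · intro i j h
    omega
  · intro u τ hu hτ hP
    have hR : τ.rarr aR = σ.rarr aR := hτ.rarr _ rfl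
    have key := exec_loop_one (x := vq) (hi := nN) (n := N)
      (σ := { τ with nvar := Function.update τ.nvar vr (u + 1) })
      (body := putR aB0 vr vq (.get aR vq vr))
      (fun w υ => ∀ i j : Fin N, (i : ℕ) < u ∨ (i : ℕ) = u ∧ (j : ℕ) < w →
        mat N (υ.rarr aB0) i j = mat N (σ.rarr aR) j i) ?_ ?_ ?_
    · intro i j hi
      exact key i j (by omega)
    · simp
      exact (hτ.nvar _ rfl).trans hN
    · intro i j hi
      exact hP i j (by omega)
    · intro w υ hw hυ hQ i j hij
      have hr : υ.nvar vr = u + 1 := (hυ.nvar vr rfl).trans (by simp)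
      have hL : υ.rarr aR = σ.rarr aR := (hυ.rarr _ rfl).trans hR
      by_cases h : (i : ℕ) = u ∧ (j : ℕ) = w
      · simp [mat, hr, hL, h.1, h.2]
      · have := hQ i j (by omega)
        simp only [mat] at this ⊢
        simp [hr, h, this]

theorem detAndInverse_eq : detAndInverse =
    (initElimination ;; setR xZ0 (.lit 1) ;; elimLoop ;; transposeInverse) := rfl

theorem detAndInverse_spec {N : ℕ} {σ : Store} (hN : σ.nvar nN = N)
    (hdet : (mat N (σ.rarr aL0)).det ≠ 0) :
    (detAndInverse.exec σ).rvar xZ0 = (mat N (σ.rarr aL0)).det ∧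
    (mat N ((detAndInverse.exec σ).rarr aB0)).transpose * mat N (σ.rarr aL0) = 1 := by
  rw [detAndInverse_eq]
  simp only [exec_seq]
  obtain ⟨hA, hR⟩ := initElimination_spec hN
  have ag1 := exec_agree initElimination σ
  set σ1 := initElimination.exec σ
  set σ2 := (setR xZ0 (RExp.lit 1)).exec σ1 with hσ2
  have hN2 : σ2.nvar nN = N := (ag1.nvar nN rfl).trans hN
  have h2a : σ2.rarr = σ1.rarr := rfl
  have hred : Reduced (mat N (σ.rarr aL0)) 0 σ2 := by
    refine ⟨?_, ?_, fun _ _ h => absurd h (by omega)⟩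
    · rw [h2a, hA, hR, one_mul]
    · rw [h2a, hA, hσ2]
      simp
  have hfin := elimLoop_spec hN2 hdet hred
  have ag3 := exec_agree elimLoop σ2
  set σ3 := elimLoop.exec σ2
  have hA3 : mat N (σ3.rarr aA) = 1 := by
    ext i j
    rw [hfin.unit i j j.is_lt, Matrix.one_apply]
  refine ⟨?_, ?_⟩
  · rw [(exec_agree transposeInverse σ3).rvar xZ0 rfl, ← hfin.det, hA3, Matrix.det_one, mul_one]
  · rw [transposeInverse_spec ((ag3.nvar nN rfl).trans hN2), Matrix.transpose_transpose, hfin.mul,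
      hA3]

/-! ## Rank-one updates -/

/-- Cramer's rule, with `B.transpose` as the inverse of `L`. It serves both to read off the edge
marginals and to update `Z`. -/
theorem det_updateCol_eq {N : ℕ} {L B : Matrix (Fin N) (Fin N) ℝ} (h : B.transpose * L = 1)
    (c : Fin N) (v : Fin N → ℝ) :
    (L.updateCol c v).det = L.det * ∑ r, v r * B r c := by
  have h1 : L.cramer v = L.det • (B.transpose.mulVec v) := by
    have := congrArg (fun y => B.transpose.mulVec y) (Matrix.mulVec_cramer L v)
    simpa only [Matrix.mulVec_mulVec, h, Matrix.one_mulVec, Matrix.mulVec_smul] using this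
  have h2 := congrFun h1 c
  rw [Matrix.cramer_apply] at h2
  rw [h2, Pi.smul_apply, smul_eq_mul]
  congr 1
  simp only [Matrix.mulVec, dotProduct, Matrix.transpose_apply, mul_comm]

/-- The Sherman-Morrison formula for the change `u = v - L[:, c]`. Its denominator `1 + uᵀ B[:, c]`
simplifies to `∑ v B[:, c]`, the ratio of the new determinant to the old. -/
theorem inverse_updateCol {N : ℕ} {L B B' : Matrix (Fin N) (Fin N) ℝ} (h : B.transpose * L = 1)
    (c : Fin N) (v : Fin N → ℝ) (hα : ∑ r, v r * B r c ≠ 0)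
    (hB' : ∀ r q, B' r q = B r q - B r c * (∑ x, (v x - L x c) * B x q) / ∑ x, v x * B x c) :
    B'.transpose * L.updateCol c v = 1 := by
  have hent : ∀ q x, ∑ r, B r q * L r x = if q = x then 1 else 0 := fun q x => by
    have := congrFun (congrFun h q) x
    rwa [Matrix.mul_apply, Matrix.one_apply] at this
  ext q x
  set α := ∑ x, v x * B x c
  set V := ∑ x, (v x - L x c) * B x q with hV
  -- Column `c` of `L` is sent to a unit vector by `B.transpose`.
  have hVeq : V = ∑ r, B r q * v r - if q = c then 1 else 0 := by
    rw [hV, ← hent q c, ← Finset.sum_sub_distrib]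
    exact Finset.sum_congr rfl fun r _ => by ring
  have hsplit : (B'.transpose * L.updateCol c v) q x =
      ∑ r, B r q * L.updateCol c v r x - V / α * ∑ r, B r c * L.updateCol c v r x := by
    rw [Matrix.mul_apply, Finset.mul_sum, ← Finset.sum_sub_distrib]
    refine Finset.sum_congr rfl fun r _ => ?_
    rw [Matrix.transpose_apply, hB']
    ring
  rw [hsplit, Matrix.one_apply]
  by_cases hx : x = c
  · subst hx
    simp only [Matrix.updateCol_self]
    have : ∑ r, B r x * v r = α := Finset.sum_congr rfl fun r _ => mul_comm _ _
    rw [this, div_mul_cancel₀ _ hα, hVeq]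
    ring
  · simp only [Matrix.updateCol_ne hx, hent, if_neg (Ne.symm hx)]
    ring

/-! ## Sampling an edge -/

/-- The first `n` entries of the list of earlier trees. -/
def dlist (σ : Store) (n : ℕ) : List ℕ := (List.range n).map fun s => σ.narr aD 0 (s + 1)

theorem dlist_succ (σ : Store) (n : ℕ) : dlist σ (n + 1) = dlist σ n ++ [σ.narr aD 0 (n + 1)] := by
  simp [dlist, List.range_succ]

/-- The total weight of the listed trees whose edge into the node `j` has the tail `i`. -/
noncomputable def tailWeight (σ : Store) (l : List ℕ) (j i : ℕ) : ℝ :=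
  ((l.filter fun t => σ.narr aT t j = i).map fun t => σ.rarr aWt 0 t).sum

def clearSums : Stmt := loop vr n0 nN (putR aS n0 vr (.lit 0))

theorem clearSums_spec {N : ℕ} {σ : Store} (hN : σ.nvar nN = N) :
    ∀ i, i ≤ N → (clearSums.exec σ).rarr aS 0 i = 0 := by
  have key := exec_loop_zero (x := vr) (hi := nN) (σ := σ) (body := putR aS n0 vr (.lit 0))
    (fun u τ => ∀ i, i < u → τ.rarr aS 0 i = 0) hN (by omega) ?_
  · exact fun i hi => key i (by omega)
  · intro u τ hu hτ hP i hi
    by_cases h : i = u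
    · simp [h]
    · simpa [h] using hP i (by omega)

def tailSums : Stmt :=
  loop vs n1 vd (
    setN vt (.get aD n0 vs) ;;
    putR aS n0 (.get aT vt vj) (.get aS n0 (.get aT vt vj) +ᵣ .get aWt n0 vt))

theorem tailSums_spec {N d : ℕ} {σ : Store} (hd : σ.nvar vd = d)
    (h0 : ∀ i, i ≤ N → σ.rarr aS 0 i = 0) :
    ∀ i, i ≤ N → (tailSums.exec σ).rarr aS 0 i = tailWeight σ (dlist σ d) (σ.nvar vj) i := by
  refine exec_loop_one (x := vs) (hi := vd) (σ := σ)
    (fun u τ => ∀ i, i ≤ N → τ.rarr aS 0 i = tailWeight σ (dlist σ u) (σ.nvar vj) i) hd ?_ ?_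
  · intro i hi
    simp [h0 i hi, tailWeight, dlist]
  · intro u τ hu hτ hP i hi
    have hT : τ.narr = σ.narr := by
      ext a i j
      cases a
      · rw [hτ.narr aT rfl]
      · rw [hτ.narr aD rfl]
    have hW : τ.rarr aWt = σ.rarr aWt := hτ.rarr _ rfl
    have hj : τ.nvar vj = σ.nvar vj := hτ.nvar _ rfl
    have : tailWeight σ (dlist σ (u + 1)) (σ.nvar vj) i = tailWeight σ (dlist σ u) (σ.nvar vj) i +
        if σ.narr aT (σ.narr aD 0 (u + 1)) (σ.nvar vj) = i then σ.rarr aWt 0 (σ.narr aD 0 (u + 1))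
        else 0 := by
      rw [dlist_succ, tailWeight, List.filter_append, List.map_append, List.sum_append]
      congr 1
      split_ifs with h <;> simp [h]
    rw [this]
    simp [hT, hW, hj]
    by_cases h : σ.narr aT (σ.narr aD 0 (u + 1)) (σ.nvar vj) = i
    · subst h
      simp [hP _ hi]
    · simp [h, Ne.symm h, hP _ hi]

def marginals : Stmt :=
  loop vr n1 nN (
    ite (eqN vr vj)
      (putR aM n0 vr (.lit 0))
      (putR aM n0 vr
        (xZ *ᵣ (.get aW vr vj *ᵣ
            (.indNe vj n1 *ᵣ .get aB vj vj -ᵣ .indNe vr n1 *ᵣ .get aB vr vj))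
          -ᵣ .get aS n0 vr)))

theorem sum_nodeVec_mul {N : ℕ} (k : Fin N) (b : Fin N → ℝ) :
    ∑ r, nodeVec k r * b r = (if (k : ℕ) ≠ 0 then 1 else 0) * b k := by
  rw [Finset.sum_eq_single k]
  · simp [nodeVec]
  · intro r _ hr
    simp [nodeVec, hr]
  · simp

/-- The program writes `0` for the tail `j` itself. The general formula agrees there, because the
edge vector of a loop is zero and, by `hS`, no earlier tree contributes. -/
theorem marginals_spec {N : ℕ} {σ : Store} {c : Fin N} (hN : σ.nvar nN = N)
    (hj : σ.nvar vj = c + 1) (hS : σ.rarr aS 0 (c + 1) = 0) :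
    (marginals.exec σ).rarr aM 0 0 = σ.rarr aM 0 0 ∧
    ∀ k : Fin N, (marginals.exec σ).rarr aM 0 (k + 1) =
      σ.rvar xZ * (σ.rarr aW (k + 1) (c + 1) *
        ∑ r, edgeVec k.succ c r * mat N (σ.rarr aB) r c) - σ.rarr aS 0 (k + 1) := by
  have key := exec_loop_one (x := vr) (hi := nN) (σ := σ)
    (body := ite (eqN vr vj)
      (putR aM n0 vr (.lit 0))
      (putR aM n0 vr
        (xZ *ᵣ (.get aW vr vj *ᵣ
            (.indNe vj n1 *ᵣ .get aB vj vj -ᵣ .indNe vr n1 *ᵣ .get aB vr vj))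
          -ᵣ .get aS n0 vr)))
    (fun u τ => τ.rarr aM 0 0 = σ.rarr aM 0 0 ∧
      ∀ k : Fin N, (k : ℕ) < u → τ.rarr aM 0 (k + 1) =
        σ.rvar xZ * (σ.rarr aW (k + 1) (c + 1) *
          ∑ r, edgeVec k.succ c r * mat N (σ.rarr aB) r c) - σ.rarr aS 0 (k + 1))
    hN ⟨rfl, by omega⟩ ?_
  · exact ⟨key.1, fun k => key.2 k k.is_lt⟩
  · intro u τ hu hτ hP
    have hj' : τ.nvar vj = c + 1 := (hτ.nvar _ rfl).trans hj
    have hW : τ.rarr aW = σ.rarr aW := hτ.rarr _ rfl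
    have hB : τ.rarr aB = σ.rarr aB := hτ.rarr _ rfl
    have hS' : τ.rarr aS = σ.rarr aS := hτ.rarr _ rfl
    have hZ : τ.rvar xZ = σ.rvar xZ := hτ.rvar _ rfl
    by_cases huc : u = c
    · rw [exec_ite_pos _ (by simp [hj', huc])]
      refine ⟨by simpa using hP.1, fun k hk => ?_⟩
      by_cases hku : (k : ℕ) = u
      · have : k = c := Fin.ext (hku.trans huc)
        subst this
        simp [huc, hS]
      · simpa [hku] using hP.2 k (by omega)
    · rw [exec_ite_neg _ (by simp [hj', huc])]
      refine ⟨by simpa using hP.1, fun k hk => ?_⟩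
      by_cases hku : (k : ℕ) = u
      · subst hku
        simp [hj', hW, hB, hS', hZ, sub_mul, Finset.sum_sub_distrib, sum_nodeVec_mul]
        simp [mat]
      · simpa [hku] using hP.2 k (by omega)

def normalize : Stmt := loop vr n0 nN (putR aM n0 vr (.get aM n0 vr /ᵣ xZD))

theorem normalize_spec {N : ℕ} {σ : Store} (hN : σ.nvar nN = N) :
    ∀ i, i ≤ N → (normalize.exec σ).rarr aM 0 i = σ.rarr aM 0 i / σ.rvar xZD := by
  have key := exec_loop_zero (x := vr) (hi := nN) (σ := σ)
    (body := putR aM n0 vr (.get aM n0 vr /ᵣ xZD))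
    (fun u τ => ∀ i, τ.rarr aM 0 i =
      if i < u then σ.rarr aM 0 i / σ.rvar xZD else σ.rarr aM 0 i) hN (by simp) ?_
  · intro i hi
    rw [normalize, key i, if_pos (by omega)]
  · intro u τ hu hτ hP i
    have hZ : τ.rvar xZD = σ.rvar xZD := hτ.rvar _ rfl
    by_cases h : i = u
    · simp [h, hZ, hP u]
    · have : i < u ↔ i < u + 1 := by omega
      simp [h, hP i, this]

def edgeLaw : Stmt :=
  clearSums ;; tailSums ;;
  putR aM n0 n0 (xZ *ᵣ (.get aW n0 vj *ᵣ .get aB n1 vj) -ᵣ .get aS n0 n0) ;;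
  marginals ;; normalize

theorem sampleEdge_run (σ : Store) (φ) :
    ev (sampleEdge.run σ) φ = ev ((draw ve aM nN).run (edgeLaw.exec σ)) φ := by
  have h : sampleEdge = (clearSums ;; tailSums ;;
    putR aM n0 n0 (xZ *ᵣ (.get aW n0 vj *ᵣ .get aB n1 vj) -ᵣ .get aS n0 n0) ;;
    marginals ;; normalize ;; draw ve aM nN) := rfl
  rw [h]
  simp only [ev_seq]
  iterate 5 rw [ev_run_of_drawFree _ rfl]
  rfl

/-- The root case and the two indicators of the algorithm merge into the single linear form of
`edgeVec i c` with column `c` of `B`; for the root it reduces to `B[1, j]`. -/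
theorem edgeLaw_spec {N d : ℕ} {σ : Store} {c : Fin N} (hN : σ.nvar nN = N)
    (hj : σ.nvar vj = c + 1) (hd : σ.nvar vd = d)
    (hself : tailWeight σ (dlist σ d) (c + 1) (c + 1) = 0) (i : Fin (N + 1)) :
    (edgeLaw.exec σ).rarr aM 0 i = (σ.rvar xZ * (σ.rarr aW i (c + 1) *
      ∑ r, edgeVec i c r * mat N (σ.rarr aB) r c) - tailWeight σ (dlist σ d) (c + 1) i) /
        σ.rvar xZD := by
  simp only [edgeLaw, exec_seq]
  have h1 := clearSums_spec hN
  have ag1 := exec_agree clearSums σ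
  set σ1 := clearSums.exec σ
  have hdl : dlist σ1 d = dlist σ d := by simp only [dlist, ag1.narr aD rfl]
  have htw : ∀ i, tailWeight σ1 (dlist σ1 d) (σ1.nvar vj) i =
      tailWeight σ (dlist σ d) (c + 1) i := fun i => by
    simp only [tailWeight, hdl, ag1.narr aT rfl, ag1.rarr aWt rfl, ag1.nvar vj rfl, hj]
  have h2 := tailSums_spec (σ := σ1) ((ag1.nvar vd rfl).trans hd) h1
  simp only [htw] at h2
  have ag2 := exec_agree tailSums σ1
  set σ2 := tailSums.exec σ1
  have hj2 : σ2.nvar vj = c + 1 := (ag2.nvar vj rfl).trans ((ag1.nvar vj rfl).trans hj)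
  have hN2 : σ2.nvar nN = N := (ag2.nvar nN rfl).trans ((ag1.nvar nN rfl).trans hN)
  have hW2 : σ2.rarr aW = σ.rarr aW := (ag2.rarr aW rfl).trans (ag1.rarr aW rfl)
  have hB2 : σ2.rarr aB = σ.rarr aB := (ag2.rarr aB rfl).trans (ag1.rarr aB rfl)
  have hZ2 : σ2.rvar xZ = σ.rvar xZ := (ag2.rvar xZ rfl).trans (ag1.rvar xZ rfl)
  have hZD2 : σ2.rvar xZD = σ.rvar xZD := (ag2.rvar xZD rfl).trans (ag1.rvar xZD rfl)
  set σ3 := (putR aM n0 n0 (xZ *ᵣ (.get aW n0 vj *ᵣ .get aB n1 vj) -ᵣ .get aS n0 n0)).exec σ2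
    with hσ3
  have hS3 : σ3.rarr aS = σ2.rarr aS := by
    ext i j
    rw [hσ3]
    simp
  have hW3 : σ3.rarr aW = σ.rarr aW := by
    rw [← hW2]
    ext i j
    rw [hσ3]
    simp
  have hB3 : σ3.rarr aB = σ.rarr aB := by
    rw [← hB2]
    ext i j
    rw [hσ3]
    simp
  obtain ⟨hm0, hm1⟩ := marginals_spec (σ := σ3) hN2 hj2
    (by rw [hS3, h2 _ (by omega), hself])
  have ag4 := exec_agree marginals σ3
  set σ4 := marginals.exec σ3
  rw [normalize_spec ((ag4.nvar nN rfl).trans hN2) i (by omega), ag4.rvar xZD rfl]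
  have hZD3 : σ3.rvar xZD = σ.rvar xZD := hZD2
  have hZ3 : σ3.rvar xZ = σ.rvar xZ := hZ2
  rw [hZD3]
  congr 1
  refine Fin.cases ?_ (fun k => ?_) i
  · rw [Fin.val_zero, hm0, ← h2 0 (by omega), hσ3]
    have hz : ∑ r, edgeVec 0 c r * mat N (σ.rarr aB) r c = σ.rarr aB 1 (c + 1) := by
      rw [Finset.sum_eq_single ⟨0, c.pos⟩]
      · simp [rootVec, mat]
      · intro r _ hr
        have : (r : ℕ) ≠ 0 := fun h => hr (Fin.ext h)
        simp [rootVec, this]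
      · simp
    rw [hz]
    simp [hj2, hW2, hB2, hZ2]
  · rw [Fin.val_succ, hm1 k, hS3, h2 _ (by omega), hW3, hB3, hZ3]

/-! ## Conditioning on an edge -/

def columnChange : Stmt :=
  ite (eqN ve n0)
    (loop vr n1 nN (
      putR aU n0 vr (.get aW n0 vj *ᵣ .indEq vr n1 -ᵣ .get aL vr vj)))
    (loop vr n1 nN (
      putR aU n0 vr
        (.get aW ve vj *ᵣ
            (.indNe vj n1 *ᵣ .indEq vr vj -ᵣ .indNe ve n1 *ᵣ .indEq vr ve)
          -ᵣ .get aL vr vj)))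

theorem columnChange_spec {N : ℕ} {σ : Store} {c : Fin N} {i : Fin (N + 1)} (hN : σ.nvar nN = N)
    (hj : σ.nvar vj = c + 1) (he : σ.nvar ve = i) (r : Fin N) :
    (columnChange.exec σ).rarr aU 0 (r + 1) =
      σ.rarr aW i (c + 1) * edgeVec i c r - mat N (σ.rarr aL) r c := by
  revert r
  by_cases hi : i = 0
  · subst hi
    rw [columnChange, exec_ite_pos _ (by simp [he])]
    have key := exec_loop_one (x := vr) (hi := nN) (σ := σ)
      (body := putR aU n0 vr (.get aW n0 vj *ᵣ .indEq vr n1 -ᵣ .get aL vr vj))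
      (fun u τ => ∀ r : Fin N, (r : ℕ) < u → τ.rarr aU 0 (r + 1) =
        σ.rarr aW 0 (c + 1) * rootVec r - mat N (σ.rarr aL) r c) hN (by simp) ?_
    · exact fun r => key r r.is_lt
    · intro u τ hu hτ hP r hr
      have hj' : τ.nvar vj = c + 1 := (hτ.nvar _ rfl).trans hj
      have hW : τ.rarr aW = σ.rarr aW := hτ.rarr _ rfl
      have hL : τ.rarr aL = σ.rarr aL := hτ.rarr _ rfl
      by_cases h : (r : ℕ) = u
      · simp [h, hj', hW, hL, rootVec, mat]
      · simpa [h] using hP r (by omega)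
  · obtain ⟨k, rfl⟩ := Fin.exists_succ_eq.2 hi
    rw [Fin.val_succ] at he
    rw [columnChange, exec_ite_neg _ (by simp [he])]
    have key := exec_loop_one (x := vr) (hi := nN) (σ := σ)
      (body := putR aU n0 vr
        (.get aW ve vj *ᵣ
            (.indNe vj n1 *ᵣ .indEq vr vj -ᵣ .indNe ve n1 *ᵣ .indEq vr ve)
          -ᵣ .get aL vr vj))
      (fun u τ => ∀ r : Fin N, (r : ℕ) < u → τ.rarr aU 0 (r + 1) =
        σ.rarr aW (k + 1) (c + 1) * edgeVec k.succ c r - mat N (σ.rarr aL) r c) hN (by simp) ?_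
    · exact fun r => key r r.is_lt
    · intro u τ hu hτ hP r hr
      have hj' : τ.nvar vj = c + 1 := (hτ.nvar _ rfl).trans hj
      have he' : τ.nvar ve = k + 1 := (hτ.nvar _ rfl).trans he
      have hW : τ.rarr aW = σ.rarr aW := hτ.rarr _ rfl
      have hL : τ.rarr aL = σ.rarr aL := hτ.rarr _ rfl
      have hnode : ∀ x : Fin N, nodeVec x r = (if (x : ℕ) = 0 then 0 else 1) *
          if (r : ℕ) = x then 1 else 0 := fun x => by
        simp only [nodeVec, Fin.ext_iff]
        by_cases hx : (x : ℕ) = 0 <;> simp [hx]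
      by_cases h : (r : ℕ) = u
      · simp [hj', he', hW, hL, hnode, h, mat]
      · simpa [h] using hP r (by omega)

def columnUpdate : Stmt := loop vr n1 nN (putR aL vr vj (.get aL vr vj +ᵣ .get aU n0 vr))

theorem columnUpdate_spec {N : ℕ} {σ : Store} {c : Fin N} (hN : σ.nvar nN = N)
    (hj : σ.nvar vj = c + 1) :
    mat N ((columnUpdate.exec σ).rarr aL) = (mat N (σ.rarr aL)).updateCol c
      fun r => mat N (σ.rarr aL) r c + σ.rarr aU 0 (r + 1) := by
  have key := exec_loop_one (x := vr) (hi := nN) (σ := σ)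
    (body := putR aL vr vj (.get aL vr vj +ᵣ .get aU n0 vr))
    (fun u τ => ∀ r q : Fin N, τ.rarr aL (r + 1) (q + 1) =
      if (r : ℕ) < u ∧ q = c then σ.rarr aL (r + 1) (q + 1) + σ.rarr aU 0 (r + 1)
      else σ.rarr aL (r + 1) (q + 1)) hN (by simp) ?_
  · ext r q
    refine (key r q).trans ?_
    by_cases hq : q = c
    · subst hq; simp [mat]
    · simp [mat, hq]
  · intro u τ hu hτ hP r q
    have hj' : τ.nvar vj = c + 1 := (hτ.nvar _ rfl).trans hj
    have hU : τ.rarr aU = σ.rarr aU := hτ.rarr _ rfl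
    by_cases h : (r : ℕ) = u
    · by_cases hq : q = c
      · subst hq
        have := hP r q
        simp [h] at this
        simp [h, hj', hU, this]
      · simpa [hj', h, hq, Fin.val_inj] using hP r q
    · have : (r : ℕ) < u ↔ (r : ℕ) < u + 1 := by omega
      simpa [h, this] using hP r q

def updateFactor : Stmt :=
  setR xp (.lit 1) ;; loop vr n1 nN (setR xp (xp +ᵣ .get aU n0 vr *ᵣ .get aB vr vj))

theorem updateFactor_spec {N : ℕ} {σ : Store} {c : Fin N} (hN : σ.nvar nN = N)
    (hj : σ.nvar vj = c + 1) :
    (updateFactor.exec σ).rvar xp = 1 + ∑ r : Fin N, σ.rarr aU 0 (r + 1) * mat N (σ.rarr aB) r c := by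
  rw [updateFactor, exec_seq]
  have key := exec_loop_one (x := vr) (hi := nN) (σ := (setR xp (RExp.lit 1)).exec σ) (n := N)
    (body := setR xp (xp +ᵣ .get aU n0 vr *ᵣ .get aB vr vj))
    (fun u τ => τ.rvar xp =
      1 + ∑ x ∈ Finset.range u, σ.rarr aU 0 (x + 1) * σ.rarr aB (x + 1) (c + 1))
    hN (by simp) ?_
  · rw [key, Finset.sum_range fun x => σ.rarr aU 0 (x + 1) * σ.rarr aB (x + 1) (c + 1)]
    rfl
  · intro u τ hu hτ hP
    have hj' : τ.nvar vj = c + 1 := (hτ.nvar _ rfl).trans hj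
    have hU : τ.rarr aU = σ.rarr aU := hτ.rarr _ rfl
    have hB : τ.rarr aB = σ.rarr aB := hτ.rarr _ rfl
    simp [hP, hj', hU, hB, Finset.sum_range_succ, add_assoc]

def changeTimesInverse : Stmt :=
  loop vq n1 nN (
    putR aV n0 vq (.lit 0) ;;
    loop vr n1 nN (putR aV n0 vq (.get aV n0 vq +ᵣ .get aU n0 vr *ᵣ .get aB vr vq)))

theorem changeTimesInverse_spec {N : ℕ} {σ : Store} (hN : σ.nvar nN = N) (q : Fin N) :
    (changeTimesInverse.exec σ).rarr aV 0 (q + 1) =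
      ∑ r : Fin N, σ.rarr aU 0 (r + 1) * mat N (σ.rarr aB) r q := by
  have key := exec_loop_one (x := vq) (hi := nN) (σ := σ)
    (body := putR aV n0 vq (.lit 0) ;;
      loop vr n1 nN (putR aV n0 vq (.get aV n0 vq +ᵣ .get aU n0 vr *ᵣ .get aB vr vq)))
    (fun u τ => ∀ q : Fin N, (q : ℕ) < u → τ.rarr aV 0 (q + 1) =
      ∑ x ∈ Finset.range N, σ.rarr aU 0 (x + 1) * σ.rarr aB (x + 1) (q + 1)) hN (by simp) ?_
  · rw [changeTimesInverse, key q q.is_lt,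
      Finset.sum_range fun x => σ.rarr aU 0 (x + 1) * σ.rarr aB (x + 1) (q + 1)]
    rfl
  · intro u τ hu hτ hP
    rw [exec_seq]
    have hN' : τ.nvar nN = N := (hτ.nvar _ rfl).trans hN
    have hU : τ.rarr aU = σ.rarr aU := hτ.rarr _ rfl
    have hB : τ.rarr aB = σ.rarr aB := hτ.rarr _ rfl
    set τ' := (putR aV n0 vq (RExp.lit 0)).exec
      { τ with nvar := Function.update τ.nvar vq (u + 1) } with hτ'
    have key := exec_loop_one (x := vr) (hi := nN) (σ := τ') (n := N)
      (body := putR aV n0 vq (.get aV n0 vq +ᵣ .get aU n0 vr *ᵣ .get aB vr vq))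
      (fun w υ => (∀ q : Fin N, (q : ℕ) < u → υ.rarr aV 0 (q + 1) =
        ∑ x ∈ Finset.range N, σ.rarr aU 0 (x + 1) * σ.rarr aB (x + 1) (q + 1)) ∧
        υ.rarr aV 0 (u + 1) =
          ∑ x ∈ Finset.range w, σ.rarr aU 0 (x + 1) * σ.rarr aB (x + 1) (u + 1))
      (by rw [hτ']; simpa using hN') ?_ ?_
    · intro q hq
      by_cases h : (q : ℕ) = u
      · rw [h]; exact key.2
      · exact key.1 q (by omega)
    · rw [hτ']
      refine ⟨fun q hq => ?_, by simp⟩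
      simpa [hq.ne] using hP q hq
    · intro w υ hw hυ hQ
      have hq' : υ.nvar vq = u + 1 := (hυ.nvar vq rfl).trans (by rw [hτ']; simp)
      have hU' : υ.rarr aU = σ.rarr aU := by
        rw [hυ.rarr aU rfl, ← hU, hτ']
        ext i j
        simp
      have hB' : υ.rarr aB = σ.rarr aB := by
        rw [hυ.rarr aB rfl, ← hB, hτ']
        ext i j
        simp
      refine ⟨fun q hq => ?_, ?_⟩
      · simpa [hq', hq.ne] using hQ.1 q hq
      · simp [hq', hU', hB', hQ.2, Finset.sum_range_succ]

/-- The rank-one update reads column `j` of `B` while overwriting it, hence the copy. -/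
def saveColumn : Stmt := loop vr n1 nN (putR aC n0 vr (.get aB vr vj))

theorem saveColumn_spec {N : ℕ} {σ : Store} {c : Fin N} (hN : σ.nvar nN = N)
    (hj : σ.nvar vj = c + 1) (r : Fin N) :
    (saveColumn.exec σ).rarr aC 0 (r + 1) = mat N (σ.rarr aB) r c := by
  have key := exec_loop_one (x := vr) (hi := nN) (σ := σ)
    (body := putR aC n0 vr (.get aB vr vj))
    (fun u τ => ∀ r : Fin N, (r : ℕ) < u → τ.rarr aC 0 (r + 1) = mat N (σ.rarr aB) r c)
    hN (by simp) ?_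
  · exact key r r.is_lt
  · intro u τ hu hτ hP r hr
    have hj' : τ.nvar vj = c + 1 := (hτ.nvar _ rfl).trans hj
    have hB : τ.rarr aB = σ.rarr aB := hτ.rarr _ rfl
    by_cases h : (r : ℕ) = u
    · simp [h, hj', hB, mat]
    · simpa [h] using hP r (by omega)

def inverseUpdate : Stmt :=
  loop vr n1 nN (loop vq n1 nN (
    putR aB vr vq (.get aB vr vq -ᵣ .get aC n0 vr *ᵣ .get aV n0 vq /ᵣ xp)))

theorem inverseUpdate_spec {N : ℕ} {σ : Store} (hN : σ.nvar nN = N) (r q : Fin N) :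
    mat N ((inverseUpdate.exec σ).rarr aB) r q = mat N (σ.rarr aB) r q -
      σ.rarr aC 0 (r + 1) * σ.rarr aV 0 (q + 1) / σ.rvar xp := by
  have key := exec_loop_one (x := vr) (hi := nN) (σ := σ) (n := N)
    (body := loop vq n1 nN (
      putR aB vr vq (.get aB vr vq -ᵣ .get aC n0 vr *ᵣ .get aV n0 vq /ᵣ xp)))
    (fun u τ => ∀ i j : Fin N, mat N (τ.rarr aB) i j =
      if (i : ℕ) < u then mat N (σ.rarr aB) i j -
        σ.rarr aC 0 (i + 1) * σ.rarr aV 0 (j + 1) / σ.rvar xp else mat N (σ.rarr aB) i j) hN ?_ ?_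
  · exact (key r q).trans (if_pos r.is_lt)
  · intro i j
    simp
  · intro u τ hu hτ hP i j
    have hC : τ.rarr aC = σ.rarr aC := hτ.rarr _ rfl
    have hV : τ.rarr aV = σ.rarr aV := hτ.rarr _ rfl
    have hp : τ.rvar xp = σ.rvar xp := hτ.rvar _ rfl
    have key := exec_loop_one (x := vq) (hi := nN) (n := N)
      (σ := { τ with nvar := Function.update τ.nvar vr (u + 1) })
      (body := putR aB vr vq (.get aB vr vq -ᵣ .get aC n0 vr *ᵣ .get aV n0 vq /ᵣ xp))
      (fun w υ => ∀ i j : Fin N, mat N (υ.rarr aB) i j =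
        if (i : ℕ) < u ∨ (i : ℕ) = u ∧ (j : ℕ) < w then mat N (σ.rarr aB) i j -
          σ.rarr aC 0 (i + 1) * σ.rarr aV 0 (j + 1) / σ.rvar xp else mat N (σ.rarr aB) i j)
      (by simpa using (hτ.nvar nN rfl).trans hN) ?_ ?_
    · refine (key i j).trans ?_
      have : ((i : ℕ) < u ∨ (i : ℕ) = u ∧ (j : ℕ) < N) ↔ (i : ℕ) < u + 1 := by omega
      simp only [this]
    · intro i j
      simpa using hP i j
    · intro w υ hw hυ hQ i j
      have hr : υ.nvar vr = u + 1 := (hυ.nvar vr rfl).trans (by simp)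
      have hC' : υ.rarr aC = σ.rarr aC := (hυ.rarr _ rfl).trans hC
      have hV' : υ.rarr aV = σ.rarr aV := (hυ.rarr _ rfl).trans hV
      have hp' : υ.rvar xp = σ.rvar xp := (hυ.rvar _ rfl).trans hp
      have hij := hQ i j
      by_cases h : (i : ℕ) = u ∧ (j : ℕ) = w
      · rw [if_neg (by omega)] at hij
        rw [if_pos (by omega)]
        simp only [mat] at hij ⊢
        rw [h.1, h.2] at hij ⊢
        simp [hr, hC', hV', hp', hij]
      · have : ((i : ℕ) < u ∨ (i : ℕ) = u ∧ (j : ℕ) < w) ↔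
            ((i : ℕ) < u ∨ (i : ℕ) = u ∧ (j : ℕ) < w + 1) := by omega
        simp only [this] at hij
        rw [← hij]
        simp [mat, hr, h]

def filterBody : Stmt :=
  setN vt (.get aD n0 vs) ;;
    ite (eqN (.get aT vt vj) ve)
      (setN vd2 (.succ vd2) ;;
        putN aD n0 vd2 vt ;;
        setR xZD (xZD -ᵣ .get aWt n0 vt))
      skip

def filterTrees : Stmt := setN vd2 n0 ;; setR xZD xZ ;; loop vs n1 vd filterBody ;; setN vd vd2

/-- The list is filtered in place. This is safe because the write position never overtakes the read
position: `vd2 ≤ u`, and the entries from `u` on are still the original ones. -/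
theorem filterTrees_spec {d : ℕ} {σ : Store} (hd : σ.nvar vd = d) :
    dlist (filterTrees.exec σ) ((filterTrees.exec σ).nvar vd) =
      (dlist σ d).filter (fun t => σ.narr aT t (σ.nvar vj) = σ.nvar ve) ∧
    (filterTrees.exec σ).rvar xZD =
      σ.rvar xZ - tailWeight σ (dlist σ d) (σ.nvar vj) (σ.nvar ve) := by
  simp only [filterTrees, exec_seq]
  set σ1 := (setR xZD xZ).exec ((setN vd2 n0).exec σ) with hσ1
  have h1d : σ1.nvar vd = d := by rw [hσ1]; simpa using hd
  have key := exec_loop_one (x := vs) (hi := vd) (σ := σ1) (n := d) (body := filterBody)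
    (fun u τ => τ.nvar vd2 ≤ u ∧ (∀ s, u ≤ s → τ.narr aD 0 (s + 1) = σ.narr aD 0 (s + 1)) ∧
      dlist τ (τ.nvar vd2) =
        (dlist σ u).filter (fun t => σ.narr aT t (σ.nvar vj) = σ.nvar ve) ∧
      τ.rvar xZD = σ.rvar xZ - tailWeight σ (dlist σ u) (σ.nvar vj) (σ.nvar ve)) h1d ?_ ?_
  · set σ2 := (loop vs n1 vd filterBody).exec σ1
    refine ⟨?_, key.2.2.2⟩
    rw [← key.2.2.1]
    simp [dlist]
  · rw [hσ1]
    simp [dlist, tailWeight]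
  · intro u τ hu hτ hP
    have hT : τ.narr aT = σ.narr aT := hτ.narr _ rfl
    have hW : τ.rarr aWt = σ.rarr aWt := hτ.rarr _ rfl
    have hj : τ.nvar vj = σ.nvar vj := (hτ.nvar _ rfl).trans (by rw [hσ1]; simp)
    have he : τ.nvar ve = σ.nvar ve := (hτ.nvar _ rfl).trans (by rw [hσ1]; simp)
    obtain ⟨hP1, hP2, hP3, hP4⟩ := hP
    have hu' : τ.narr aD 0 (u + 1) = σ.narr aD 0 (u + 1) := hP2 u le_rfl
    rw [dlist_succ, tailWeight, List.filter_append, List.map_append, List.sum_append,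
      ← tailWeight, filterBody, exec_seq]
    by_cases h : σ.narr aT (σ.narr aD 0 (u + 1)) (σ.nvar vj) = σ.nvar ve
    · rw [exec_ite_pos _ (by simp [hT, hj, he, hu', h])]
      refine ⟨by simpa using hP1, fun s hs => ?_, ?_, ?_⟩
      · simp
        rw [if_neg (by omega)]
        exact hP2 s (by omega)
      · rw [← hP3]
        simp only [exec_seq, exec_setR_nvar, exec_putN_nvar]
        simp only [exec_setN_nvar, NExp.eval, if_true, dlist_succ]
        simp [hu', h]
        refine List.map_congr_left fun s hs => ?_
        have := List.mem_range.1 hs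
        simp [this.ne]
      · simp [h, hP4, hW, hu']
        ring
    · rw [exec_ite_neg _ (by simp [hT, hj, he, hu', h]), exec_skip]
      refine ⟨by simpa using hP1.trans (Nat.le_succ u), fun s hs => by simpa using hP2 s (by omega), ?_, ?_⟩
      · simp only [List.filter_cons, List.filter_nil, h, decide_false, Bool.false_eq_true, if_false,
          List.append_nil]
        rw [← hP3]
        simp [dlist]
      · simp [h, hP4]

theorem condition_exec (σ : Store) : condition.exec σ = filterTrees.exec (inverseUpdate.exec
    (saveColumn.exec (changeTimesInverse.exec ((setR xZ (xZ *ᵣ xp)).exec (updateFactor.exec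
      (columnUpdate.exec (columnChange.exec σ))))))) := rfl

theorem condition_spec {N d : ℕ} {σ : Store} {c : Fin N} {i : Fin (N + 1)} {v : Fin N → ℝ}
    (hN : σ.nvar nN = N) (hj : σ.nvar vj = c + 1) (he : σ.nvar ve = i) (hd : σ.nvar vd = d)
    (hinv : (mat N (σ.rarr aB)).transpose * mat N (σ.rarr aL) = 1)
    (hv : v = fun r => σ.rarr aW i (c + 1) * edgeVec i c r)
    (hα : ∑ r, v r * mat N (σ.rarr aB) r c ≠ 0) :
    mat N ((condition.exec σ).rarr aL) = (mat N (σ.rarr aL)).updateCol c v ∧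
    (mat N ((condition.exec σ).rarr aB)).transpose * mat N ((condition.exec σ).rarr aL) = 1 ∧
    (condition.exec σ).rvar xZ = σ.rvar xZ * ∑ r, v r * mat N (σ.rarr aB) r c ∧
    dlist (condition.exec σ) ((condition.exec σ).nvar vd) =
      (dlist σ d).filter (fun t => σ.narr aT t (c + 1) = i) ∧
    (condition.exec σ).rvar xZD =
      (condition.exec σ).rvar xZ - tailWeight σ (dlist σ d) (c + 1) i := by
  rw [condition_exec]
  have hU := columnChange_spec hN hj he
  have ag1 := exec_agree columnChange σ
  set σ1 := columnChange.exec σ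
  have hN1 := (ag1.nvar nN rfl).trans hN
  have hj1 := (ag1.nvar vj rfl).trans hj
  have hL2 := columnUpdate_spec hN1 hj1
  have ag2 := exec_agree columnUpdate σ1
  set σ2 := columnUpdate.exec σ1
  have hN2 := (ag2.nvar nN rfl).trans hN1
  have hj2 := (ag2.nvar vj rfl).trans hj1
  have hp3 := updateFactor_spec hN2 hj2
  have ag3 := exec_agree updateFactor σ2
  set σ3 := updateFactor.exec σ2
  set σ4 := (setR xZ (xZ *ᵣ xp)).exec σ3 with hσ4
  have hN4 : σ4.nvar nN = N := (ag3.nvar nN rfl).trans hN2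
  have hj4 : σ4.nvar vj = c + 1 := (ag3.nvar vj rfl).trans hj2
  have hV5 := changeTimesInverse_spec hN4
  have ag5 := exec_agree changeTimesInverse σ4
  set σ5 := changeTimesInverse.exec σ4
  have hN5 := (ag5.nvar nN rfl).trans hN4
  have hj5 := (ag5.nvar vj rfl).trans hj4
  have hC6 := saveColumn_spec hN5 hj5
  have ag6 := exec_agree saveColumn σ5
  set σ6 := saveColumn.exec σ5
  have hB7 := inverseUpdate_spec ((ag6.nvar nN rfl).trans hN5)
  have ag7 := exec_agree inverseUpdate σ6
  set σ7 := inverseUpdate.exec σ6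
  have hB1 : σ1.rarr aB = σ.rarr aB := ag1.rarr aB rfl
  have hB2 : σ2.rarr aB = σ.rarr aB := (ag2.rarr aB rfl).trans hB1
  have h4a : σ4.rarr = σ3.rarr := rfl
  have hB4 : σ4.rarr aB = σ.rarr aB := (ag3.rarr aB rfl).trans hB2
  have hB5 : σ5.rarr aB = σ.rarr aB := (ag5.rarr aB rfl).trans hB4
  have hB6 : σ6.rarr aB = σ.rarr aB := (ag6.rarr aB rfl).trans hB5
  have hU2 : σ2.rarr aU = σ1.rarr aU := ag2.rarr aU rfl
  have hU4 : σ4.rarr aU = σ1.rarr aU := (ag3.rarr aU rfl).trans hU2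
  have hUv : ∀ r : Fin N, σ1.rarr aU 0 (r + 1) = v r - mat N (σ.rarr aL) r c := fun r => by
    rw [hU r, hv]
  have hL1 : σ1.rarr aL = σ.rarr aL := ag1.rarr aL rfl
  -- The leading `1` of the factor cancels against column `c` of `L`, since the diagonal entry of
  -- `B.transpose * L` is `1`.
  have hα' : σ3.rvar xp = ∑ r, v r * mat N (σ.rarr aB) r c := by
    have hcc := congrFun (congrFun hinv c) c
    rw [Matrix.mul_apply, Matrix.one_apply_eq] at hcc
    rw [hp3, hU2, hB2]
    simp only [hUv, sub_mul, Finset.sum_sub_distrib]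
    rw [← hcc]
    have : ∑ r, mat N (σ.rarr aL) r c * mat N (σ.rarr aB) r c =
        ∑ r, (mat N (σ.rarr aB)).transpose c r * mat N (σ.rarr aL) r c :=
      Finset.sum_congr rfl fun r _ => mul_comm _ _
    rw [this]
    ring
  have hp6 : σ6.rvar xp = ∑ r, v r * mat N (σ.rarr aB) r c := by
    rw [ag6.rvar xp rfl, ag5.rvar xp rfl, ← hα', hσ4]
    simp
  have hL7 : mat N (σ7.rarr aL) = (mat N (σ.rarr aL)).updateCol c v := by
    rw [ag7.rarr aL rfl, ag6.rarr aL rfl, ag5.rarr aL rfl, h4a, ag3.rarr aL rfl, hL2, hL1]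
    congr 1
    ext r
    rw [hUv]
    ring
  have hZ7 : σ7.rvar xZ = σ.rvar xZ * ∑ r, v r * mat N (σ.rarr aB) r c := by
    rw [ag7.rvar xZ rfl, ag6.rvar xZ rfl, ag5.rvar xZ rfl, hσ4, ← hα']
    simp
    left
    rw [ag3.rvar xZ rfl, ag2.rvar xZ rfl, ag1.rvar xZ rfl]
  have hBL : (mat N (σ7.rarr aB)).transpose * mat N (σ7.rarr aL) = 1 := by
    rw [hL7]
    refine inverse_updateCol hinv c v hα fun r q => ?_
    rw [hB7, hB6, hC6, hB5, hp6, ag6.rarr aV rfl, hV5, hU4, hB4]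
    simp only [hUv]
  have hd7 : σ7.nvar vd = d := by
    rw [ag7.nvar vd rfl, ag6.nvar vd rfl, ag5.nvar vd rfl, hσ4, exec_setR_nvar, ag3.nvar vd rfl,
      ag2.nvar vd rfl, ag1.nvar vd rfl, hd]
  have hj7 : σ7.nvar vj = c + 1 := by rw [ag7.nvar vj rfl, ag6.nvar vj rfl, hj5]
  have he7 : σ7.nvar ve = i := by
    rw [ag7.nvar ve rfl, ag6.nvar ve rfl, ag5.nvar ve rfl, hσ4, exec_setR_nvar, ag3.nvar ve rfl,
      ag2.nvar ve rfl, ag1.nvar ve rfl, he]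
  have hT7 : ∀ a, σ7.narr a = σ.narr a := by
    intro a
    cases a
    · rw [ag7.narr _ rfl, ag6.narr _ rfl, ag5.narr _ rfl, hσ4, exec_setR_narr, ag3.narr _ rfl,
        ag2.narr _ rfl, ag1.narr _ rfl]
    · rw [ag7.narr _ rfl, ag6.narr _ rfl, ag5.narr _ rfl, hσ4, exec_setR_narr, ag3.narr _ rfl,
        ag2.narr _ rfl, ag1.narr _ rfl]
  have hWt7 : σ7.rarr aWt = σ.rarr aWt := by
    rw [ag7.rarr _ rfl, ag6.rarr _ rfl, ag5.rarr _ rfl, h4a, ag3.rarr _ rfl,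
        ag2.rarr _ rfl, ag1.rarr _ rfl]
  obtain ⟨hD8, hZD8⟩ := filterTrees_spec hd7
  have ag8 := exec_agree filterTrees σ7
  set σ8 := filterTrees.exec σ7
  have hdl : dlist σ7 d = dlist σ d := by simp only [dlist, hT7]
  refine ⟨?_, ?_, ?_, ?_, ?_⟩
  · rw [ag8.rarr aL rfl, hL7]
  · rw [ag8.rarr aL rfl, ag8.rarr aB rfl, hBL]
  · rw [ag8.rvar xZ rfl, hZ7]
  · rw [hD8, hdl, hT7, hj7, he7]
  · rw [hZD8, ag8.rvar xZ rfl, hdl, hj7, he7]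
    simp only [tailWeight, hT7, hWt7]

variable {N : ℕ}

/-! ## Drawing the edges of a tree -/

/-- The memory holds the graph `G`, its Laplacian and the trees `tr 1, …, tr m`. -/
structure Holds (G : RootedGraph N) (tr : ℕ → Fin N → Fin (N + 1)) (m : ℕ) (σ : Store) : Prop where
  size : σ.nvar nN = N
  weight : ∀ i j : Fin (N + 1), σ.rarr aW i j = G.weight i j
  lap0 : mat N (σ.rarr aL0) = lap fun c i => G.weight i c.succ
  inv0 : (mat N (σ.rarr aB0)).transpose * mat N (σ.rarr aL0) = 1
  det0 : σ.rvar xZ0 = (mat N (σ.rarr aL0)).det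
  tree : ∀ s, 1 ≤ s → s ≤ m → ∀ c : Fin N, σ.narr aT s (c + 1) = tr s c
  treeWeight : ∀ s, 1 ≤ s → s ≤ m → σ.rarr aWt 0 s = funWeight G (tr s)
  nodup : ((List.range' 1 m).map tr).Nodup
  pos : ∀ f ∈ (List.range' 1 m).map tr, f ∈ posFuns G
  rest0 : σ.rvar xZD0 = restWeight G ((List.range' 1 m).map tr) 0 (fun _ => 0)

theorem Holds.of_agree {G : RootedGraph N} {tr m} {σ τ : Store} (h : Holds G tr m σ)
    (h1 : τ.nvar nN = σ.nvar nN) (h2 : τ.rarr aW = σ.rarr aW) (h3 : τ.rarr aL0 = σ.rarr aL0)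
    (h4 : τ.rarr aB0 = σ.rarr aB0) (h5 : τ.rvar xZ0 = σ.rvar xZ0)
    (h6 : ∀ s, 1 ≤ s → s ≤ m → ∀ c, τ.narr aT s c = σ.narr aT s c)
    (h7 : τ.rarr aWt = σ.rarr aWt) (h8 : τ.rvar xZD0 = σ.rvar xZD0) : Holds G tr m τ :=
  { size := h1.trans h.size
    weight := by rw [h2]; exact h.weight
    lap0 := by rw [h3]; exact h.lap0
    inv0 := by rw [h3, h4]; exact h.inv0
    det0 := by rw [h3, h5]; exact h.det0
    tree := fun s hs hm c => by rw [h6 s hs hm]; exact h.tree s hs hm c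
    treeWeight := by rw [h7]; exact h.treeWeight
    nodup := h.nodup
    pos := h.pos
    rest0 := h8.trans h.rest0 }

open Classical in
/-- The memory while a tree is drawn: the edges into the first `n` nodes are given by `p`. -/
structure Drawing (G : RootedGraph N) (tr : ℕ → Fin N → Fin (N + 1)) (m : ℕ)
    (p : Fin N → Fin (N + 1)) (n : ℕ) (σ : Store) : Prop where
  holds : Holds G tr m σ
  current : σ.nvar vk = m + 1
  drawn : ∀ c : Fin N, (c : ℕ) < n → σ.narr aT (m + 1) (c + 1) = p c
  lap : mat N (σ.rarr aL) = lap (condWeights G p n)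
  inv : (mat N (σ.rarr aB)).transpose * mat N (σ.rarr aL) = 1
  det : σ.rvar xZ = (mat N (σ.rarr aL)).det
  earlier : dlist σ (σ.nvar vd) =
    (List.range' 1 m).filter fun s => decide (AgreeUpTo n p (tr s))
  rest : σ.rvar xZD = restWeight G ((List.range' 1 m).map tr) n p
  rest_pos : 0 < restWeight G ((List.range' 1 m).map tr) n p

theorem Drawing.filter_earlier {G : RootedGraph N} {tr m p} {c : Fin N} {σ : Store}
    (h : Drawing G tr m p c σ) (i : Fin (N + 1)) [DecidablePred fun s =>
      AgreeUpTo (c + 1) (Function.update p c i) (tr s)] :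
    (dlist σ (σ.nvar vd)).filter (fun t => σ.narr aT t (c + 1) = i) =
      (List.range' 1 m).filter fun s =>
        decide (AgreeUpTo (c + 1) (Function.update p c i) (tr s)) := by
  rw [h.earlier, List.filter_filter]
  refine List.filter_congr fun s hs => ?_
  rw [List.mem_range'_1] at hs
  rw [h.holds.tree s hs.1 (by omega) c]
  rw [Bool.eq_iff_iff]
  simp only [Bool.and_eq_true, decide_eq_true_eq, agreeUpTo_succ, Fin.val_inj]
  tauto

/-- Partition function of the graph with the edge `(i, c)` fixed, minus the earlier trees that
contain all fixed edges: this is the unnormalised probability `m`. -/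
theorem Drawing.tailWeight_eq {G : RootedGraph N} {tr m p} {c : Fin N} {σ : Store}
    (h : Drawing G tr m p c σ) (i : Fin (N + 1)) :
    (Arborescence.lap (condWeights G (Function.update p c i) (c + 1))).det -
      tailWeight σ (dlist σ (σ.nvar vd)) (c + 1) i =
      restWeight G ((List.range' 1 m).map tr) (c + 1) (Function.update p c i) := by
  classical
  rw [det_lap_condWeights c.pos, ← list_sum_filter_eq G h.holds.nodup h.holds.pos]
  congr 1
  rw [tailWeight, h.filter_earlier i, List.filter_map, List.map_map]
  refine congrArg List.sum (List.map_congr_left fun s hs => ?_)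
  have := List.mem_range'_1.1 (List.mem_filter.1 hs).1
  exact h.holds.treeWeight s this.1 (by omega)

theorem Drawing.det_updateCol {G : RootedGraph N} {tr m p} {c : Fin N} {σ : Store}
    (h : Drawing G tr m p c σ) (i : Fin (N + 1)) :
    σ.rvar xZ * ∑ r, G.weight i c.succ * edgeVec i c r * mat N (σ.rarr aB) r c =
      (Arborescence.lap (condWeights G (Function.update p c i) (c + 1))).det := by
  rw [lap_condWeights_succ, ← h.lap, det_updateCol_eq h.inv, h.det]

/-- A rank forbids a node to be its own parent. -/
theorem Drawing.self_tailWeight {G : RootedGraph N} {tr m p} {c : Fin N} {σ : Store}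
    (h : Drawing G tr m p c σ) :
    tailWeight σ (dlist σ (σ.nvar vd)) (c + 1) (c + 1) = 0 := by
  classical
  have h1 := h.filter_earlier c.succ
  rw [Fin.val_succ] at h1
  rw [tailWeight, h1, List.filter_eq_nil_iff.2]
  · simp
  · intro s hs
    have hpos := h.holds.pos (tr s) (List.mem_map_of_mem hs)
    obtain ⟨⟨⟨d, hd⟩, -⟩, -⟩ := mem_posFuns.1 hpos
    simp only [decide_eq_true_eq, agreeUpTo_succ, not_and]
    exact fun _ hc => lt_irrefl _ (hd c c hc)

def drawColumn : Stmt := sampleEdge ;; putN aT vk vj ve ;; condition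

/-- The numbers handed to the draw are ratios of masses; non-negativity and total one are evident in
this form. -/
theorem Drawing.edgeLaw {G : RootedGraph N} {tr m p} {c : Fin N} {σ : Store}
    (h : Drawing G tr m p c σ) (hj : σ.nvar vj = c + 1) (i : Fin (N + 1)) :
    (edgeLaw.exec σ).rarr aM 0 i =
      restWeight G ((List.range' 1 m).map tr) (c + 1) (Function.update p c i) /
        restWeight G ((List.range' 1 m).map tr) c p := by
  have hW := h.holds.weight i c.succ
  rw [Fin.val_succ] at hW
  rw [edgeLaw_spec h.holds.size hj rfl h.self_tailWeight, h.rest, ← h.tailWeight_eq,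
    ← h.det_updateCol, hW, Finset.mul_sum]
  simp only [mul_assoc]

/-- Conditioning keeps the memory in order. -/
theorem Drawing.condition {G : RootedGraph N} {tr m p} {c : Fin N} {σ : Store}
    (h : Drawing G tr m p c σ) (hj : σ.nvar vj = c + 1) {i : Fin (N + 1)} (he : σ.nvar ve = i)
    (hpos : 0 < restWeight G ((List.range' 1 m).map tr) (c + 1) (Function.update p c i)) :
    Drawing G tr m (Function.update p c i) (c + 1)
      ((putN aT vk vj ve ;; condition).exec σ) := by
  classical
  have hW := h.holds.weight i c.succ
  rw [Fin.val_succ] at hW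
  have hdet := h.det_updateCol i
  -- The divisor of the update is nonzero: otherwise the conditioned determinant, a sum of
  -- non-negative weights, would vanish although an unseen tree of positive weight contributes to
  -- it.
  have hne : ∑ r, G.weight i c.succ * edgeVec i c r * mat N (σ.rarr aB) r c ≠ 0 := by
    intro h0
    rw [h0, mul_zero, det_lap_condWeights c.pos] at hdet
    obtain ⟨f, hf⟩ : (restFuns G ((List.range' 1 m).map tr) (c + 1)
        (Function.update p c i)).Nonempty := by
      by_contra hcon
      rw [Finset.not_nonempty_iff_eq_empty] at hcon
      simp [restWeight, hcon] at hpos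
    obtain ⟨hf1, hf2, -⟩ := mem_restFuns.1 hf
    have := (Finset.sum_eq_zero_iff_of_nonneg fun f _ => funWeight_nonneg G f).1 hdet.symm f
      (Finset.mem_filter.2 ⟨hf1, hf2⟩)
    exact (mem_posFuns.1 hf1).2.ne' this
  rw [exec_seq]
  set σ1 := (putN aT vk vj ve).exec σ with hσ1
  -- The new edge goes to row `m + 1`, so the rows of the earlier trees are intact.
  have hT : ∀ s c', σ1.narr aT s c' =
      if s = m + 1 ∧ c' = c + 1 then (i : ℕ) else σ.narr aT s c' := by
    intro s c'
    rw [hσ1]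
    simp [h.current, hj, he]
  have hTs : ∀ s, s ≤ m → ∀ c', σ1.narr aT s c' = σ.narr aT s c' := fun s hs c' => by
    rw [hT, if_neg (by omega)]
  have hdl : dlist σ1 (σ.nvar vd) = dlist σ (σ.nvar vd) := by
    simp [dlist, hσ1]
  have hlem : ∀ t ∈ dlist σ (σ.nvar vd), t ≤ m := by
    intro t ht
    rw [h.earlier, List.mem_filter, List.mem_range'_1] at ht
    omega
  have hfil : ∀ x : ℕ, (dlist σ (σ.nvar vd)).filter (fun t => σ1.narr aT t (c + 1) = x) =
      (dlist σ (σ.nvar vd)).filter (fun t => σ.narr aT t (c + 1) = x) := fun x =>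
    List.filter_congr fun t ht => by rw [hTs t (hlem t ht)]
  have htw : tailWeight σ1 (dlist σ1 (σ.nvar vd)) (c + 1) i =
      tailWeight σ (dlist σ (σ.nvar vd)) (c + 1) i := by
    rw [hdl, tailWeight, hfil, tailWeight]
    rfl
  obtain ⟨c1, c2, c3, c4, c5⟩ := condition_spec (σ := σ1) (c := c) (i := i)
    (v := fun r => G.weight i c.succ * edgeVec i c r) h.holds.size hj he rfl h.inv
    (by ext r; rw [← hW]; rfl) hne
  have ag := exec_agree RealRAM.condition σ1
  have hlap : mat N ((RealRAM.condition.exec σ1).rarr aL) =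
      Arborescence.lap (condWeights G (Function.update p c i) (c + 1)) := by
    rw [c1, lap_condWeights_succ, ← h.lap]
    rfl
  have hZ : (RealRAM.condition.exec σ1).rvar xZ =
      (Arborescence.lap (condWeights G (Function.update p c i) (c + 1))).det := by
    rw [c3, ← hdet]
    rfl
  refine ⟨h.holds.of_agree (ag.nvar _ rfl) (ag.rarr _ rfl) (ag.rarr _ rfl) (ag.rarr _ rfl)
    (ag.rvar _ rfl) ?_ (ag.rarr _ rfl) (ag.rvar _ rfl), ?_, ?_, hlap, c2, ?_, ?_, ?_, hpos⟩
  · intro s _ hs c'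
    rw [ag.narr aT rfl, hTs s hs]
  · rw [ag.nvar vk rfl]
    exact h.current
  · intro x hx
    rw [ag.narr aT rfl, hT]
    by_cases hxc : x = c
    · subst hxc
      simp
    · rw [Function.update_of_ne hxc, if_neg (by rw [Fin.ext_iff] at hxc; omega)]
      exact h.drawn x (by rw [Fin.ext_iff] at hxc; omega)
  · rw [hZ, hlap]
  · rw [c4, ← h.filter_earlier i]
    show ((dlist σ1 (σ.nvar vd)).filter _) = _
    rw [hdl]
    exact hfil i
  · rw [c5, hZ, ← h.tailWeight_eq, ← htw]
    rfl

/-- The computation of the edge law and the draw touch only scratch memory, which the invariant does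
not mention. -/
theorem Drawing.of_setN {G : RootedGraph N} {tr m p n} {σ : Store} (h : Drawing G tr m p n σ)
    {τ : Store} (h1 : ∀ x, x ≠ vj → x ≠ ve → x ≠ vr → x ≠ vs → x ≠ vt → τ.nvar x = σ.nvar x)
    (h2 : τ.rvar = σ.rvar) (h3 : τ.narr = σ.narr)
    (h4 : ∀ a, a ≠ aS → a ≠ aM → τ.rarr a = σ.rarr a) : Drawing G tr m p n τ := by
  have hN : τ.nvar nN = σ.nvar nN := h1 _ (by decide) (by decide) (by decide) (by decide) (by decide)
  have hk : τ.nvar vk = σ.nvar vk := h1 _ (by decide) (by decide) (by decide) (by decide) (by decide)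
  have hd : τ.nvar vd = σ.nvar vd := h1 _ (by decide) (by decide) (by decide) (by decide) (by decide)
  refine ⟨h.holds.of_agree hN ?_ ?_ ?_ (by rw [h2]) (by simp [h3]) ?_ (by rw [h2]),
    hk.trans h.current, ?_, ?_, ?_, ?_, ?_, ?_, h.rest_pos⟩
  iterate 4 exact h4 _ (by decide) (by decide)
  · rw [h3]; exact h.drawn
  · rw [h4 _ (by decide) (by decide)]; exact h.lap
  · rw [h4 _ (by decide) (by decide), h4 _ (by decide) (by decide)]; exact h.inv
  · rw [h2, h4 _ (by decide) (by decide)]; exact h.det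
  · rw [hd, ← h.earlier, dlist, dlist, h3]
  · rw [h2]; exact h.rest

/-- The invariant includes positive mass, so it is restored only for edges of positive probability.
-/
theorem ev_drawColumn {G : RootedGraph N} {tr m p} {c : Fin N} {σ : Store}
    (h : Drawing G tr m p c σ) (hj : σ.nvar vj = c + 1) (ψ : Store → ℝ≥0∞)
    (g : Fin (N + 1) → ℝ≥0∞)
    (hg : ∀ i τ, Drawing G tr m (Function.update p c i) (c + 1) τ → ψ τ = g i) :
    ev (drawColumn.run σ) ψ = ∑ i, ENNReal.ofReal
      (restWeight G ((List.range' 1 m).map tr) (c + 1) (Function.update p c i) /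
        restWeight G ((List.range' 1 m).map tr) c p) * g i := by
  rw [drawColumn, ev_seq, sampleEdge_run]
  have hag := exec_agree RealRAM.edgeLaw σ
  have hlaw := h.edgeLaw hj
  set σ1 := RealRAM.edgeLaw.exec σ
  have hN1 : NExp.eval σ1 nN = N := (hag.nvar nN rfl).trans h.holds.size
  have h1 : Drawing G tr m p c σ1 := by
    refine h.of_setN (fun x _ _ _ _ _ => hag.nvar x ?_) ?_ ?_ (fun a _ _ => hag.rarr a ?_)
    · cases x <;> first | rfl | contradiction
    · ext x; rw [hag.rvar x (by cases x <;> rfl)]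
    · ext x; rw [hag.narr x (by cases x <;> rfl)]
    · cases a <;> first | rfl | contradiction
  have hprob : IsProbVector (NExp.eval σ1 nN) (σ1.rarr aM 0) := by
    rw [hN1]
    constructor
    · intro i hi
      have := hlaw ⟨i, Finset.mem_range.1 hi⟩
      simp only at this
      rw [this]
      exact div_nonneg (restWeight_nonneg _ _ _ _) (restWeight_nonneg _ _ _ _)
    · rw [Finset.sum_range, Finset.sum_congr rfl fun i _ => hlaw i, ← Finset.sum_div]
      have := sum_restFuns_succ G ((List.range' 1 m).map tr) p c (funWeight G)
      simp only [restWeight] at this ⊢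
      rw [this]
      exact div_self h.rest_pos.ne'
  rw [ev_draw _ _ _ _ hprob, hN1, Finset.sum_range]
  refine Finset.sum_congr rfl fun i _ => ?_
  rw [hlaw i]
  by_cases hpos : 0 < restWeight G ((List.range' 1 m).map tr) (c + 1) (Function.update p c i)
  · congr 1
    rw [ev_run_of_drawFree _ rfl]
    refine hg i _ (Drawing.condition ?_ ?_ ?_ hpos)
    · refine h1.of_setN (fun x _ hx _ _ _ => ?_) rfl rfl (fun _ _ _ => rfl)
      simp [hx]
    · have : σ1.nvar vj = σ.nvar vj := hag.nvar vj rfl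
      simpa using this.trans hj
    · simp
  -- An edge of mass zero has probability zero, so whatever the program would do after it is
  -- irrelevant.
  · have h0 := le_antisymm (not_lt.1 hpos) (restWeight_nonneg _ _ _ _)
    rw [h0, zero_div, ENNReal.ofReal_zero, zero_mul, zero_mul]

/-- The edge probabilities telescope: the ratio of consecutive masses times `w(f)` over the later
mass is `w(f)` over the earlier one. At the end a single function is left and its ratio is `1`. -/
theorem ev_drawColumns {G : RootedGraph N} {tr m} (ψ : Store → ℝ≥0∞)
    (g : (Fin N → Fin (N + 1)) → ℝ≥0∞) (hg : ∀ f τ, Drawing G tr m f N τ → ψ τ = g f)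
    (k n : ℕ) (hk : n + k = N) (p : Fin N → Fin (N + 1)) (σ : Store) (h : Drawing G tr m p n σ) :
    ev (iter (fun v τ => drawColumn.run { τ with nvar := Function.update τ.nvar vj v })
        (List.range' (n + 1) k) σ) ψ =
      ∑ f ∈ restFuns G ((List.range' 1 m).map tr) n p,
        ENNReal.ofReal (funWeight G f / restWeight G ((List.range' 1 m).map tr) n p) * g f := by
  induction k generalizing n p σ with
  | zero =>
    obtain rfl : n = N := by omega
    rw [List.range'_zero, ev_iter_nil, hg p σ h]
    obtain ⟨h1, h2, -, h3⟩ := restFuns_all h.rest_pos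
    rw [h1, Finset.sum_singleton, h3, div_self (mem_posFuns.1 h2).2.ne', ENNReal.ofReal_one, one_mul]
  | succ k ih =>
    rw [List.range'_succ, ev_iter_cons]
    let c : Fin N := ⟨n, by omega⟩
    have h' : Drawing G tr m p c { σ with nvar := Function.update σ.nvar vj (n + 1) } := by
      refine h.of_setN (fun x hx _ _ _ _ => ?_) rfl rfl (fun _ _ _ => rfl)
      simp [hx]
    rw [ev_drawColumn h' (by simp [c]) _ _
      fun i τ hτ => ih (n + 1) (by omega) (Function.update p c i) τ hτ]
    have hsum := sum_restFuns_succ G ((List.range' 1 m).map tr) p c fun f =>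
      ENNReal.ofReal (funWeight G f / restWeight G ((List.range' 1 m).map tr) n p) * g f
    refine Eq.trans (Finset.sum_congr rfl fun i _ => ?_) hsum
    rw [Finset.mul_sum]
    refine Finset.sum_congr rfl fun f hf => ?_
    have hpos := restWeight_pos hf
    rw [← mul_assoc, ← ENNReal.ofReal_mul (div_nonneg hpos.le (restWeight_nonneg _ _ _ _))]
    congr 2
    have := h.rest_pos
    show restWeight G _ (n + 1) (Function.update p c i) / restWeight G _ n p *
      (funWeight G f / restWeight G _ (n + 1) (Function.update p c i)) = _
    have hpos' : restWeight G ((List.range' 1 m).map tr) (n + 1) (Function.update p c i) ≠ 0 :=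
      hpos.ne'
    field_simp

/-! ## Drawing a tree -/

def listTrees : Stmt := loop vs n1 vd (putN aD n0 vs vs)

theorem listTrees_spec {d : ℕ} {σ : Store} (hd : σ.nvar vd = d) :
    dlist (listTrees.exec σ) d = List.range' 1 d := by
  have key := exec_loop_one (x := vs) (hi := vd) (σ := σ) (n := d)
    (body := putN aD n0 vs vs)
    (fun u τ => ∀ s, s < u → τ.narr aD 0 (s + 1) = s + 1) hd (by simp) ?_
  · rw [dlist, List.range'_eq_map_range]
    refine List.map_congr_left fun s hs => ?_
    rw [listTrees, key s (List.mem_range.1 hs), add_comm]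
  · intro u τ hu hτ hP s hs
    by_cases h : s = u
    · simp [h]
    · simpa [h] using hP s (by omega)

def copyMatrices : Stmt :=
  loop vr n1 nN (loop vq n1 nN (
    putR aL vr vq (.get aL0 vr vq) ;;
    putR aB vr vq (.get aB0 vr vq)))

theorem copyMatrices_spec {σ : Store} (hN : σ.nvar nN = N) :
    mat N ((copyMatrices.exec σ).rarr aL) = mat N (σ.rarr aL0) ∧
    mat N ((copyMatrices.exec σ).rarr aB) = mat N (σ.rarr aB0) := by
  have key := exec_loop_one (x := vr) (hi := nN) (σ := σ) (n := N)
    (body := loop vq n1 nN (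
      putR aL vr vq (.get aL0 vr vq) ;; putR aB vr vq (.get aB0 vr vq)))
    (fun u τ => ∀ i j : Fin N, (i : ℕ) < u → mat N (τ.rarr aL) i j = mat N (σ.rarr aL0) i j ∧
      mat N (τ.rarr aB) i j = mat N (σ.rarr aB0) i j) hN (by simp) ?_
  · refine ⟨?_, ?_⟩
    · ext i j
      exact (key i j i.is_lt).1
    · ext i j
      exact (key i j i.is_lt).2
  · intro u τ hu hτ hP
    have hL0 : τ.rarr aL0 = σ.rarr aL0 := hτ.rarr _ rfl
    have hB0 : τ.rarr aB0 = σ.rarr aB0 := hτ.rarr _ rfl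
    have key := exec_loop_one (x := vq) (hi := nN) (n := N)
      (σ := { τ with nvar := Function.update τ.nvar vr (u + 1) })
      (body := putR aL vr vq (.get aL0 vr vq) ;; putR aB vr vq (.get aB0 vr vq))
      (fun w υ => ∀ i j : Fin N, (i : ℕ) < u ∨ (i : ℕ) = u ∧ (j : ℕ) < w →
        mat N (υ.rarr aL) i j = mat N (σ.rarr aL0) i j ∧
        mat N (υ.rarr aB) i j = mat N (σ.rarr aB0) i j)
      (by simpa using (hτ.nvar nN rfl).trans hN) ?_ ?_
    · intro i j hi
      exact key i j (by omega)
    · intro i j hi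
      exact hP i j (by omega)
    · intro w υ hw hυ hQ i j hij
      have hr : υ.nvar vr = u + 1 := (hυ.nvar vr rfl).trans (by simp)
      have hL : υ.rarr aL0 = σ.rarr aL0 := (hυ.rarr _ rfl).trans hL0
      have hB : υ.rarr aB0 = σ.rarr aB0 := (hυ.rarr _ rfl).trans hB0
      by_cases h : (i : ℕ) = u ∧ (j : ℕ) = w
      · simp [mat, hr, hL, hB, h.1, h.2]
      · have := hQ i j (by omega)
        simp only [mat] at this ⊢
        simp [hr, h, this]

def startTree : Stmt := listTrees ;; setR xZ xZ0 ;; setR xZD xZD0 ;; copyMatrices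

/-- The memory after `m` trees have been drawn. -/
structure Drawn (G : RootedGraph N) (tr : ℕ → Fin N → Fin (N + 1)) (m : ℕ) (σ : Store) : Prop where
  holds : Holds G tr m σ
  count : σ.nvar vd = m

theorem startTree_spec {G : RootedGraph N} {tr m} {σ : Store} (h : Drawn G tr m σ)
    (hk : σ.nvar vk = m + 1) (hpos : 0 < restWeight G ((List.range' 1 m).map tr) 0 noFun) :
    Drawing G tr m noFun 0 (startTree.exec σ) := by
  classical
  have hd := listTrees_spec h.count
  have ag1 := exec_agree listTrees σ
  rw [startTree]
  simp only [exec_seq]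
  set σ1 := listTrees.exec σ
  set σ2 := (setR xZD xZD0).exec ((setR xZ xZ0).exec σ1) with hσ2
  have hN2 : σ2.nvar nN = N := (ag1.nvar nN rfl).trans h.holds.size
  obtain ⟨hL, hB⟩ := copyMatrices_spec hN2
  have ag3 := exec_agree copyMatrices σ2
  set σ3 := copyMatrices.exec σ2
  have h2a : σ2.rarr = σ1.rarr := rfl
  have h2n : σ2.narr = σ1.narr := rfl
  have hr0 : ∀ x, x ≠ xZ → x ≠ xZD → σ2.rvar x = σ.rvar x := fun x h1 h2 => by
    rw [hσ2]
    simp only [exec_setR_rvar, if_neg h1, if_neg h2]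
    rw [ag1.rvar x rfl]
  have hra : ∀ a, a ≠ aL → a ≠ aB → σ3.rarr a = σ.rarr a := fun a h1 h2 => by
    rw [ag3.rarr a (by cases a <;> first | rfl | contradiction), h2a, ag1.rarr a rfl]
  have hL3 : mat N (σ3.rarr aL) = mat N (σ.rarr aL0) := by rw [hL, h2a, ag1.rarr aL0 rfl]
  have hB3 : mat N (σ3.rarr aB) = mat N (σ.rarr aB0) := by rw [hB, h2a, ag1.rarr aB0 rfl]
  refine ⟨h.holds.of_agree ?_ (hra _ (by decide) (by decide)) (hra _ (by decide) (by decide))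
    (hra _ (by decide) (by decide)) ?_ ?_ (hra _ (by decide) (by decide)) ?_, ?_, ?_, ?_, ?_, ?_,
    ?_, ?_, hpos⟩
  · rw [ag3.nvar nN rfl, hN2, h.holds.size]
  · rw [ag3.rvar xZ0 rfl, hr0 _ (by decide) (by decide)]
  · intro s _ _ c
    rw [ag3.narr aT rfl, h2n, ag1.narr aT rfl]
  · rw [ag3.rvar xZD0 rfl, hr0 _ (by decide) (by decide)]
  · rw [ag3.nvar vk rfl, ← hk]
    exact ag1.nvar vk rfl
  · exact fun c hc => absurd hc (Nat.not_lt_zero _)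
  · rw [hL3, h.holds.lap0, lap_condWeights_zero]
  · rw [hL3, hB3, h.holds.inv0]
  · rw [ag3.rvar xZ rfl, hL3, ← h.holds.det0, ← ag1.rvar xZ0 rfl, hσ2]
    simp
  · have : σ3.nvar vd = m := by
      rw [ag3.nvar vd rfl, ← h.count]
      exact ag1.nvar vd rfl
    rw [this, List.filter_eq_self.2]
    · rw [← hd, dlist, dlist, ag3.narr aD rfl, h2n]
    · intro s _
      rw [decide_eq_true_eq]
      exact fun c hc => absurd hc (Nat.not_lt_zero _)
  · rw [ag3.rvar xZD rfl, ← h.holds.rest0, ← ag1.rvar xZD0 rfl, hσ2]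
    simp

def weighTree : Stmt :=
  putR aWt n0 vk (.lit 1) ;;
  loop vj n1 nN (
    putR aWt n0 vk (.get aWt n0 vk *ᵣ .get aW (.get aT vk vj) vj))

theorem weighTree_spec {σ : Store} (hN : σ.nvar nN = N) :
    (∀ s, s ≠ σ.nvar vk → (weighTree.exec σ).rarr aWt 0 s = σ.rarr aWt 0 s) ∧
    (weighTree.exec σ).rarr aWt 0 (σ.nvar vk) =
      ∏ c : Fin N, σ.rarr aW (σ.narr aT (σ.nvar vk) (c + 1)) (c + 1) := by
  rw [weighTree, exec_seq]
  set σ1 := (putR aWt n0 vk (RExp.lit 1)).exec σ with hσ1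
  have hW1 : σ1.rarr aW = σ.rarr aW := by
    ext i j
    rw [hσ1]
    simp
  have key := exec_loop_one (x := vj) (hi := nN) (σ := σ1) (n := N)
    (body := putR aWt n0 vk (.get aWt n0 vk *ᵣ .get aW (.get aT vk vj) vj))
    (fun u τ => (∀ s, s ≠ σ.nvar vk → τ.rarr aWt 0 s = σ.rarr aWt 0 s) ∧
      τ.rarr aWt 0 (σ.nvar vk) = ∏ x ∈ Finset.range u,
        σ.rarr aW (σ.narr aT (σ.nvar vk) (x + 1)) (x + 1)) hN ?_ ?_
  · refine ⟨key.1, ?_⟩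
    rw [key.2, Finset.prod_range fun x => σ.rarr aW (σ.narr aT (σ.nvar vk) (x + 1)) (x + 1)]
  · rw [hσ1]
    exact ⟨fun s hs => by simp [hs], by simp⟩
  · intro u τ hu hτ hP
    have hk : τ.nvar vk = σ.nvar vk := hτ.nvar _ rfl
    have hT : τ.narr aT = σ.narr aT := hτ.narr _ rfl
    have hW : τ.rarr aW = σ.rarr aW := (hτ.rarr _ rfl).trans hW1
    refine ⟨fun s hs => ?_, ?_⟩
    · simpa [hk, hs] using hP.1 s hs
    · simp [hk, hT, hW, hP.2, Finset.prod_range_succ]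

def finishTree : Stmt := weighTree ;; setR xZD0 (xZD0 -ᵣ .get aWt n0 vk) ;; setN vd vk

theorem map_range'_update (tr : ℕ → Fin N → Fin (N + 1)) (m : ℕ) (f : Fin N → Fin (N + 1)) :
    (List.range' 1 (m + 1)).map (Function.update tr (m + 1) f) =
      (List.range' 1 m).map tr ++ [f] := by
  rw [List.range'_concat, List.map_append]
  congr 1
  · refine List.map_congr_left fun s hs => ?_
    have := List.mem_range'_1.1 hs
    rw [Function.update_of_ne (by omega)]
  · simp [add_comm]

/-- Positive mass at `n = N` certifies that `f` is new and has positive weight. This restores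
`nodup` and `pos` and makes the subtraction from `xZD0` correct. -/
theorem finishTree_spec {G : RootedGraph N} {tr m f} {σ : Store} (h : Drawing G tr m f N σ) :
    Drawn G (Function.update tr (m + 1) f) (m + 1) (finishTree.exec σ) := by
  obtain ⟨-, hf, hfs, -⟩ := restFuns_all h.rest_pos
  obtain ⟨hw1, hw2⟩ := weighTree_spec h.holds.size
  have ag := exec_agree weighTree σ
  rw [h.current] at hw1 hw2
  have hw : (weighTree.exec σ).rarr aWt 0 (m + 1) = funWeight G f := by
    rw [hw2, funWeight]
    refine Finset.prod_congr rfl fun c _ => ?_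
    rw [h.drawn c c.is_lt, ← h.holds.weight, Fin.val_succ]
  rw [finishTree]
  simp only [exec_seq]
  set σ1 := weighTree.exec σ
  have hk1 : σ1.nvar vk = m + 1 := (ag.nvar vk rfl).trans h.current
  refine ⟨⟨?_, ?_, ?_, ?_, ?_, ?_, ?_, ?_, ?_, ?_⟩, ?_⟩
  · simpa using (ag.nvar nN rfl).trans h.holds.size
  · intro i j
    rw [exec_setN_rarr, exec_setR_rarr, ag.rarr aW rfl]
    exact h.holds.weight i j
  · rw [exec_setN_rarr, exec_setR_rarr, ag.rarr aL0 rfl]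
    exact h.holds.lap0
  · rw [exec_setN_rarr, exec_setR_rarr, ag.rarr aL0 rfl, ag.rarr aB0 rfl]
    exact h.holds.inv0
  · rw [exec_setN_rarr, exec_setR_rarr, ag.rarr aL0 rfl, ← h.holds.det0, ← ag.rvar xZ0 rfl]
    simp
  · intro s hs hm c
    rw [exec_setN_narr, exec_setR_narr, ag.narr aT rfl]
    by_cases hsm : s = m + 1
    · subst hsm
      rw [Function.update_self, h.drawn c c.is_lt]
    · rw [Function.update_of_ne hsm, h.holds.tree s hs (by omega)]
  · intro s hs hm
    rw [exec_setN_rarr, exec_setR_rarr]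
    by_cases hsm : s = m + 1
    · subst hsm
      rw [Function.update_self, hw]
    · rw [Function.update_of_ne hsm, hw1 s hsm, h.holds.treeWeight s hs (by omega)]
  · rw [map_range'_update, List.nodup_append]
    refine ⟨h.holds.nodup, List.nodup_singleton f, ?_⟩
    intro a ha b hb hab
    rw [List.mem_singleton] at hb
    exact hfs (hb ▸ hab ▸ ha)
  · rw [map_range'_update]
    intro g hg
    rcases List.mem_append.1 hg with hg | hg
    · exact h.holds.pos g hg
    · rw [List.mem_singleton.1 hg]
      exact hf
  · rw [map_range'_update]
    rw [restFuns_append_singleton (mem_restFuns_zero.2 ⟨hf, hfs⟩)]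
    have := (ag.rvar xZD0 rfl).trans h.holds.rest0
    simp [hk1, hw, this]
  · simp [hk1]

theorem drawTree_ev (σ : Store) (φ) : ev (drawTree.run σ) φ =
    ev ((startTree ;; loop vj n1 nN drawColumn ;; finishTree).run σ) φ := by
  have h : drawTree = (listTrees ;; setR xZ xZ0 ;; setR xZD xZD0 ;; copyMatrices ;;
      loop vj n1 nN drawColumn ;; putR aWt n0 vk (.lit 1) ;;
      loop vj n1 nN (
        putR aWt n0 vk (.get aWt n0 vk *ᵣ .get aW (.get aT vk vj) vj)) ;;
      setR xZD0 (xZD0 -ᵣ .get aWt n0 vk) ;; setN vd vk) := rfl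
  rw [h, startTree, finishTree, weighTree]
  simp only [ev_seq]

theorem ev_drawTree {G : RootedGraph N} {tr m} {σ : Store} (h : Drawn G tr m σ)
    (hpos : 0 < restWeight G ((List.range' 1 m).map tr) 0 noFun) (ψ : Store → ℝ≥0∞)
    (g : (Fin N → Fin (N + 1)) → ℝ≥0∞)
    (hg : ∀ f τ, Drawn G (Function.update tr (m + 1) f) (m + 1) τ → ψ τ = g f) :
    ev (drawTree.run { σ with nvar := Function.update σ.nvar vk (m + 1) }) ψ =
      ∑ f ∈ restFuns G ((List.range' 1 m).map tr) 0 noFun,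
        ENNReal.ofReal (funWeight G f / restWeight G ((List.range' 1 m).map tr) 0 noFun) * g f := by
  rw [drawTree_ev, ev_seq, ev_run_of_drawFree _ rfl, ev_seq]
  have h' : Drawn G tr m { σ with nvar := Function.update σ.nvar vk (m + 1) } :=
    ⟨h.holds.of_agree (by simp) rfl rfl rfl rfl (fun _ _ _ _ => rfl) rfl rfl,
      by simpa using h.count⟩
  have h0 := startTree_spec h' (by simp) hpos
  set σ0 := startTree.exec { σ with nvar := Function.update σ.nvar vk (m + 1) }
  have hcols := ev_drawColumns (G := G) (tr := tr) (m := m)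
    (fun τ => ev (finishTree.run τ) ψ) g (fun f τ hτ => by
      rw [ev_run_of_drawFree _ rfl]
      exact hg f _ (finishTree_spec hτ)) N 0 (zero_add N) noFun σ0 h0
  rw [← hcols]
  have hN : NExp.eval σ0 nN = N := h0.holds.size
  simp only [Stmt.run, ev_charge, hN]
  rfl

/-! ## The whole run -/

/-- The memory holds the trees `fs`. -/
def Sampled (G : RootedGraph N) (fs : List (Fin N → Fin (N + 1))) (σ : Store) : Prop :=
  ∃ tr, (List.range' 1 fs.length).map tr = fs ∧ Drawn G tr fs.length σ

/-- The bound `hK` guarantees that an undrawn tree of positive weight exists before each draw, hence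
that the process never gets stuck. -/
theorem ev_drawTrees {G : RootedGraph N} (ψ : Store → ℝ≥0∞)
    (h : List (Fin N → Fin (N + 1)) → ℝ≥0∞) {K : ℕ} (hK : K ≤ (posFuns G).card)
    (hψ : ∀ fs τ, fs.length = K → Sampled G fs τ → ψ τ = h fs)
    (k : ℕ) (fs : List (Fin N → Fin (N + 1))) (hk : fs.length + k = K) (σ : Store)
    (hσ : Sampled G fs σ) :
    ev (iter (fun v τ => drawTree.run { τ with nvar := Function.update τ.nvar vk v })
        (List.range' (fs.length + 1) k) σ) ψ = expectDraws G h k fs := by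
  induction k generalizing fs σ with
  | zero =>
    rw [List.range'_zero, ev_iter_nil]
    exact hψ fs σ (by omega) hσ
  | succ k ih =>
    rw [List.range'_succ, ev_iter_cons, expectDraws]
    obtain ⟨tr, htr, hdr⟩ := hσ
    have hpos := restWeight_zero_pos (G := G) (fs := fs) (by omega) noFun
    rw [← htr] at hpos
    have := ev_drawTree hdr hpos
      (fun τ => ev (iter (fun v τ => drawTree.run { τ with nvar := Function.update τ.nvar vk v })
        (List.range' (fs.length + 1 + 1) k) τ) ψ)
      (fun f => expectDraws G h k (fs ++ [f])) ?_
    · rw [htr] at this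
      exact this
    · intro f τ hτ
      have hlen : (fs ++ [f]).length = fs.length + 1 := by simp
      rw [← hlen]
      refine ih (fs ++ [f]) (by omega) τ ⟨Function.update tr (fs.length + 1) f, ?_, ?_⟩
      · rw [hlen, map_range'_update, htr]
      · rw [hlen]
        exact hτ

theorem readTrees_of_sampled {G : RootedGraph N} {fs : List (Fin N → Fin (N + 1))} {σ : Store}
    (h : Sampled G fs σ) : readTrees N fs.length σ = fs.map edgeSet := by
  obtain ⟨tr, htr, hdr⟩ := h
  conv_rhs => rw [← htr]
  rw [readTrees, List.map_map]
  refine List.map_congr_left fun s hs => ?_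
  have hs' := List.mem_range'_1.1 hs
  ext ⟨i, j⟩
  simp only [readTree, Finset.mem_filter, Finset.mem_univ, true_and, Function.comp]
  refine Fin.cases ?_ (fun c => ?_) j
  · simp [mem_edgeSet, Fin.succ_ne_zero]
  · rw [Fin.val_succ, hdr.holds.tree s hs'.1 (by omega) c, mem_edgeSet_succ]
    simp [Fin.succ_ne_zero, Fin.val_inj]

def setup : Stmt := laplacian ;; detAndInverse ;; setR xZD0 xZ0 ;; setN vd n0

theorem input_weight (G : RootedGraph N) (K : ℕ) (i j : Fin (N + 1)) :
    (input G K).rarr aW i j = G.weight i j := by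
  simp only [input]
  rw [if_pos trivial, dif_pos ⟨i.is_lt, j.is_lt⟩]

/-- The determinant of the Laplacian is the total weight of the trees, positive by hypothesis, so
the elimination succeeds. A tree of positive weight has a root edge, which forces `N > 0`. -/
theorem setup_spec {G : RootedGraph N} {K : ℕ} (hpos : 0 < (posFuns G).card) :
    Sampled G [] (setup.exec (input G K)) ∧ (setup.exec (input G K)).nvar nK = K := by
  classical
  obtain ⟨f, hf⟩ := Finset.card_pos.1 hpos
  have hN : 0 < N := by
    obtain ⟨⟨-, c, -⟩, -⟩ := mem_posFuns.1 hf
    exact c.pos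
  rw [setup]
  simp only [exec_seq]
  have hlap := laplacian_spec G (σ := input G K) (by simp [input])
    (input_weight G K)
  have ag1 := exec_agree laplacian (input G K)
  set σ1 := laplacian.exec (input G K)
  have hN1 : σ1.nvar nN = N := (ag1.nvar nN rfl).trans (by simp [input])
  have hdet : (mat N (σ1.rarr aL0)).det = restWeight G [] 0 noFun := by
    rw [hlap, ← lap_condWeights_zero G noFun, det_lap_condWeights hN, restWeight]
    refine Finset.sum_congr ?_ fun _ _ => rfl
    ext g
    simp [mem_restFuns]
  have hrest := restWeight_zero_pos (G := G) (fs := []) hpos noFun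
  obtain ⟨hZ, hB⟩ := detAndInverse_spec hN1 (by rw [hdet]; exact hrest.ne')
  have ag2 := exec_agree detAndInverse σ1
  set σ2 := detAndInverse.exec σ1
  -- No tree is stored yet, so the numbering of trees is arbitrary.
  refine ⟨⟨fun _ => noFun, rfl, ⟨?_, ?_, ?_, ?_, ?_, ?_, ?_, ?_, ?_, ?_⟩, ?_⟩, ?_⟩
  · simpa using (ag2.nvar nN rfl).trans hN1
  · intro i j
    rw [exec_setN_rarr, exec_setR_rarr, ag2.rarr aW rfl, ag1.rarr aW rfl]
    exact input_weight G K i j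
  · rw [exec_setN_rarr, exec_setR_rarr, ag2.rarr aL0 rfl, hlap]
  · rw [exec_setN_rarr, exec_setR_rarr, ag2.rarr aL0 rfl, hB]
  · rw [exec_setN_rarr, exec_setR_rarr, ag2.rarr aL0 rfl, ← hZ]
    simp
  · intro s hs hs'
    simp at hs'
    omega
  · intro s hs hs'
    simp at hs'
    omega
  · simp
  · simp
  · have : σ2.rvar xZ0 = restWeight G [] 0 noFun := hZ.trans hdet
    simpa using this
  · simp
  · simp
    rw [ag2.nvar nK rfl, ag1.nvar nK rfl]
    simp [input]

/-- The expectation of a function of the output. -/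
theorem ev_swor {G : RootedGraph N} {K : ℕ} (hK : 0 < K) (hcard : K ≤ (posFuns G).card)
    (h : List (EdgeSet N) → ℝ≥0∞) :
    ev (swor.run (input G K)) (fun σ => h (readTrees N K σ)) =
      expectDraws G (fun fs => h (fs.map edgeSet)) K [] := by
  have hsw : swor = (laplacian ;; detAndInverse ;; setR xZD0 xZ0 ;; setN vd n0 ;;
    loop vk n1 nK drawTree) := rfl
  have hseq : ∀ φ, ev (swor.run (input G K)) φ =
      ev ((setup ;; loop vk n1 nK drawTree).run (input G K)) φ := fun φ => by
    rw [hsw, setup]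
    simp only [ev_seq]
  obtain ⟨hs, hKreg⟩ := setup_spec (G := G) (K := K) (hK.trans_le hcard)
  rw [hseq, ev_seq, ev_run_of_drawFree _ rfl]
  set σ0 := setup.exec (input G K)
  have := ev_drawTrees (fun σ => h (readTrees N K σ)) (fun fs => h (fs.map edgeSet)) hcard
    (fun fs τ hlen hτ => by rw [← hlen, readTrees_of_sampled hτ]) K [] (by simp) σ0 hs
  rw [← this]
  have hev : NExp.eval σ0 nK = K := hKreg
  simp only [Stmt.run, ev_charge, hev]
  rfl

/-! ## Running time -/

/-- Every run costs at most `c` steps, and `Q` holds afterwards if it is not aborted. -/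
def Within (p : RunLaw) (c : ℕ) (Q : Store → Prop) : Prop :=
  ∀ r ∈ p.support, r.2 ≤ c ∧ ∀ τ, r.1 = some τ → Q τ

theorem Within.mono {p : RunLaw} {c c' : ℕ} {Q Q' : Store → Prop} (h : Within p c Q) (hc : c ≤ c')
    (hQ : ∀ τ, Q τ → Q' τ) : Within p c' Q' :=
  fun r hr => ⟨(h r hr).1.trans hc, fun τ hτ => hQ τ ((h r hr).2 τ hτ)⟩

theorem within_done {σ : Store} {c : ℕ} {Q : Store → Prop} (h : Q σ) : Within (done σ c) c Q := by
  intro r hr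
  rw [done, PMF.support_pure, Set.mem_singleton_iff] at hr
  subst hr
  refine ⟨le_rfl, ?_⟩
  rintro τ ⟨⟩
  exact h

theorem Within.charge {p : RunLaw} {c k : ℕ} {Q : Store → Prop} (h : Within p c Q) :
    Within (charge k p) (k + c) Q := by
  intro r hr
  rw [RealRAM.charge, PMF.support_map] at hr
  obtain ⟨r', hr', rfl⟩ := hr
  exact ⟨Nat.add_le_add_left (h r' hr').1 k, (h r' hr').2⟩

theorem Within.andThen {p : RunLaw} {f : Store → RunLaw} {c d : ℕ} {P Q : Store → Prop}
    (h : Within p c P) (hf : ∀ σ, P σ → Within (f σ) d Q) : Within (andThen p f) (c + d) Q := by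
  intro r hr
  rw [RealRAM.andThen, PMF.mem_support_bind_iff] at hr
  obtain ⟨⟨o, k⟩, hr', hr⟩ := hr
  obtain ⟨hk, hP⟩ := h _ hr'
  cases o with
  | none =>
    simp only [PMF.support_pure, Set.mem_singleton_iff] at hr
    subst hr
    exact ⟨hk.trans (Nat.le_add_right _ _), fun τ hτ => by simp at hτ⟩
  | some σ =>
    obtain ⟨h1, h2⟩ := (hf σ (hP σ rfl)).charge (k := k) r hr
    exact ⟨h1.trans (Nat.add_le_add_right hk d), h2⟩

theorem within_iter {f : ℕ → Store → RunLaw} {c : ℕ} {P : Store → Prop} (l : List ℕ)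
    (h : ∀ x ∈ l, ∀ σ, P σ → Within (f x σ) c P) {σ : Store} (hσ : P σ) :
    Within (iter f l σ) (l.length * (1 + c)) P := by
  induction l generalizing σ with
  | nil => exact (within_done (c := 0) hσ).mono (Nat.zero_le _) fun _ h => h
  | cons x l ih =>
    rw [List.length_cons, Nat.succ_mul, Nat.add_comm]
    refine Within.andThen (h x (List.mem_cons_self) σ hσ).charge fun τ hτ => ?_
    exact ih (fun y hy => h y (List.mem_cons_of_mem _ hy)) hτ

theorem within_seq {s₁ s₂ : Stmt} {σ : Store} {c d : ℕ} {P Q : Store → Prop}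
    (h : Within (s₁.run σ) c P) (hf : ∀ σ, P σ → Within (s₂.run σ) d Q) :
    Within ((Stmt.seq s₁ s₂).run σ) (c + d) Q := h.andThen hf

/-- The value of a loop bound if `nN` is `n` and `vd` is `d`. -/
def NExp.bound (n d : ℕ) : NExp → ℕ
  | .var nN => n
  | .var vd => d
  | _ => 0

def NExp.isBound : NExp → Bool
  | .var nN => true
  | .var vd => true
  | _ => false

/-- A bound for the cost of a statement if `nN` is `n` and `vd` is at most `d`. -/
def Stmt.bound (n d : ℕ) : Stmt → ℕ
  | .skip => 1
  | .setN _ e => e.cost + 1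
  | .setR _ e => e.cost + 1
  | .putN _ i j e => i.cost + j.cost + e.cost + 1
  | .putR _ i j e => i.cost + j.cost + e.cost + 1
  | .seq s₁ s₂ => s₁.bound n d + s₂.bound n d
  | .ite b s₁ s₂ => b.cost + 1 + (s₁.bound n d + s₂.bound n d)
  | .loop _ lo hi body => lo.cost + hi.cost + 1 + (hi.bound n d + 1) * (1 + body.bound n d)
  | .draw _ _ e => e.cost + (e.bound n d + 1) + 1

/-- `nN` and `vd` bound all loops and are not changed before the end. -/
def Stmt.hasBound : Stmt → Bool
  | .seq s₁ s₂ => s₁.hasBound && s₂.hasBound && !s₁.writesN nN && !s₁.writesN vd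
  | .ite _ s₁ s₂ => s₁.hasBound && s₂.hasBound
  | .loop x _ hi body =>
    hi.isBound && body.hasBound && !(Stmt.loop x hi hi body).writesN nN &&
      !(Stmt.loop x hi hi body).writesN vd
  | .draw _ _ e => e.isBound
  | _ => true

theorem eval_le_bound {e : NExp} {σ : Store} {n d : ℕ} (h : e.isBound = true)
    (hn : σ.nvar nN = n) (hd : σ.nvar vd ≤ d) : e.eval σ ≤ e.bound n d := by
  unfold NExp.isBound at h
  split at h
  · exact hn.le
  · exact hd
  · contradiction

/-- The frame property is proved together with the cost, because the loop bounds of later code must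
still be those of the start. Both branches of a conditional are charged, and `hi + 1` passes cover
any lower bound of a loop. -/
theorem within_bound (s : Stmt) (hs : s.hasBound = true) {n d : ℕ} {σ : Store}
    (hn : σ.nvar nN = n) (hd : σ.nvar vd ≤ d) :
    Within (s.run σ) (s.bound n d) fun τ => ∀ x, s.writesN x = false → τ.nvar x = σ.nvar x := by
  induction s generalizing σ with
  | seq a b iha ihb =>
    simp only [Stmt.hasBound, Bool.and_eq_true, Bool.not_eq_true'] at hs
    obtain ⟨⟨⟨ha, hb⟩, h1⟩, h2⟩ := hs
    refine within_seq (iha ha hn hd) fun τ hτ => ?_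
    refine (ihb hb ((hτ _ h1).trans hn) ((hτ _ h2).trans_le hd)).mono le_rfl fun υ hυ x hx => ?_
    simp only [Stmt.writesN, Bool.or_eq_false_iff] at hx
    exact (hυ x hx.2).trans (hτ x hx.1)
  | ite b s₁ s₂ h₁ h₂ =>
    simp only [Stmt.hasBound, Bool.and_eq_true] at hs
    simp only [Stmt.run]
    refine Within.charge ?_
    split_ifs
    · refine (h₁ hs.1 hn hd).mono (Nat.le_add_right _ _) fun υ hυ x hx => ?_
      simp only [Stmt.writesN, Bool.or_eq_false_iff] at hx
      exact hυ x hx.1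
    · refine (h₂ hs.2 hn hd).mono (Nat.le_add_left _ _) fun υ hυ x hx => ?_
      simp only [Stmt.writesN, Bool.or_eq_false_iff] at hx
      exact hυ x hx.2
  | loop x lo hi body ih =>
    simp only [Stmt.hasBound, Bool.and_eq_true, Bool.not_eq_true'] at hs
    obtain ⟨⟨⟨h1, h2⟩, h3⟩, h4⟩ := hs
    have key := within_iter (f := fun v τ => body.run { τ with nvar := Function.update τ.nvar x v })
      (c := body.bound n d)
      (P := fun τ => ∀ y, (Stmt.loop x hi hi body).writesN y = false → τ.nvar y = σ.nvar y)
      (List.range' (lo.eval σ) (hi.eval σ + 1 - lo.eval σ)) ?_ (σ := σ) (fun _ _ => rfl)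
    · simp only [Stmt.run]
      refine (key.mono ?_ fun _ h => h).charge
      rw [List.length_range']
      have := eval_le_bound h1 hn hd
      exact Nat.mul_le_mul_right _ (by omega)
    · intro v _ τ hτ
      have hx : ∀ y, (Stmt.loop x hi hi body).writesN y = false →
          ({ τ with nvar := Function.update τ.nvar x v } : Store).nvar y = σ.nvar y := by
        intro y hy
        have hyx : y ≠ x := by
          rintro rfl
          simp [Stmt.writesN] at hy
        rw [← hτ y hy]
        exact Function.update_of_ne hyx _ _
      refine (ih h2 ((hx _ h3).trans hn) ((hx _ h4).trans_le hd)).mono le_rfl fun υ hυ y hy => ?_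
      rw [← hx y hy]
      simp only [Stmt.writesN, Bool.or_eq_false_iff] at hy
      exact hυ y hy.2
  | draw y a e =>
    have hle := eval_le_bound hs hn hd
    simp only [Stmt.run, Stmt.bound]
    split_ifs with hp
    · intro r hr
      rw [PMF.support_map] at hr
      obtain ⟨v, -, rfl⟩ := hr
      refine ⟨by simp only; omega, ?_⟩
      rintro τ ⟨⟩ x hx
      simp only [Stmt.writesN, decide_eq_false_iff_not] at hx
      exact Function.update_of_ne (Ne.symm hx) _ _
    · intro r hr
      rw [PMF.support_pure, Set.mem_singleton_iff] at hr
      subst hr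
      exact ⟨by simp only; omega, fun τ hτ => by simp at hτ⟩
  | setN y e =>
    refine within_done fun x hx => ?_
    simp only [Stmt.writesN, decide_eq_false_iff_not] at hx
    exact Function.update_of_ne (Ne.symm hx) _ _
  | _ => exact within_done fun _ _ => rfl

theorem eq_exec_of_mem_support {s : Stmt} (hs : s.drawFree = true) {σ : Store}
    {r : Option Store × ℕ} (hr : r ∈ (s.run σ).support) : r.1 = some (s.exec σ) := by
  classical
  have h1 : ev (s.run σ) (fun τ => if τ = s.exec σ then 1 else 0) = 1 := by
    rw [ev_run_of_drawFree s hs, if_pos rfl]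
  have h2 := eq_one_of_tsum_mul_eq_one _
    (fun r : Option Store × ℕ => r.1.elim 0 fun τ => if τ = s.exec σ then (1 : ℝ≥0∞) else 0)
    (fun r => by
      cases r.1 with
      | none => simp
      | some τ => simp only [Option.elim]; split_ifs <;> simp) h1 r hr
  obtain ⟨_ | τ, k⟩ := r
  · simp at h2
  · by_contra hne
    have hne' : τ ≠ s.exec σ := fun h => hne (by rw [h])
    simp [hne'] at h2

/-- Makes the functional specifications of draw-free code available in the cost analysis. -/
theorem within_exec {s : Stmt} (hs : s.drawFree = true) {σ : Store} {c : ℕ} {Q : Store → Prop}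
    (h : Within (s.run σ) c Q) : Within (s.run σ) c fun τ => τ = s.exec σ := by
  intro r hr
  refine ⟨(h r hr).1, fun τ hτ => ?_⟩
  rw [eq_exec_of_mem_support hs hr] at hτ
  exact (Option.some.inj hτ).symm

/-- The registers that control the running time of `drawTree`. -/
def Control (n d k : ℕ) (σ : Store) : Prop := σ.nvar nN = n ∧ σ.nvar vd ≤ d ∧ σ.nvar vk = k

theorem within_control (s : Stmt) (hs : s.hasBound = true) (h1 : s.writesN nN = false)
    (h2 : s.writesN vd = false) (h3 : s.writesN vk = false) {n d k : ℕ} {σ : Store}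
    (h : Control n d k σ) : Within (s.run σ) (s.bound n d) (Control n d k) :=
  (within_bound s hs h.1 h.2.1).mono le_rfl fun _ hτ =>
    ⟨(hτ _ h1).trans h.1, (hτ _ h2).trans_le h.2.1, (hτ _ h3).trans h.2.2⟩

/-- Conditioning rewrites `vd`, which the textual analysis cannot control; the new value is the
length of a filtered list. -/
theorem condition_vd_le (σ : Store) : (condition.exec σ).nvar vd ≤ σ.nvar vd := by
  rw [condition_exec]
  set σ7 := inverseUpdate.exec
    (saveColumn.exec (changeTimesInverse.exec ((setR xZ (xZ *ᵣ xp)).exec (updateFactor.exec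
      (columnUpdate.exec (columnChange.exec σ)))))) with h7
  have hd : σ7.nvar vd = σ.nvar vd := by
    rw [h7, (exec_agree inverseUpdate _).nvar vd rfl, (exec_agree saveColumn _).nvar vd rfl,
      (exec_agree changeTimesInverse _).nvar vd rfl, exec_setR_nvar,
      (exec_agree updateFactor _).nvar vd rfl, (exec_agree columnUpdate _).nvar vd rfl,
      (exec_agree columnChange _).nvar vd rfl]
  have h1 := congrArg List.length (filterTrees_spec hd).1
  have hlen : ∀ (υ : Store) (m : ℕ), (dlist υ m).length = m := fun _ m => by simp [dlist]
  rw [hlen] at h1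
  rw [h1]
  exact (List.length_filter_le _ _).trans_eq (hlen _ _)

theorem within_condition {n d k : ℕ} {σ : Store} (h : Control n d k σ) :
    Within (condition.run σ) (condition.bound n d) (Control n d k) := by
  refine (within_exec rfl (within_bound condition rfl h.1 h.2.1)).mono le_rfl ?_
  rintro τ rfl
  have ag := exec_agree condition σ
  exact ⟨(ag.nvar nN rfl).trans h.1, (condition_vd_le σ).trans h.2.1, (ag.nvar vk rfl).trans h.2.2⟩

/-- The rank-one update accounts for `n²`, the two scans of the listed trees for `d`; `600` absorbs
the constants of the textual count. -/
theorem bound_drawColumn {n d : ℕ} (hn : 0 < n) :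
    sampleEdge.bound n d + ((putN aT vk vj ve).bound n d + condition.bound n d) ≤
      600 * (n ^ 2 + d) := by
  simp only [sampleEdge, condition, Stmt.bound, NExp.bound, NExp.cost, RExp.cost, BExp.cost]
  have h1 : n ≤ n ^ 2 := Nat.le_self_pow (by norm_num) n
  have h2 : 1 ≤ n ^ 2 := Nat.one_le_pow _ _ hn
  ring_nf
  omega

theorem within_drawColumn {n d k : ℕ} (hn : 0 < n) {σ : Store} (h : Control n d k σ) :
    Within (drawColumn.run σ) (600 * (n ^ 2 + d)) (Control n d k) :=
  (within_seq (within_control sampleEdge rfl rfl rfl rfl h) fun _ h1 =>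
    within_seq (within_control (putN aT vk vj ve) rfl rfl rfl rfl h1) fun _ h2 =>
      within_condition h2).mono (bound_drawColumn hn) fun _ h => h

/-- At most `K` trees are listed throughout, so the `n` columns cost `n (n² + K)` up to a constant.
The condition `k ≤ K` restores the bound on `vd` when it is finally set to `k`. -/
theorem within_drawTree {n K k : ℕ} (hn : 0 < n) (hk : k ≤ K) {σ : Store} (h : Control n K k σ) :
    Within (drawTree.run σ) (2000 * (n ^ 3 + n * K)) fun τ => τ.nvar nN = n ∧ τ.nvar vd ≤ K := by
  have hdef : drawTree = (listTrees ;; setR xZ xZ0 ;; setR xZD xZD0 ;; copyMatrices ;;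
      loop vj n1 nN drawColumn ;; putR aWt n0 vk (.lit 1) ;;
      loop vj n1 nN (
        putR aWt n0 vk (.get aWt n0 vk *ᵣ .get aW (.get aT vk vj) vj)) ;;
      setR xZD0 (xZD0 -ᵣ .get aWt n0 vk) ;; setN vd vk) := rfl
  rw [hdef]
  have hcols : ∀ τ, Control n K k τ → Within ((loop vj n1 nN drawColumn).run τ)
      (3 + n * (1 + 600 * (n ^ 2 + K))) (Control n K k) := by
    intro τ hτ
    have key := within_iter
      (f := fun v τ => drawColumn.run { τ with nvar := Function.update τ.nvar vj v })
      (List.range' 1 n)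
      (fun v _ υ (hυ : Control n K k υ) => within_drawColumn hn
        (σ := { υ with nvar := Function.update υ.nvar vj v })
        ⟨by simpa using hυ.1, by simpa using hυ.2.1, by simpa using hυ.2.2⟩) hτ
    rw [List.length_range'] at key
    have hev : NExp.eval τ nN = n := hτ.1
    simp only [Stmt.run, hev]
    exact key.charge
  have hlast : ∀ τ, Control n K k τ → Within ((setN vd vk).run τ) 2
      fun τ => τ.nvar nN = n ∧ τ.nvar vd ≤ K := fun τ h =>
    within_done ⟨by simpa using h.1, by simpa [h.2.2] using hk⟩
  have hall := within_seq (within_control listTrees rfl rfl rfl rfl h) fun _ h =>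
    within_seq (within_control (setR xZ xZ0) rfl rfl rfl rfl h) fun _ h =>
    within_seq (within_control (setR xZD xZD0) rfl rfl rfl rfl h) fun _ h =>
    within_seq (within_control copyMatrices rfl rfl rfl rfl h) fun _ h =>
    within_seq (hcols _ h) fun _ h =>
    within_seq (within_control (putR aWt n0 vk (.lit 1)) rfl rfl rfl rfl h) fun _ h =>
    within_seq (within_control (loop vj n1 nN (
        putR aWt n0 vk (.get aWt n0 vk *ᵣ .get aW (.get aT vk vj) vj))) rfl rfl rfl rfl h)
      fun _ h =>
    within_seq (within_control (setR xZD0 (xZD0 -ᵣ .get aWt n0 vk)) rfl rfl rfl rfl h) hlast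
  refine hall.mono ?_ fun _ h => h
  simp only [listTrees, copyMatrices, Stmt.bound, NExp.bound, NExp.cost, RExp.cost]
  have h1 : n ≤ n ^ 3 := Nat.le_self_pow (by norm_num) n
  have h2 : 1 ≤ n ^ 3 := Nat.one_le_pow _ _ hn
  have h3 : n ^ 2 ≤ n ^ 3 := Nat.pow_le_pow_right hn (by norm_num)
  have h4 : K ≤ K * n := Nat.le_mul_of_pos_right K hn
  ring_nf
  omega

theorem bound_setup {n : ℕ} (hn : 0 < n) (d : ℕ) :
    laplacian.bound n d + (detAndInverse.bound n d + ((setR xZD0 xZ0).bound n d +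
      (setN vd n0).bound n d)) ≤ 1000 * n ^ 3 := by
  simp only [laplacian, detAndInverse, eliminate, Stmt.bound, NExp.bound, NExp.cost, RExp.cost,
    BExp.cost]
  have h1 : n ≤ n ^ 3 := Nat.le_self_pow (by norm_num) n
  have h2 : 1 ≤ n ^ 3 := Nat.one_le_pow _ _ hn
  have h3 : n ^ 2 ≤ n ^ 3 := Nat.pow_le_pow_right hn (by norm_num)
  ring_nf
  omega

theorem within_swor {N K : ℕ} (hN : 0 < N) (hK : 0 < K) (G : RootedGraph N) :
    Within (swor.run (input G K)) (3010 * (K * N ^ 3 + K ^ 2 * N)) fun _ => True := by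
  have hdef : swor = (laplacian ;; detAndInverse ;; setR xZD0 xZ0 ;; setN vd n0 ;;
    loop vk n1 nK drawTree) := rfl
  rw [hdef]
  have hstep : ∀ s : Stmt, s.hasBound = true → s.writesN nN = false → s.writesN nK = false →
      s.writesN vd = false → ∀ σ : Store, σ.nvar nN = N ∧ σ.nvar nK = K ∧ σ.nvar vd = 0 →
      Within (s.run σ) (s.bound N 0) fun σ => σ.nvar nN = N ∧ σ.nvar nK = K ∧ σ.nvar vd = 0 :=
    fun s hs h1 h2 h3 σ h => (within_bound s hs h.1 h.2.2.le).mono le_rfl fun τ hτ =>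
      ⟨(hτ _ h1).trans h.1, (hτ _ h2).trans h.2.1, (hτ _ h3).trans h.2.2⟩
  have htrees : ∀ τ : Store, τ.nvar nN = N ∧ τ.nvar nK = K ∧ τ.nvar vd = 0 →
      Within ((loop vk n1 nK drawTree).run τ) (3 + K * (1 + 2000 * (N ^ 3 + N * K)))
        fun _ => True := by
    intro τ hτ
    have key := within_iter
      (f := fun v τ => drawTree.run { τ with nvar := Function.update τ.nvar vk v })
      (P := fun τ => τ.nvar nN = N ∧ τ.nvar vd ≤ K)
      (List.range' 1 K)
      (fun v hv υ hυ => within_drawTree hN (k := v) (by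
          have := List.mem_range'_1.1 hv
          omega)
        (σ := { υ with nvar := Function.update υ.nvar vk v })
        ⟨by simpa using hυ.1, by simpa using hυ.2, by simp⟩) (σ := τ) ⟨hτ.1, by omega⟩
    rw [List.length_range'] at key
    have hev : NExp.eval τ nK = K := hτ.2.1
    simp only [Stmt.run, hev]
    exact key.charge.mono le_rfl fun _ _ => trivial
  have hzero : ∀ τ : Store, τ.nvar nN = N ∧ τ.nvar nK = K ∧ τ.nvar vd = 0 →
      Within ((setN vd n0).run τ) 2 fun σ => σ.nvar nN = N ∧ σ.nvar nK = K ∧ σ.nvar vd = 0 :=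
    fun τ h => within_done ⟨by simpa using h.1, by simpa using h.2.1, by simp⟩
  have hall := within_seq (hstep laplacian rfl rfl rfl rfl (input G K) (by simp [input])) fun _ h =>
    within_seq (hstep detAndInverse rfl rfl rfl rfl _ h) fun _ h =>
    within_seq (hstep (setR xZD0 xZ0) rfl rfl rfl rfl _ h) fun τ h =>
    within_seq (hzero τ h) htrees
  refine hall.mono ?_ fun _ h => h
  -- In units of `K N³` the setup counts `1000` and the overhead of the outer loop `3 + 1`; the
  -- trees add `2000` in both terms.
  have hb := bound_setup hN 0
  have hb' : (setN vd n0).bound N 0 = 2 := rfl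
  rw [hb'] at hb
  have h1 : N ^ 3 ≤ K * N ^ 3 := Nat.le_mul_of_pos_left _ hK
  have h2 : K ≤ K * N ^ 3 := Nat.le_mul_of_pos_right _ (Nat.pow_pos hN)
  have h3 : 1 ≤ K * N ^ 3 := (Nat.succ_le_of_lt hK).trans h2
  have h4 : K * (1 + 2000 * (N ^ 3 + N * K)) = K + 2000 * (K * N ^ 3) + 2000 * (K ^ 2 * N) := by
    ring
  rw [h4]
  omega

/-! ### Almost sure output and prefix probabilities -/

theorem card_pos_depTrees (G : RootedGraph N) :
    (G.depTrees.filter fun t => 0 < G.treeWeight t).card = (posFuns G).card := by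
  classical
  rw [← Finset.card_image_of_injective (posFuns G) edgeSet_injective, ← filter_pos_depTrees]

theorem mem_depTrees_of_posFuns {G : RootedGraph N} {f : Fin N → Fin (N + 1)}
    (hf : f ∈ posFuns G) : edgeSet f ∈ G.depTrees := by
  classical
  have h := Finset.mem_image_of_mem edgeSet hf
  rw [← filter_pos_depTrees] at h
  exact (Finset.mem_filter.1 h).1

/-- The indicator of a correct output has expectation one and aborted runs count as zero, so every
outcome of positive probability is a correct, completed run. -/
theorem sworRun_support {G : RootedGraph N} {K : ℕ} (hK : 0 < K) (hcard : K ≤ (posFuns G).card)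
    {r : Option (List (EdgeSet N)) × ℕ} (hr : r ∈ (sworRun G K).support) :
    ∃ ts : List (EdgeSet N),
      r.1 = some ts ∧ ts.length = K ∧ ts.Nodup ∧ ∀ t ∈ ts, t ∈ G.depTrees := by
  classical
  rw [sworRun, PMF.support_map] at hr
  obtain ⟨r', hr', rfl⟩ := hr
  let good : List (EdgeSet N) → Prop := fun ts =>
    ts.length = K ∧ ts.Nodup ∧ ∀ t ∈ ts, t ∈ G.depTrees
  have h1 := ev_swor hK hcard fun ts => if good ts then 1 else 0
  rw [expectDraws_congr (h' := fun _ => 1) K [], expectDraws_one K [] (by simpa using hcard)] at h1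
  · have h2 := eq_one_of_tsum_mul_eq_one _
      (fun r : Option Store × ℕ =>
        r.1.elim 0 fun τ => if good (readTrees N K τ) then (1 : ℝ≥0∞) else 0)
      (fun r => by
        cases r.1 with
        | none => simp
        | some τ => simp only [Option.elim]; split_ifs <;> simp) h1 r' hr'
    obtain ⟨_ | τ, k⟩ := r'
    · simp at h2
    · refine ⟨readTrees N K τ, rfl, ?_⟩
      by_contra hne
      have : ¬ good (readTrees N K τ) := hne
      simp [this] at h2
  · intro gs _ hlen hgs
    obtain ⟨hnd, hpos⟩ := hgs ⟨List.nodup_nil, by simp⟩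
    rw [if_pos]
    refine ⟨by simpa using hlen, hnd.map edgeSet_injective, ?_⟩
    intro t ht
    obtain ⟨f, hf, rfl⟩ := List.mem_map.1 ht
    exact mem_depTrees_of_posFuns (hpos f hf)

/-- The probability of the event is the expectation of its indicator, and aborted runs lie outside
it. -/
theorem prefixProb_eq {G : RootedGraph N} {K : ℕ} (hK : 0 < K) (hcard : K ≤ (posFuns G).card)
    (D : List (EdgeSet N)) (hD : D.length ≤ K) : prefixProb G K D = nextProb G [] D := by
  classical
  rw [← expectDraws_prefix D K [] hD (by simpa using hcard)]
  refine Eq.trans ?_ (ev_swor hK hcard fun ts => if D <+: ts then 1 else 0)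
  rw [prefixProb, sworRun, PMF.toOuterMeasure_map_apply, PMF.toOuterMeasure_apply, ev]
  refine tsum_congr fun r => ?_
  obtain ⟨_ | τ, k⟩ := r
  · simp [Set.indicator]
  · by_cases h : D <+: readTrees N K τ
    · simp [Set.indicator, h]
    · simp [Set.indicator, h]

end RealRAM

theorem mainTheorem2 :
    -- correctness
    (∀ (N K : ℕ) (G : RootedGraph N), 0 < K →
      K ≤ (G.depTrees.filter fun t => 0 < G.treeWeight t).card →
        (∀ r ∈ (RealRAM.sworRun G K).support, ∃ ts : List (EdgeSet N),
          r.1 = some ts ∧ ts.length = K ∧ ts.Nodup ∧ ∀ t ∈ ts, t ∈ G.depTrees) ∧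
        (∀ D : List (EdgeSet N), D.length < K → ∀ t ∈ G.depTrees,
          RealRAM.prefixProb G K (D ++ [t]) =
            RealRAM.prefixProb G K D * ENNReal.ofReal (G.condProb D.toFinset t))) ∧
    -- running time
    (∃ C : ℕ, ∀ (N K : ℕ) (G : RootedGraph N), 0 < N → 0 < K →
      ∀ r ∈ (RealRAM.sworRun G K).support, r.2 ≤ C * (K * N ^ 3 + K ^ 2 * N)) := by
  refine ⟨fun N K G hK hcard => ?_, 3010, fun N K G hN hK r hr => ?_⟩
  · have hcard' : K ≤ (Arborescence.posFuns G).card := by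
      rw [← RealRAM.card_pos_depTrees]
      convert hcard
    refine ⟨fun r hr => RealRAM.sworRun_support hK hcard' hr, fun D hD t ht => ?_⟩
    rw [RealRAM.prefixProb_eq hK hcard' _ (by simpa using hD),
      RealRAM.prefixProb_eq hK hcard' _ hD.le, Arborescence.nextProb_append G D ht]
    simp only [List.map_nil, List.nil_append]
  · rw [RealRAM.sworRun, PMF.support_map] at hr
    obtain ⟨r', hr', rfl⟩ := hr
    exact (RealRAM.within_swor hN hK G r' hr').1
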